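/- Fix integers $d_1,d_2,g\ge 1$ and a multiset $\Delta=\{L_1,\dots,L_{d_2}\}$ of integers with $\sum_i L_i=0$, and put $n=2d_2+g-1$. **Pearl side.** A *pearl chain* of type $(d_2,g)$ is a connected finite graph $\mathcal P$ of first Betti number $g$ with $d_2$ white and $d_2+g-1$ black vertices, in which every edge joins a white and a black vertex, every black vertex is $2$-valent and there is no cycle of length two. Let $E=\mathbb R/T\mathbb Z$ ($T>0$) and let $P_1,\dots,P_n\in E$ be distinct points. A *curled pearl chain* of type $(\Delta,d_2,g)$ is a surjective map $\pi:\mathcal P'\to E$, where $\mathcal P'$ is a pearl chain of type $(d_2,g)$ with positive edge lengths, such that $\pi$ is affine on every edge $e$ with slope a positive integer $w_e$ (the expansion factor, for the suitable direction of $e$), each $\pi^{-1}(P_i)$ contains exactly one vertex, at every black vertex the sum of the $w_e$ of the incoming edges equals that of the outgoing edges (with respect to the orientation of $E$), and the differences "incoming minus outgoing" at the white vertices form the multiset $\Delta$. Its degree is the minimum over all $a\in E$ and both flags $f'$ at $a$ of the sum of the expansion factors of the flags of $\mathcal P'$ lying over $f'$; its multiplicity is $\prod_e w_e$. Let $N^{\mathrm{pearl}}_{(\Delta,d_1,d_2,g)}$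 be the number of isomorphism classes of curled pearl chains of type $(\Delta,d_2,g)$ and degree $d_1$, counted with multiplicity. **Tropical side.** A *tropical stable map* to $E_{\mathbb T}\times\mathbb P^1_{\mathbb T}$ of leaky degree $\Delta$ is a map $f:\Gamma\to\mathbb R^2$ from a (not necessarily connected) metric graph with unbounded ends, affine with integer direction vectors on edges and balanced at all vertices, whose ends are: $n$ contracted ends labelled $x_1,\dots,x_n$; $d_2$ ends of direction $(0,-1)$; one end of direction $(L_i,1)$ for each $i$; and horizontal ends of directions $(w,0)$ and $(-w,0)$, $w\geq 1$, which are matched in pairs consisting of one end of direction $(w,0)$ and one of direction $(-w,0)$ with the same $w$ and the same $y$-coordinate (components of $\Gamma$ that are a single horizontal line are allowed). Glueing the pairs gives a graph $\Gamma'$; the map is connected if $\Gamma'$ is, its genus is the first Betti number of $\Gamma'$, and maps giving the same glued graph and map are identified. Its bidegree is $(d_1,d_2)$, where $d_1$ is the minimum, over all vertical lines through no vertex, of the total absolute horizontal direction component (with multiplicity) of the edges crossing the line, the ends of direction $(L_i,1)$ being disregarded. If all vertices are $3$-valent and $f$ is an embedding locally around each vertex not adjacent to a contracted end, its multiplicity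 is $\prod_V|\det(v_1,v_2)|$, over the vertices $V$ not adjacent to a contracted end, $v_1,v_2$ being the directions of two of the edges at $V$. For $p=(p_1,\dots,p_n)\in(\mathbb R^2)^n$ let $N^{\mathrm{trop}}_{(\Delta,d_1,d_2,g)}(p)$ be the number of connected tropical stable maps of leaky degree $\Delta$, bidegree $(d_1,d_2)$ and genus $g$ with $f(x_i)=p_i$ for all $i$ for which this multiplicity is defined, counted with multiplicity. **Theorem.** For generic horizontally stretched point conditions $p$, both counts are finite and $$N^{\mathrm{pearl}}_{(\Delta,d_1,d_2,g)}=N^{\mathrm{trop}}_{(\Delta,d_1,d_2,g)}(p),$$ for every choice of $T$ and of the distinct points $P_i$. Precisely: there are a constant $C$ and finitely many nonzero linear forms on $(\mathbb R^2)^n$, depending only on $\Delta,d_1,d_2,g$, such that this holds for all $p=((x_i,y_i))_i$ at which none of the forms vanishes and which satisfy $|x_i-x_j|>C\,|y_k-y_l|$ for all $i\ne j$ and all $k,l$. -/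

import Mathlib

open Finset

/-!
## Tropical stable maps to `E × ℙ¹`

A (cut, open) tropical stable map is a metric graph with unbounded ends together with a map to
`ℝ²` which is integer affine on edges and balanced.  It is encoded by its inner vertices with
their images, its bounded edges (as pairs of opposite flags carrying a common length), its ends,
and the components which are a single horizontal line without any vertex.
-/

/-- The combinatorial and metric data of a cut tropical stable map with `n` contracted marked
ends. -/
structure CutData (n : ℕ) where
  /-- inner vertices -/
  V : Type
  /-- flags of bounded edges -/
  H : Type
  /-- ends of direction `(0,-1)` -/
  Dn : Type
  /-- ends of direction `(L,1)`, `L` an integer -/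
  Up : Type
  /-- ends at a vertex of primitive direction `(1,0)` -/
  Rt : Type
  /-- ends at a vertex of primitive direction `(-1,0)` -/
  Lf : Type
  /-- components consisting of a single horizontal line without vertices; each of them has one
  end of primitive direction `(1,0)` and one of primitive direction `(-1,0)` -/
  Z : Type
  [fV : Fintype V]
  [fH : Fintype H]
  [fDn : Fintype Dn]
  [fUp : Fintype Up]
  [fRt : Fintype Rt]
  [fLf : Fintype Lf]
  [fZ : Fintype Z]
  /-- the vertex of a flag of a bounded edge -/
  vert : H → V
  /-- the opposite flag of the same bounded edge -/
  opp : H → H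
  /-- the length of the bounded edge -/
  len : H → ℝ
  /-- the direction of a flag of a bounded edge -/
  dir : H → ℤ × ℤ
  dnVert : Dn → V
  upVert : Up → V
  /-- the end `u` has direction `(leak u, 1)` -/
  leak : Up → ℤ
  rtVert : Rt → V
  /-- expansion factor of an end of primitive direction `(1,0)` -/
  rtWt : Rt → ℕ
  lfVert : Lf → V
  /-- expansion factor of an end of primitive direction `(-1,0)` -/
  lfWt : Lf → ℕ
  /-- expansion factor of a horizontal line -/
  lineWt : Z → ℕ
  /-- the `y`-coordinate of a horizontal line -/
  lineY : Z → ℝ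
  /-- the vertex at which the `i`-th contracted marked end is attached -/
  markVert : Fin n → V
  /-- the image of a vertex in the plane -/
  pos : V → ℝ × ℝ
  /-- the pairing of the ends of primitive direction `(1,0)` with those of primitive direction
  `(-1,0)`; the vertexless lines occur on both sides -/
  glue : Rt ⊕ Z ≃ Lf ⊕ Z

attribute [instance] CutData.fV CutData.fH CutData.fDn CutData.fUp CutData.fRt CutData.fLf
  CutData.fZ

namespace CutData

variable {n : ℕ} (C : CutData n)

/-- All flags at inner vertices, except those of the contracted marked ends. -/
abbrev Flag : Type := C.H ⊕ C.Dn ⊕ C.Up ⊕ C.Rt ⊕ C.Lf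

/-- The vertex of a flag. -/
def flagVert : C.Flag → C.V
  | .inl h => C.vert h
  | .inr (.inl d) => C.dnVert d
  | .inr (.inr (.inl u)) => C.upVert u
  | .inr (.inr (.inr (.inl r))) => C.rtVert r
  | .inr (.inr (.inr (.inr l))) => C.lfVert l

/-- The direction of a flag, pointing away from its vertex. -/
def flagDir : C.Flag → ℤ × ℤ
  | .inl h => C.dir h
  | .inr (.inl _) => (0, -1)
  | .inr (.inr (.inl u)) => (C.leak u, 1)
  | .inr (.inr (.inr (.inl r))) => ((C.rtWt r : ℤ), 0)
  | .inr (.inr (.inr (.inr l))) => (-(C.lfWt l : ℤ), 0)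

open Classical in
/-- The non-contracted flags at a vertex. -/
noncomputable def flagsAt (v : C.V) : Finset C.Flag := univ.filter fun f => C.flagVert f = v

/-- The vertex `v` is adjacent to a contracted marked end. -/
def Marked (v : C.V) : Prop := ∃ i, C.markVert i = v

open Classical in
/-- The valence of a vertex, contracted marked ends included. -/
noncomputable def valence (v : C.V) : ℕ :=
  #(C.flagsAt v) + #(univ.filter fun i => C.markVert i = v)

/-- Expansion factor of an end of primitive direction `(1,0)`. -/
def rightWt : C.Rt ⊕ C.Z → ℕ := Sum.elim C.rtWt C.lineWt

/-- Expansion factor of an end of primitive direction `(-1,0)`. -/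
def leftWt : C.Lf ⊕ C.Z → ℕ := Sum.elim C.lfWt C.lineWt

/-- `y`-coordinate of an end of primitive direction `(1,0)`. -/
def rightY : C.Rt ⊕ C.Z → ℝ := Sum.elim (fun r => (C.pos (C.rtVert r)).2) C.lineY

/-- `y`-coordinate of an end of primitive direction `(-1,0)`. -/
def leftY : C.Lf ⊕ C.Z → ℝ := Sum.elim (fun l => (C.pos (C.lfVert l)).2) C.lineY

/-- The vertex or the line carrying an end of primitive direction `(1,0)`. -/
def rightBase : C.Rt ⊕ C.Z → C.V ⊕ C.Z := Sum.map C.rtVert id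

/-- The vertex or the line carrying an end of primitive direction `(-1,0)`. -/
def leftBase : C.Lf ⊕ C.Z → C.V ⊕ C.Z := Sum.map C.lfVert id

/-- Adjacency in the glued graph `Γ'`.  Every vertexless line is represented by one additional
(two-valent) node; ends are omitted, since they change neither connectedness nor genus. -/
def gluedGraph : SimpleGraph (C.V ⊕ C.Z) :=
  SimpleGraph.fromRel fun a b =>
    (∃ h, a = .inl (C.vert h) ∧ b = .inl (C.vert (C.opp h))) ∨
      ∃ r, a = C.rightBase r ∧ b = C.leftBase (C.glue r)

/-- The first Betti number (edges minus vertices plus one) of the glued graph `Γ'`, assumed to be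
connected.  Its edges are the bounded edges and the pairs of glued ends, its nodes are the
vertices and the vertexless lines. -/
def genus : ℤ :=
  ((Fintype.card C.H / 2 + Fintype.card (C.Rt ⊕ C.Z) : ℕ) : ℤ)
    - (Fintype.card (C.V ⊕ C.Z) : ℤ) + 1

open Classical in
/-- The intersection number of the vertical line `x = a` (through no vertex) with the curve from
which the ends of direction `(L,1)` have been removed.  (Each bounded edge is counted through its
flag that points to the right.) -/
noncomputable def crossing (a : ℝ) : ℤ :=
  (∑ h ∈ univ.filter fun h => (C.pos (C.vert h)).1 < a ∧ a < (C.pos (C.vert (C.opp h))).1,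
      (C.dir h).1)
    + (∑ r ∈ univ.filter fun r => (C.pos (C.rtVert r)).1 < a, (C.rtWt r : ℤ))
    + (∑ l ∈ univ.filter fun l => a < (C.pos (C.lfVert l)).1, (C.lfWt l : ℤ))
    + ∑ z, (C.lineWt z : ℤ)

/-- The bidegree is `(d₁, d₂)`: there are `d₂` ends of direction `(0,-1)` and `d₂` ends of
directions `(L,1)`, and `d₁` is the smallest intersection number of a vertical line with the curve
without its ends of directions `(L,1)`. -/
def HasBidegree (d₁ d₂ : ℕ) : Prop :=
  Fintype.card C.Dn = d₂ ∧ Fintype.card C.Up = d₂ ∧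
    IsLeast {k : ℤ | ∃ a : ℝ, (∀ v, (C.pos v).1 ≠ a) ∧ C.crossing a = k} (d₁ : ℤ)

/-- The leaky degree is the multiset `Δ`. -/
def HasLeakyDegree (Δ : Multiset ℤ) : Prop :=
  (univ : Finset C.Up).val.map C.leak = Δ

/-- Every vertex is `3`-valent. -/
def Trivalent : Prop := ∀ v, C.valence v = 3

/-- The map is an embedding locally around each vertex not adjacent to a contracted marked end:
the flags there map to pairwise different rays. -/
def LocallyEmbedded : Prop :=
  ∀ v, ¬ C.Marked v → ∀ f ∈ C.flagsAt v, ∀ f' ∈ C.flagsAt v, f ≠ f' →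
    ¬ SameRay ℤ (C.flagDir f) (C.flagDir f')

/-- Vertex multiplicity: the absolute value of the determinant of the directions of two of the
flags.  At a `3`-valent vertex without contracted end, this value is the same for any two different
flags by balancing, so the maximum over all pairs of flags is that common value. -/
noncomputable def vertexMult (v : C.V) : ℕ :=
  (C.flagsAt v ×ˢ C.flagsAt v).sup fun q =>
    ((C.flagDir q.1).1 * (C.flagDir q.2).2 - (C.flagDir q.1).2 * (C.flagDir q.2).1).natAbs

open Classical in
/-- The multiplicity: the product of the vertex multiplicities over all vertices not adjacent to
contracted marked ends. -/
noncomputable def mult : ℕ := ∏ v ∈ univ.filter fun v => ¬ C.Marked v, C.vertexMult v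

/-- Isomorphisms of the glued graphs which respect all metric data and the maps; the bijections of
the horizontal ends are arbitrary, hence markings of these ends are forgotten and only their
pairing is remembered. -/
structure Iso (C D : CutData n) where
  eV : C.V ≃ D.V
  eH : C.H ≃ D.H
  eDn : C.Dn ≃ D.Dn
  eUp : C.Up ≃ D.Up
  eRt : C.Rt ≃ D.Rt
  eLf : C.Lf ≃ D.Lf
  eZ : C.Z ≃ D.Z
  vert : ∀ h, D.vert (eH h) = eV (C.vert h)
  opp : ∀ h, D.opp (eH h) = eH (C.opp h)
  len : ∀ h, D.len (eH h) = C.len h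
  dir : ∀ h, D.dir (eH h) = C.dir h
  dnVert : ∀ d, D.dnVert (eDn d) = eV (C.dnVert d)
  upVert : ∀ u, D.upVert (eUp u) = eV (C.upVert u)
  leak : ∀ u, D.leak (eUp u) = C.leak u
  rtVert : ∀ r, D.rtVert (eRt r) = eV (C.rtVert r)
  rtWt : ∀ r, D.rtWt (eRt r) = C.rtWt r
  lfVert : ∀ l, D.lfVert (eLf l) = eV (C.lfVert l)
  lfWt : ∀ l, D.lfWt (eLf l) = C.lfWt l
  lineWt : ∀ z, D.lineWt (eZ z) = C.lineWt z
  lineY : ∀ z, D.lineY (eZ z) = C.lineY z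
  markVert : ∀ i, D.markVert i = eV (C.markVert i)
  pos : ∀ v, D.pos (eV v) = C.pos v
  glue : ∀ r, D.glue (Sum.map eRt eZ r) = Sum.map eLf eZ (C.glue r)

namespace Iso

variable {C D E : CutData n}

/-- The identity. -/
def refl (C : CutData n) : Iso C C where
  eV := .refl _
  eH := .refl _
  eDn := .refl _
  eUp := .refl _
  eRt := .refl _
  eLf := .refl _
  eZ := .refl _
  vert _ := rfl
  opp _ := rfl
  len _ := rfl
  dir _ := rfl
  dnVert _ := rfl
  upVert _ := rfl
  leak _ := rfl
  rtVert _ := rfl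
  rtWt _ := rfl
  lfVert _ := rfl
  lfWt _ := rfl
  lineWt _ := rfl
  lineY _ := rfl
  markVert _ := rfl
  pos _ := rfl
  glue r := by simp

/-- The inverse. -/
def symm (e : Iso C D) : Iso D C where
  eV := e.eV.symm
  eH := e.eH.symm
  eDn := e.eDn.symm
  eUp := e.eUp.symm
  eRt := e.eRt.symm
  eLf := e.eLf.symm
  eZ := e.eZ.symm
  vert h := by rw [Equiv.eq_symm_apply, ← e.vert, Equiv.apply_symm_apply]
  opp h := by rw [Equiv.eq_symm_apply, ← e.opp, Equiv.apply_symm_apply]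
  len h := by rw [← e.len, Equiv.apply_symm_apply]
  dir h := by rw [← e.dir, Equiv.apply_symm_apply]
  dnVert h := by rw [Equiv.eq_symm_apply, ← e.dnVert, Equiv.apply_symm_apply]
  upVert h := by rw [Equiv.eq_symm_apply, ← e.upVert, Equiv.apply_symm_apply]
  leak h := by rw [← e.leak, Equiv.apply_symm_apply]
  rtVert h := by rw [Equiv.eq_symm_apply, ← e.rtVert, Equiv.apply_symm_apply]
  rtWt h := by rw [← e.rtWt, Equiv.apply_symm_apply]
  lfVert h := by rw [Equiv.eq_symm_apply, ← e.lfVert, Equiv.apply_symm_apply]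
  lfWt h := by rw [← e.lfWt, Equiv.apply_symm_apply]
  lineWt h := by rw [← e.lineWt, Equiv.apply_symm_apply]
  lineY h := by rw [← e.lineY, Equiv.apply_symm_apply]
  markVert i := by rw [Equiv.eq_symm_apply, e.markVert]
  pos v := by rw [← e.pos, Equiv.apply_symm_apply]
  glue r := by
    have h := e.glue (Sum.map e.eRt.symm e.eZ.symm r)
    simp only [Sum.map_map, Equiv.self_comp_symm, Sum.map_id_id, id_eq] at h
    rw [h]
    simp

/-- The composition. -/
def trans (e : Iso C D) (e' : Iso D E) : Iso C E where
  eV := e.eV.trans e'.eV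
  eH := e.eH.trans e'.eH
  eDn := e.eDn.trans e'.eDn
  eUp := e.eUp.trans e'.eUp
  eRt := e.eRt.trans e'.eRt
  eLf := e.eLf.trans e'.eLf
  eZ := e.eZ.trans e'.eZ
  vert h := by simp [e.vert, e'.vert]
  opp h := by simp [e.opp, e'.opp]
  len h := by simp [e.len, e'.len]
  dir h := by simp [e.dir, e'.dir]
  dnVert h := by simp [e.dnVert, e'.dnVert]
  upVert h := by simp [e.upVert, e'.upVert]
  leak h := by simp [e.leak, e'.leak]
  rtVert h := by simp [e.rtVert, e'.rtVert]
  rtWt h := by simp [e.rtWt, e'.rtWt]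
  lfVert h := by simp [e.lfVert, e'.lfVert]
  lfWt h := by simp [e.lfWt, e'.lfWt]
  lineWt h := by simp [e.lineWt, e'.lineWt]
  lineY h := by simp [e.lineY, e'.lineY]
  markVert i := by simp [e.markVert, e'.markVert]
  pos v := by simp [e.pos, e'.pos]
  glue r := by
    have h := e'.glue (Sum.map e.eRt e.eZ r)
    rw [e.glue] at h
    simpa [Sum.map_map] using h

/-- The induced bijection of flags. -/
def eFlag (e : Iso C D) : C.Flag ≃ D.Flag :=
  Equiv.sumCongr e.eH (Equiv.sumCongr e.eDn (Equiv.sumCongr e.eUp (Equiv.sumCongr e.eRt e.eLf)))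

theorem flagVert_eFlag (e : Iso C D) (f : C.Flag) :
    D.flagVert (e.eFlag f) = e.eV (C.flagVert f) := by
  rcases f with h | d | u | r | l
  · exact e.vert h
  · exact e.dnVert d
  · exact e.upVert u
  · exact e.rtVert r
  · exact e.lfVert l

theorem flagDir_eFlag (e : Iso C D) (f : C.Flag) : D.flagDir (e.eFlag f) = C.flagDir f := by
  rcases f with h | d | u | r | l
  · exact e.dir h
  · rfl
  · simp [eFlag, flagDir, e.leak]
  · simp [eFlag, flagDir, e.rtWt]
  · simp [eFlag, flagDir, e.lfWt]

theorem flagsAt_eq (e : Iso C D) (v : C.V) :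
    D.flagsAt (e.eV v) = (C.flagsAt v).map e.eFlag.toEmbedding := by
  ext f
  obtain ⟨f, rfl⟩ := e.eFlag.surjective f
  simp [flagsAt, e.flagVert_eFlag]

theorem vertexMult_eq (e : Iso C D) (v : C.V) : D.vertexMult (e.eV v) = C.vertexMult v := by
  unfold vertexMult
  rw [e.flagsAt_eq]
  apply le_antisymm
  · refine Finset.sup_le fun q hq => ?_
    simp only [mem_product, mem_map_equiv] at hq
    refine le_trans (le_of_eq ?_) (Finset.le_sup (b := (e.eFlag.symm q.1, e.eFlag.symm q.2))
      (by simpa using hq))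
    simp only [← e.flagDir_eFlag, Equiv.apply_symm_apply]
  · refine Finset.sup_le fun q hq => ?_
    simp only [mem_product] at hq
    refine le_trans (le_of_eq ?_) (Finset.le_sup (b := (e.eFlag q.1, e.eFlag q.2))
      (by simpa using hq))
    simp only [e.flagDir_eFlag]

theorem marked_iff (e : Iso C D) (v : C.V) : D.Marked (e.eV v) ↔ C.Marked v := by
  simp [Marked, e.markVert]

theorem mult_eq (e : Iso C D) : C.mult = D.mult := by
  classical
  unfold mult
  refine Finset.prod_equiv e.eV (fun v => ?_) (fun v _ => (e.vertexMult_eq v).symm)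
  simp [e.marked_iff]

end Iso

end CutData

/-- A (cut, open) tropical stable map to `E × ℙ¹` with `n` contracted marked ends. -/
structure CutStableMap (n : ℕ) extends CutData n where
  opp_opp : ∀ h, opp (opp h) = h
  opp_ne : ∀ h, opp h ≠ h
  len_pos : ∀ h, 0 < len h
  len_opp : ∀ h, len (opp h) = len h
  dir_opp : ∀ h, dir (opp h) = -dir h
  /-- the map is affine on each bounded edge, with the given direction -/
  affine : ∀ h, pos (vert (opp h)) =
    pos (vert h) + (len h * ((dir h).1 : ℝ), len h * ((dir h).2 : ℝ))
  rtWt_pos : ∀ r, 0 < rtWt r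
  lfWt_pos : ∀ l, 0 < lfWt l
  lineWt_pos : ∀ z, 0 < lineWt z
  /-- inner vertices are the points of valence at least three -/
  three_le_valence : ∀ v, 3 ≤ toCutData.valence v
  balanced : ∀ v, ∑ f ∈ toCutData.flagsAt v, toCutData.flagDir f = 0
  glue_wt : ∀ r, toCutData.leftWt (glue r) = toCutData.rightWt r
  glue_y : ∀ r, toCutData.leftY (glue r) = toCutData.rightY r

/-- The connected tropical stable maps of leaky degree `Δ`, bidegree `(d₁, d₂)` and genus `g` that
satisfy the point conditions `p` and for which the multiplicity is defined (`3`-valent, and locally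
embedded around the vertices not adjacent to contracted ends). -/
structure CountedMap (Δ : Multiset ℤ) (d₁ d₂ g : ℕ) {n : ℕ} (p : Fin n → ℝ × ℝ) extends
    CutStableMap n where
  leakyDegree : toCutData.HasLeakyDegree Δ
  bidegree : toCutData.HasBidegree d₁ d₂
  connected : toCutData.gluedGraph.Connected
  genus_eq : toCutData.genus = g
  trivalent : toCutData.Trivalent
  locallyEmbedded : toCutData.LocallyEmbedded
  point : ∀ i, pos (markVert i) = p i

namespace CountedMap

variable (Δ : Multiset ℤ) (d₁ d₂ g : ℕ) {n : ℕ} (p : Fin n → ℝ × ℝ)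

/-- Equivalence of tropical stable maps. -/
instance setoid : Setoid (CountedMap Δ d₁ d₂ g p) where
  r A B := Nonempty (CutData.Iso A.toCutData B.toCutData)
  iseqv :=
    { refl := fun _ => ⟨.refl _⟩
      symm := fun ⟨e⟩ => ⟨e.symm⟩
      trans := fun ⟨e⟩ ⟨e'⟩ => ⟨e.trans e'⟩ }

/-- Equivalence classes of tropical stable maps. -/
abbrev Class : Type 1 := Quotient (setoid Δ d₁ d₂ g p)

/-- Multiplicity of an equivalence class. -/
noncomputable def Class.mult (q : Class Δ d₁ d₂ g p) : ℕ :=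
  Quotient.lift (fun A : CountedMap Δ d₁ d₂ g p => A.toCutData.mult)
    (by rintro _ _ ⟨e⟩; exact e.mult_eq) q

end CountedMap

/-- The number of connected tropical stable maps of leaky degree `Δ`, bidegree `(d₁, d₂)` and genus
`g` through the points `p`, counted with multiplicity. -/
noncomputable def tropCount (Δ : Multiset ℤ) (d₁ d₂ g : ℕ) {n : ℕ} (p : Fin n → ℝ × ℝ) : ℕ :=
  ∑ᶠ q : CountedMap.Class Δ d₁ d₂ g p, q.mult

/-- The point configuration is horizontally stretched with factor `C`: differences of
`x`-coordinates exceed `C` times the differences of `y`-coordinates. -/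
def HorizontallyStretched (C : ℝ) {n : ℕ} (p : Fin n → ℝ × ℝ) : Prop :=
  ∀ i j, i ≠ j → ∀ k l, C * |(p k).2 - (p l).2| < |(p i).1 - (p j).1|

/-!
## Curled pearl chains
-/

/-- A pearl chain of type `(d₂, g)`.  Edges connect a white with a black vertex. -/
structure PearlChain (d₂ g : ℕ) where
  /-- white vertices -/
  W : Type
  /-- black vertices -/
  B : Type
  /-- edges -/
  E : Type
  [fW : Fintype W]
  [fB : Fintype B]
  [fE : Fintype E]
  white : E → W
  black : E → B
  card_white : Fintype.card W = d₂
  card_black : Fintype.card B + 1 = d₂ + g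
  two_valent : ∀ b, Nat.card {e // black e = b} = 2
  /-- there are no cycles of length two -/
  no_two_cycle : ∀ e e', white e = white e' → black e = black e' → e = e'
  connected : (SimpleGraph.fromRel fun a b : W ⊕ B =>
    ∃ e, a = .inl (white e) ∧ b = .inr (black e)).Connected
  /-- the first Betti number is `g` -/
  genus_eq : (Fintype.card E : ℤ) - Fintype.card (W ⊕ B) + 1 = g

attribute [instance] PearlChain.fW PearlChain.fB PearlChain.fE

/-- A curled pearl chain of type `(Δ, d₂, g)`: a leaky tropical cover of the circle `ℝ / Tℤ` by a
metrization of a pearl chain, with vertices over the points `P`.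

An edge `e` is mapped at constant speed `wt e` (its expansion factor), in the positive direction of
the circle if it is run through from its white to its black vertex (when `fwd e = true`)
respectively from its black to its white vertex (when `fwd e = false`). -/
structure CurledPearlChain (T : ℝ) (Δ : Multiset ℤ) (d₂ g : ℕ) {n : ℕ}
    (P : Fin n → AddCircle T) extends PearlChain d₂ g where
  /-- edge lengths -/
  len : E → ℝ
  len_pos : ∀ e, 0 < len e
  /-- images of the vertices -/
  pos : W ⊕ B → AddCircle T
  fwd : E → Bool
  /-- expansion factors -/
  wt : E → ℕ
  wt_pos : ∀ e, 0 < wt e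
  affine : ∀ e, pos (if fwd e then .inr (black e) else .inl (white e)) =
    pos (if fwd e then .inl (white e) else .inr (black e)) +
      (((wt e : ℝ) * len e : ℝ) : AddCircle T)
  surjective : ∀ a : AddCircle T, ∃ e, ∃ t ∈ Set.Icc 0 (len e),
    pos (if fwd e then .inl (white e) else .inr (black e)) +
      (((wt e : ℝ) * t : ℝ) : AddCircle T) = a
  /-- over each point of `P` there is exactly one vertex -/
  point : ∀ i, ∃! v, pos v = P i
  /-- the leakings (incoming minus outgoing local degree) at the white vertices form `Δ` -/
  leaking : (univ : Finset W).val.map (fun v =>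
    ∑ᶠ (e : E) (_ : white e = v), (if fwd e then -(wt e : ℤ) else (wt e : ℤ))) = Δ
  /-- black vertices are balanced -/
  balanced : ∀ b,
    ∑ᶠ (e : E) (_ : black e = b), (if fwd e then (wt e : ℤ) else -(wt e : ℤ)) = 0

namespace CurledPearlChain

variable {T : ℝ} {Δ : Multiset ℤ} {d₂ g n : ℕ} {P : Fin n → AddCircle T}

/-- The image of the vertex at which the edge `e` starts in the positive direction. -/
def start (c : CurledPearlChain T Δ d₂ g P) (e : c.E) : AddCircle T :=
  c.pos (if c.fwd e then .inl (c.white e) else .inr (c.black e))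

/-- The sum of the local degrees of all preimages of `a` with respect to the outgoing flag at `a`.
(An edge contributes its expansion factor for each of its points over `a` other than its final
vertex.) -/
noncomputable def degOut (c : CurledPearlChain T Δ d₂ g P) (a : AddCircle T) : ℕ :=
  ∑ e, c.wt e * Set.ncard {t : ℝ | t ∈ Set.Ico 0 (c.len e) ∧
    c.start e + (((c.wt e : ℝ) * t : ℝ) : AddCircle T) = a}

/-- The sum of the local degrees of all preimages of `a` with respect to the incoming flag at
`a`. -/
noncomputable def degIn (c : CurledPearlChain T Δ d₂ g P) (a : AddCircle T) : ℕ :=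
  ∑ e, c.wt e * Set.ncard {t : ℝ | t ∈ Set.Ioc 0 (c.len e) ∧
    c.start e + (((c.wt e : ℝ) * t : ℝ) : AddCircle T) = a}

/-- The degree of the leaky cover is `d₁`. -/
def HasDegree (c : CurledPearlChain T Δ d₂ g P) (d₁ : ℕ) : Prop :=
  IsLeast (Set.range c.degOut ∪ Set.range c.degIn) d₁

/-- The multiplicity: the product of all expansion factors. -/
def mult (c : CurledPearlChain T Δ d₂ g P) : ℕ := ∏ e, c.wt e

/-- Isomorphisms of curled pearl chains: isometries of the coloured graphs over the circle. -/
structure Iso (c d : CurledPearlChain T Δ d₂ g P) where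
  eW : c.W ≃ d.W
  eB : c.B ≃ d.B
  eE : c.E ≃ d.E
  white : ∀ e, d.white (eE e) = eW (c.white e)
  black : ∀ e, d.black (eE e) = eB (c.black e)
  len : ∀ e, d.len (eE e) = c.len e
  fwd : ∀ e, d.fwd (eE e) = c.fwd e
  wt : ∀ e, d.wt (eE e) = c.wt e
  pos : ∀ v, d.pos (Sum.map eW eB v) = c.pos v

namespace Iso

variable {c d f : CurledPearlChain T Δ d₂ g P}

/-- The identity. -/
def refl (c : CurledPearlChain T Δ d₂ g P) : Iso c c where
  eW := .refl _
  eB := .refl _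
  eE := .refl _
  white _ := rfl
  black _ := rfl
  len _ := rfl
  fwd _ := rfl
  wt _ := rfl
  pos v := by simp

/-- The inverse. -/
def symm (i : Iso c d) : Iso d c where
  eW := i.eW.symm
  eB := i.eB.symm
  eE := i.eE.symm
  white e := by rw [Equiv.eq_symm_apply, ← i.white, Equiv.apply_symm_apply]
  black e := by rw [Equiv.eq_symm_apply, ← i.black, Equiv.apply_symm_apply]
  len e := by rw [← i.len, Equiv.apply_symm_apply]
  fwd e := by rw [← i.fwd, Equiv.apply_symm_apply]
  wt e := by rw [← i.wt, Equiv.apply_symm_apply]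
  pos v := by
    have h := i.pos (Sum.map i.eW.symm i.eB.symm v)
    simp only [Sum.map_map, Equiv.self_comp_symm, Sum.map_id_id, id_eq] at h
    exact h.symm

/-- The composition. -/
def trans (i : Iso c d) (j : Iso d f) : Iso c f where
  eW := i.eW.trans j.eW
  eB := i.eB.trans j.eB
  eE := i.eE.trans j.eE
  white e := by simp [i.white, j.white]
  black e := by simp [i.black, j.black]
  len e := by simp [i.len, j.len]
  fwd e := by simp [i.fwd, j.fwd]
  wt e := by simp [i.wt, j.wt]
  pos v := by
    have h := j.pos (Sum.map i.eW i.eB v)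
    rw [i.pos] at h
    simpa [Sum.map_map] using h

theorem mult_eq (i : Iso c d) : c.mult = d.mult :=
  Fintype.prod_equiv i.eE _ _ fun e => (i.wt e).symm

end Iso

/-- Isomorphism of curled pearl chains of degree `d₁`. -/
instance setoid (T : ℝ) (Δ : Multiset ℤ) (d₁ d₂ g : ℕ) {n : ℕ} (P : Fin n → AddCircle T) :
    Setoid {c : CurledPearlChain T Δ d₂ g P // c.HasDegree d₁} where
  r c d := Nonempty (Iso c.1 d.1)
  iseqv :=
    { refl := fun _ => ⟨.refl _⟩
      symm := fun ⟨e⟩ => ⟨e.symm⟩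
      trans := fun ⟨e⟩ ⟨e'⟩ => ⟨e.trans e'⟩ }

/-- Isomorphism classes of curled pearl chains of type `(Δ, d₂, g)` and degree `d₁`. -/
abbrev Class (T : ℝ) (Δ : Multiset ℤ) (d₁ d₂ g : ℕ) {n : ℕ} (P : Fin n → AddCircle T) : Type 1 :=
  Quotient (setoid T Δ d₁ d₂ g P)

/-- Multiplicity of an isomorphism class. -/
def Class.mult {d₁ : ℕ} (q : Class T Δ d₁ d₂ g P) : ℕ :=
  Quotient.lift (fun c : {c : CurledPearlChain T Δ d₂ g P // c.HasDegree d₁} => c.1.mult)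
    (by rintro _ _ ⟨e⟩; exact e.mult_eq) q

end CurledPearlChain

/-- The weighted count of curled pearl chains of type `(Δ, d₂, g)` and degree `d₁` over the points
`P` of the circle `ℝ / Tℤ`. -/
noncomputable def pearlCount (T : ℝ) (Δ : Multiset ℤ) (d₁ d₂ g : ℕ) {n : ℕ}
    (P : Fin n → AddCircle T) : ℕ :=
  ∑ᶠ q : CurledPearlChain.Class T Δ d₁ d₂ g P, q.mult

/-!
## Floor diagrams

Floor diagrams are the common combinatorial skeleton of curled pearl chains and of tropical stable
maps through horizontally stretched points.  The vertices are indexed by the point conditions.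
-/

/-- A floor diagram on `n` points.  A point `i` is white if `wt i = 0` and black otherwise.  Every
black point `b` has an incoming half elevator `(b, true)` and an outgoing half elevator
`(b, false)`, both of weight `wt b`, which connect it to the white points `floor b true` and
`floor b false`, and which cross the cut `wind b true` and `wind b false` times. -/
@[ext]
structure FloorDiagram (n : ℕ) where
  floor : Fin n → Bool → Fin n
  wind : Fin n → Bool → ℕ
  wt : Fin n → ℕ

namespace FloorDiagram

variable {n : ℕ} (δ : FloorDiagram n)

/-- The half elevators. -/
abbrev Half : Type := {e : Fin n × Bool // 0 < δ.wt e.1}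

/-- The point where the half elevator `(b, s)` starts in positive direction. -/
def start (b : Fin n) (s : Bool) : Fin n := if s then δ.floor b s else b

/-- The point where the half elevator `(b, s)` ends in positive direction. -/
def finish (b : Fin n) (s : Bool) : Fin n := if s then b else δ.floor b s

@[simp] theorem start_true (b : Fin n) : δ.start b true = δ.floor b true := rfl
@[simp] theorem start_false (b : Fin n) : δ.start b false = b := rfl
@[simp] theorem finish_true (b : Fin n) : δ.finish b true = b := rfl
@[simp] theorem finish_false (b : Fin n) : δ.finish b false = δ.floor b false := rfl

/-- Contribution of the half elevators at `b` to incoming minus outgoing weight at `i`. -/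
def coef (i b : Fin n) : ℤ :=
  ∑ s, ((if δ.finish b s = i then (δ.wt b : ℤ) else 0) -
    if δ.start b s = i then (δ.wt b : ℤ) else 0)

/-- Incoming minus outgoing weight at `i`. -/
def leak (i : Fin n) : ℤ := ∑ b, δ.coef i b

/-- The total weight of the crossings of the cut. -/
def base : ℤ := ∑ b, ∑ s, (δ.wt b : ℤ) * δ.wind b s

/-- The graph of a floor diagram. -/
def graph : SimpleGraph (Fin n) := SimpleGraph.fromRel fun i j => ∃ s, j = δ.floor i s

/-- The multiplicity is the product of the weights of the half elevators. -/
def mult : ℕ := ∏ e : δ.Half, δ.wt e.1.1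

/-- The white points. -/
def whites : Finset (Fin n) := univ.filter fun i => δ.wt i = 0

@[simp] theorem mem_whites {i : Fin n} : i ∈ δ.whites ↔ δ.wt i = 0 := by simp [whites]

/-- The possible intersection numbers with a fibre, for points at the positions `r`. -/
def degrees (r : Fin n → ℝ) : Set ℤ :=
  {k | ∃ S : Finset (Fin n), (∀ i ∈ S, ∀ j, r j < r i → j ∈ S) ∧ k = δ.base - ∑ i ∈ S, δ.leak i}

/-- The conditions on a floor diagram of type `(Δ, d₂)` and degree `d₁` with points at the
positions `r`. -/
structure Valid (r : Fin n → ℝ) (Δ : Multiset ℤ) (d₁ d₂ : ℕ) : Prop where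
  floor_white : ∀ i, δ.wt i = 0 → ∀ s, δ.floor i s = i
  wind_white : ∀ i, δ.wt i = 0 → ∀ s, δ.wind i s = 0
  wt_floor : ∀ i s, δ.wt (δ.floor i s) = 0
  floor_ne : ∀ i, 0 < δ.wt i → δ.floor i true ≠ δ.floor i false
  lt_or_wind : ∀ i, 0 < δ.wt i → ∀ s, r (δ.start i s) < r (δ.finish i s) ∨ 0 < δ.wind i s
  card_whites : #δ.whites = d₂
  leaky : δ.whites.val.map δ.leak = Δ
  connected : δ.graph.Connected
  degree : IsLeast (δ.degrees r) d₁

variable {δ} {r : Fin n → ℝ} {Δ : Multiset ℤ} {d₁ d₂ : ℕ}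

theorem coef_self (i : Fin n) (h : ∀ i s, δ.wt (δ.floor i s) = 0) : δ.coef i i = 0 := by
  have h1 := h i true
  have h2 := h i false
  unfold coef
  rw [Fintype.sum_bool]
  simp only [finish_true, start_true, finish_false, start_false, if_true]
  by_cases hi : δ.wt i = 0
  · simp [hi]
  · have h1 : δ.floor i true ≠ i := fun e => hi (e ▸ h1)
    have h2 : δ.floor i false ≠ i := fun e => hi (e ▸ h2)
    simp [h1, h2]

theorem coef_black {i : Fin n} (hi : δ.wt i ≠ 0) (h : ∀ i s, δ.wt (δ.floor i s) = 0)
    (b : Fin n) : δ.coef i b = 0 := by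
  by_cases hb : b = i
  · subst hb; exact coef_self b h
  · have hs : ∀ s, δ.floor b s ≠ i := fun s e => hi (e ▸ h b s)
    unfold coef
    rw [Fintype.sum_bool]
    simp [hs, hb]

theorem leak_black {i : Fin n} (hi : δ.wt i ≠ 0) (h : ∀ i s, δ.wt (δ.floor i s) = 0) :
    δ.leak i = 0 :=
  Finset.sum_eq_zero fun b _ => coef_black hi h b

theorem coef_eq {i : Fin n} (hi : δ.wt i = 0) (b : Fin n) :
    δ.coef i b = (if δ.floor b false = i then (δ.wt b : ℤ) else 0) -
      if δ.floor b true = i then (δ.wt b : ℤ) else 0 := by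
  unfold coef
  rw [Fintype.sum_bool]
  by_cases hb : b = i
  · subst hb; simp [hi]
  · by_cases h1 : δ.floor b false = i <;> by_cases h2 : δ.floor b true = i <;> simp [h1, h2, hb]

theorem abs_coef_le (i b : Fin n) : |δ.coef i b| ≤ 2 * δ.wt b := by
  unfold coef
  rw [Fintype.sum_bool]
  have : (0 : ℤ) ≤ δ.wt b := by positivity
  rw [abs_le]
  split_ifs <;> constructor <;> linarith

/-- The crossing number at a cut is the sum of nonnegative contributions of the half elevators. -/
theorem base_sub_sum (S : Finset (Fin n)) :
    δ.base - ∑ i ∈ S, δ.leak i = ∑ b, ∑ s, (δ.wt b : ℤ) * (δ.wind b s +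
      (if δ.start b s ∈ S then 1 else 0) - if δ.finish b s ∈ S then 1 else 0) := by
  have h : ∑ i ∈ S, δ.leak i = ∑ b, ∑ s, (δ.wt b : ℤ) *
      ((if δ.finish b s ∈ S then 1 else 0) - if δ.start b s ∈ S then 1 else 0) := by
    unfold leak coef
    rw [Finset.sum_comm]
    refine Finset.sum_congr rfl fun b _ => ?_
    rw [Finset.sum_comm]
    refine Finset.sum_congr rfl fun s _ => ?_
    rw [Finset.sum_sub_distrib, Finset.sum_ite_eq, Finset.sum_ite_eq]
    split_ifs <;> simp
  rw [h, base, ← Finset.sum_sub_distrib]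
  refine Finset.sum_congr rfl fun b _ => ?_
  rw [← Finset.sum_sub_distrib]
  exact Finset.sum_congr rfl fun s _ => by ring

/-- A bound for all local degrees of objects of degree `d₁` and leaking `Δ`. -/
def degreeBound (Δ : Multiset ℤ) (d₁ : ℕ) : ℕ := d₁ + 2 * (Δ.map Int.natAbs).sum

theorem abs_sum_le {ι : Type*} (S T : Finset ι) (f : ι → ℤ) (hST : S ⊆ T) :
    |∑ i ∈ S, f i| ≤ ((T.val.map f).map Int.natAbs).sum := by
  have : (((T.val.map f).map Int.natAbs).sum : ℤ) = ∑ i ∈ T, |f i| := by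
    rw [Multiset.map_map]
    change ((∑ i ∈ T, (f i).natAbs : ℕ) : ℤ) = _
    push_cast
    rfl
  rw [this]
  exact (Finset.abs_sum_le_sum_abs _ _).trans
    (Finset.sum_le_sum_of_subset_of_nonneg hST fun _ _ _ => abs_nonneg _)

namespace Valid

theorem sum_leak_whites (h : δ.Valid r Δ d₁ d₂) (S : Finset (Fin n)) :
    ∑ i ∈ S, δ.leak i = ∑ i ∈ S.filter (fun i => δ.wt i = 0), δ.leak i := by
  rw [Finset.sum_filter]
  refine Finset.sum_congr rfl fun i _ => ?_
  split_ifs with hi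
  · rfl
  · exact leak_black hi h.wt_floor

theorem abs_sum_leak_le (h : δ.Valid r Δ d₁ d₂) (S : Finset (Fin n)) :
    |∑ i ∈ S, δ.leak i| ≤ (Δ.map Int.natAbs).sum := by
  rw [h.sum_leak_whites, ← h.leaky]
  exact abs_sum_le _ _ _ (Finset.filter_subset_filter _ (Finset.subset_univ _))

theorem base_sub_le (h : δ.Valid r Δ d₁ d₂) (S : Finset (Fin n)) :
    δ.base - ∑ i ∈ S, δ.leak i ≤ degreeBound Δ d₁ := by
  obtain ⟨S₀, -, h0⟩ := h.degree.1
  have h1 := abs_le.1 (h.abs_sum_leak_le S)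
  have h2 := abs_le.1 (h.abs_sum_leak_le S₀)
  unfold degreeBound
  rw [Nat.cast_add, Nat.cast_mul, Nat.cast_two]
  linarith [h1.1, h2.2]

theorem term_le (h : δ.Valid r Δ d₁ d₂) {S : Finset (Fin n)}
    (hS : ∀ i ∈ S, ∀ j, r j < r i → j ∈ S) (b : Fin n) (s : Bool) :
    (δ.wt b : ℤ) * (δ.wind b s +
      (if δ.start b s ∈ S then 1 else 0) - if δ.finish b s ∈ S then 1 else 0) ≤
      degreeBound Δ d₁ := by
  have hnn : ∀ b s, 0 ≤ (δ.wt b : ℤ) * (δ.wind b s +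
      (if δ.start b s ∈ S then 1 else 0) - if δ.finish b s ∈ S then 1 else 0) := by
    intro b s
    rcases Nat.eq_zero_or_pos (δ.wt b) with hb | hb
    · simp [hb]
    refine mul_nonneg (by positivity) ?_
    rcases h.lt_or_wind b hb s with hlt | hw
    · by_cases hf : δ.finish b s ∈ S
      · rw [if_pos hf, if_pos (hS _ hf _ hlt)]; simp
      · have : (0 : ℤ) ≤ δ.wind b s := by positivity
        rw [if_neg hf]; split_ifs <;> linarith
    · have : (1 : ℤ) ≤ δ.wind b s := by exact_mod_cast hw
      split_ifs <;> linarith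
  refine le_trans ?_ (h.base_sub_le S)
  rw [base_sub_sum]
  refine le_trans ?_ (Finset.single_le_sum (fun b _ => Finset.sum_nonneg fun s _ => hnn b s)
    (Finset.mem_univ b))
  exact Finset.single_le_sum (f := fun s => (δ.wt b : ℤ) * (δ.wind b s +
      (if δ.start b s ∈ S then 1 else 0) - if δ.finish b s ∈ S then 1 else 0))
      (fun s _ => hnn b s) (Finset.mem_univ s)

theorem wt_mul_wind_le (h : δ.Valid r Δ d₁ d₂) (b : Fin n) (s : Bool) :
    δ.wt b * δ.wind b s ≤ degreeBound Δ d₁ := by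
  have := h.term_le (S := ∅) (by simp) b s
  simp only [Finset.notMem_empty, if_false, add_zero, sub_zero] at this
  exact_mod_cast this

theorem wind_le (h : δ.Valid r Δ d₁ d₂) (b : Fin n) (s : Bool) :
    δ.wind b s ≤ degreeBound Δ d₁ := by
  rcases Nat.eq_zero_or_pos (δ.wt b) with hb | hb
  · simp [h.wind_white b hb]
  · exact (Nat.le_mul_of_pos_left _ hb).trans (h.wt_mul_wind_le b s)

theorem wt_le (h : δ.Valid r Δ d₁ d₂) (b : Fin n) : δ.wt b ≤ degreeBound Δ d₁ := by
  rcases Nat.eq_zero_or_pos (δ.wt b) with hb | hb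
  · simp [hb]
  rcases Nat.eq_zero_or_pos (δ.wind b true) with hw | hw
  · have hlt := (h.lt_or_wind b hb true).resolve_right hw.not_gt
    have := h.term_le (S := univ.filter fun j => r j ≤ r (δ.start b true))
      (by
        intro i hi j hj
        simp only [mem_filter, mem_univ, true_and] at hi ⊢
        exact (hj.trans_le hi).le) b true
    simp only [mem_filter, mem_univ, true_and, le_refl, if_true, not_le.2 hlt, if_false, hw] at this
    norm_num at this
    exact_mod_cast this
  · exact (Nat.le_mul_of_pos_right _ hw).trans (h.wt_mul_wind_le b true)

end Valid

theorem finite_valid (r : Fin n → ℝ) (Δ : Multiset ℤ) (d₁ d₂ : ℕ) :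
    Finite {δ : FloorDiagram n // δ.Valid r Δ d₁ d₂} := by
  let K := degreeBound Δ d₁
  let f : {δ : FloorDiagram n // δ.Valid r Δ d₁ d₂} →
      (Fin n → Bool → Fin n) × (Fin n → Bool → Fin (K + 1)) × (Fin n → Fin (K + 1)) := fun δ =>
    (δ.1.floor, fun i s => ⟨δ.1.wind i s, Nat.lt_succ_of_le (δ.2.wind_le i s)⟩,
      fun i => ⟨δ.1.wt i, Nat.lt_succ_of_le (δ.2.wt_le i)⟩)
  refine Finite.of_injective f fun δ ε h => ?_
  simp only [f, Prod.mk.injEq, funext_iff, Fin.mk.injEq] at h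
  exact Subtype.ext (FloorDiagram.ext (funext fun i => funext fun s => h.1 i s)
    (funext fun i => funext fun s => h.2.1 i s) (funext h.2.2))

/-- The weighted count of floor diagrams with points at the positions `r`. -/
noncomputable def count (r : Fin n → ℝ) (Δ : Multiset ℤ) (d₁ d₂ : ℕ) : ℕ :=
  ∑ᶠ δ : {δ : FloorDiagram n // δ.Valid r Δ d₁ d₂}, δ.1.mult

/-- Renaming of the points. -/
def relabel (δ : FloorDiagram n) (σ : Equiv.Perm (Fin n)) : FloorDiagram n where
  floor i s := σ (δ.floor (σ.symm i) s)
  wind i s := δ.wind (σ.symm i) s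
  wt i := δ.wt (σ.symm i)

theorem relabel_relabel_symm (δ : FloorDiagram n) (σ : Equiv.Perm (Fin n)) :
    (δ.relabel σ).relabel σ.symm = δ := by
  ext <;> simp [relabel]

theorem start_relabel (σ : Equiv.Perm (Fin n)) (b : Fin n) (s : Bool) :
    (δ.relabel σ).start (σ b) s = σ (δ.start b s) := by
  cases s <;> simp [relabel]

theorem finish_relabel (σ : Equiv.Perm (Fin n)) (b : Fin n) (s : Bool) :
    (δ.relabel σ).finish (σ b) s = σ (δ.finish b s) := by
  cases s <;> simp [relabel]

theorem leak_relabel (σ : Equiv.Perm (Fin n)) (i : Fin n) :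
    (δ.relabel σ).leak (σ i) = δ.leak i := by
  unfold leak
  rw [← Equiv.sum_comp σ]
  refine Finset.sum_congr rfl fun b _ => ?_
  unfold coef
  simp only [start_relabel, finish_relabel, EmbeddingLike.apply_eq_iff_eq]
  simp [relabel]

theorem base_relabel (σ : Equiv.Perm (Fin n)) : (δ.relabel σ).base = δ.base := by
  unfold base
  rw [← Equiv.sum_comp σ]
  simp [relabel]

theorem whites_relabel (σ : Equiv.Perm (Fin n)) :
    (δ.relabel σ).whites = δ.whites.map σ.toEmbedding := by
  ext i
  rw [mem_map_equiv, mem_whites, mem_whites]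
  rfl

theorem graph_relabel_adj (σ : Equiv.Perm (Fin n)) (i j : Fin n) :
    (δ.relabel σ).graph.Adj (σ i) (σ j) ↔ δ.graph.Adj i j := by
  simp [graph, relabel]

theorem degrees_relabel {r r' : Fin n → ℝ} (σ : Equiv.Perm (Fin n))
    (hσ : ∀ i j, r' (σ i) < r' (σ j) ↔ r i < r j) :
    (δ.relabel σ).degrees r' = δ.degrees r := by
  ext k
  constructor
  · rintro ⟨S, hS, rfl⟩
    refine ⟨S.map σ.symm.toEmbedding, fun i hi j hj => ?_, ?_⟩
    · simp only [mem_map_equiv, Equiv.symm_symm] at hi ⊢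
      exact hS _ hi _ ((hσ _ _).2 hj)
    · rw [base_relabel, Finset.sum_map]
      congr 1
      refine Finset.sum_congr rfl fun i _ => ?_
      conv_lhs => rw [← σ.apply_symm_apply i]
      exact leak_relabel σ _
  · rintro ⟨S, hS, rfl⟩
    refine ⟨S.map σ.toEmbedding, fun i hi j hj => ?_, ?_⟩
    · simp only [mem_map_equiv] at hi ⊢
      exact hS _ hi _ ((hσ _ _).1 (by simpa using hj))
    · rw [base_relabel, Finset.sum_map]
      congr 1
      exact Finset.sum_congr rfl fun i _ => (leak_relabel σ i).symm

theorem Valid.relabel {r r' : Fin n → ℝ} (h : δ.Valid r Δ d₁ d₂) (σ : Equiv.Perm (Fin n))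
    (hσ : ∀ i j, r' (σ i) < r' (σ j) ↔ r i < r j) : (δ.relabel σ).Valid r' Δ d₁ d₂ where
  floor_white i hi s := by
    simp only [FloorDiagram.relabel] at hi ⊢
    rw [h.floor_white _ hi, Equiv.apply_symm_apply]
  wind_white i hi s := h.wind_white _ hi s
  wt_floor i s := by simpa [FloorDiagram.relabel] using h.wt_floor _ s
  floor_ne i hi := by simpa [FloorDiagram.relabel] using h.floor_ne _ hi
  lt_or_wind i hi s := by
    obtain ⟨i, rfl⟩ := σ.surjective i
    rw [start_relabel, finish_relabel, hσ]
    simpa [FloorDiagram.relabel] using h.lt_or_wind i (by simpa [FloorDiagram.relabel] using hi) s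
  card_whites := by rw [whites_relabel, card_map, h.card_whites]
  leaky := by
    rw [whites_relabel, Finset.map_val, Multiset.map_map, ← h.leaky]
    exact Multiset.map_congr rfl fun i _ => leak_relabel σ i
  connected := by
    let φ : δ.graph ≃g (δ.relabel σ).graph := ⟨σ, fun {i j} => graph_relabel_adj σ i j⟩
    exact φ.connected_iff.1 h.connected
  degree := by rw [degrees_relabel σ hσ]; exact h.degree

theorem mult_relabel (σ : Equiv.Perm (Fin n)) : (δ.relabel σ).mult = δ.mult := by
  unfold mult
  symm
  refine Fintype.prod_equiv ((σ.prodCongr (Equiv.refl Bool)).subtypeEquiv fun e => ?_) _ _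
    fun e => ?_
  · simp [FloorDiagram.relabel]
  · change δ.wt e.1.1 = δ.wt (σ.symm (σ e.1.1))
    rw [σ.symm_apply_apply]

/-- The count depends only on the order of the positions. -/
theorem count_eq_of_order {r r' : Fin n → ℝ} (σ : Equiv.Perm (Fin n))
    (hσ : ∀ i j, r' (σ i) < r' (σ j) ↔ r i < r j) :
    count r Δ d₁ d₂ = count r' Δ d₁ d₂ := by
  refine finsum_eq_of_bijective (fun δ => ⟨δ.1.relabel σ, δ.2.relabel σ hσ⟩) ⟨?_, ?_⟩
    fun δ => (mult_relabel σ).symm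
  · intro δ ε h
    have := congrArg (fun x : {δ : FloorDiagram n // δ.Valid r' Δ d₁ d₂} => x.1.relabel σ.symm) h
    simp only [relabel_relabel_symm] at this
    exact Subtype.ext this
  · rintro ⟨δ, h⟩
    refine ⟨⟨δ.relabel σ.symm, h.relabel σ.symm fun i j => ?_⟩, Subtype.ext ?_⟩
    · rw [← hσ]; simp
    · simpa using relabel_relabel_symm δ σ.symm

theorem count_eq {r r' : Fin n → ℝ} (hr : Function.Injective r) (hr' : Function.Injective r') :
    count r Δ d₁ d₂ = count r' Δ d₁ d₂ := by
  have key : ∀ {r : Fin n → ℝ}, Function.Injective r → StrictMono (r ∘ Tuple.sort r) := fun h =>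
    (Tuple.monotone_sort _).strictMono_of_injective (h.comp (Tuple.sort _).injective)
  have h := key hr
  have h' := key hr'
  refine count_eq_of_order ((Tuple.sort r).symm.trans (Tuple.sort r')) fun i j => ?_
  have e : ∀ i, r i = (r ∘ Tuple.sort r) ((Tuple.sort r).symm i) := fun i => by simp
  rw [e i, e j, h.lt_iff_lt]
  exact h'.lt_iff_lt

end FloorDiagram


theorem FloorDiagram.sum_half {n : ℕ} (δ : FloorDiagram n) {M : Type*} [AddCommMonoid M]
    (f : Fin n → Bool → M) (h : ∀ b s, δ.wt b = 0 → f b s = 0) :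
    ∑ e : δ.Half, f e.1.1 e.1.2 = ∑ b, ∑ s, f b s := by
  rw [← Fintype.sum_prod_type' f, ← Finset.sum_subtype (univ.filter fun e => 0 < δ.wt e.1)
    (by simp) (fun e : Fin n × Bool => f e.1 e.2), Finset.sum_filter_of_ne]
  rintro ⟨b, s⟩ - hb
  by_contra h0
  exact hb (h b s (by simpa using h0))

theorem finsum_cond_eq_sum {ι M : Type*} [Fintype ι] [AddCommMonoid M] (p : ι → Prop)
    [DecidablePred p] (f : ι → M) : ∑ᶠ (i) (_ : p i), f i = ∑ i, if p i then f i else 0 := by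
  rw [finsum_eq_sum_of_fintype]
  exact Finset.sum_congr rfl fun i _ => finsum_eq_if

/-! ### Counting points of an edge over a point of the circle -/

theorem AddCircle.coe_add_eq_coe_iff {T u x a : ℝ} :
    (u : AddCircle T) + (x : AddCircle T) = a ↔ ∃ m : ℤ, x = a - u + m * T := by
  rw [← AddCircle.coe_add, ← sub_eq_zero, ← AddCircle.coe_sub, AddCircle.coe_eq_zero_iff]
  constructor
  · rintro ⟨m, hm⟩
    exact ⟨m, by rw [zsmul_eq_mul] at hm; linarith⟩
  · rintro ⟨m, hm⟩
    exact ⟨m, by rw [zsmul_eq_mul]; linarith⟩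

theorem ncard_image_int {α : Type*} (f : ℤ → α) (hf : Function.Injective f) (i j : ℤ) :
    (f '' (Finset.Ico i j : Set ℤ)).ncard = (j - i).toNat := by
  rw [Set.ncard_image_of_injective _ hf, Set.ncard_coe_finset, Int.card_Ico]

section
variable {T u v a : ℝ} {k w : ℕ}

theorem ncard_Ico_fibre (hT : 0 < T) (hu : 0 ≤ u) (huT : u < T) (hv : 0 ≤ v) (hvT : v < T)
    (ha : 0 ≤ a) (haT : a < T) (hw : 0 < w) (hL : 0 < v - u + k * T) :
    (Set.ncard {t : ℝ | t ∈ Set.Ico 0 ((v - u + k * T) / w) ∧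
      (u : AddCircle T) + (((w : ℝ) * t : ℝ) : AddCircle T) = a} : ℤ) =
      k + (if u ≤ a then 1 else 0) - if v ≤ a then 1 else 0 := by
  have hw' : (0 : ℝ) < w := by exact_mod_cast hw
  have hset : {t : ℝ | t ∈ Set.Ico 0 ((v - u + k * T) / w) ∧
      (u : AddCircle T) + (((w : ℝ) * t : ℝ) : AddCircle T) = a} =
      (fun m : ℤ => (a - u + m * T) / w) '' (Finset.Ico (1 - if u ≤ a then 1 else 0)
        (k + 1 - if v ≤ a then 1 else 0 : ℤ) : Set ℤ) := by
    ext t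
    simp only [Set.mem_ofPred_eq, Set.mem_Ico, Set.mem_image, Finset.coe_Ico,
      AddCircle.coe_add_eq_coe_iff]
    have key : ∀ m : ℤ, (0 ≤ a - u + m * T ∧ a - u + m * T < v - u + k * T) ↔
        ((1 - if u ≤ a then 1 else 0) ≤ m ∧ m < (k + 1 - if v ≤ a then 1 else 0 : ℤ)) := by
      intro m
      apply and_congr
      · split_ifs with h
        · constructor
          · intro h1
            by_contra h2
            have : m ≤ -1 := by omega
            have : (m : ℝ) ≤ -1 := by exact_mod_cast this
            nlinarith
          · intro h1
            have : (0 : ℝ) ≤ m := by exact_mod_cast (by omega : 0 ≤ m)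
            nlinarith
        · constructor
          · intro h1
            by_contra h2
            have : (m : ℝ) ≤ 0 := by exact_mod_cast (by omega : m ≤ 0)
            nlinarith
          · intro h1
            have : (1 : ℝ) ≤ m := by exact_mod_cast (by omega : 1 ≤ m)
            nlinarith
      · split_ifs with h
        · constructor
          · intro h1
            by_contra h2
            have : (k : ℝ) ≤ m := by exact_mod_cast (by omega : (k : ℤ) ≤ m)
            nlinarith
          · intro h1
            have : (m : ℝ) ≤ k - 1 := by exact_mod_cast (by omega : m ≤ (k : ℤ) - 1)
            nlinarith
        · constructor
          · intro h1
            by_contra h2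
            have : (k : ℝ) + 1 ≤ m := by exact_mod_cast (by omega : (k : ℤ) + 1 ≤ m)
            nlinarith
          · intro h1
            have : (m : ℝ) ≤ k := by exact_mod_cast (by omega : m ≤ (k : ℤ))
            nlinarith
    constructor
    · rintro ⟨⟨h0, h1⟩, m, hm⟩
      refine ⟨m, (key m).1 ⟨?_, ?_⟩, ?_⟩
      · rw [← hm]; positivity
      · rw [← hm, mul_comm]; exact (lt_div_iff₀ hw').1 h1
      · rw [← hm]; field_simp
    · rintro ⟨m, hm, rfl⟩
      obtain ⟨h0, h1⟩ := (key m).2 hm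
      exact ⟨⟨by positivity, by gcongr⟩, m, by field_simp⟩
  rw [hset, ncard_image_int]
  · rw [Int.toNat_of_nonneg]
    · ring
    · rcases Nat.eq_zero_or_pos k with hk | hk
      · subst hk
        norm_num at hL
        split_ifs <;> first | (exfalso; linarith) | norm_num
      · split_ifs <;> omega
  · intro m m' h
    have h1 : a - u + m * T = a - u + m' * T := by
      field_simp at h; linarith
    have h2 : (m : ℝ) * T = m' * T := by linarith
    exact_mod_cast mul_right_cancel₀ hT.ne' h2

theorem ncard_Ioc_fibre (hT : 0 < T) (hu : 0 ≤ u) (huT : u < T) (hv : 0 ≤ v) (hvT : v < T)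
    (ha : 0 ≤ a) (haT : a < T) (hw : 0 < w) (hL : 0 < v - u + k * T) :
    (Set.ncard {t : ℝ | t ∈ Set.Ioc 0 ((v - u + k * T) / w) ∧
      (u : AddCircle T) + (((w : ℝ) * t : ℝ) : AddCircle T) = a} : ℤ) =
      k + (if u < a then 1 else 0) - if v < a then 1 else 0 := by
  have hw' : (0 : ℝ) < w := by exact_mod_cast hw
  have hset : {t : ℝ | t ∈ Set.Ioc 0 ((v - u + k * T) / w) ∧
      (u : AddCircle T) + (((w : ℝ) * t : ℝ) : AddCircle T) = a} =
      (fun m : ℤ => (a - u + m * T) / w) '' (Finset.Ico (1 - if u < a then 1 else 0)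
        (k + 1 - if v < a then 1 else 0 : ℤ) : Set ℤ) := by
    ext t
    simp only [Set.mem_ofPred_eq, Set.mem_Ioc, Set.mem_image, Finset.coe_Ico, Set.mem_Ico,
      AddCircle.coe_add_eq_coe_iff]
    have key : ∀ m : ℤ, (0 < a - u + m * T ∧ a - u + m * T ≤ v - u + k * T) ↔
        ((1 - if u < a then 1 else 0) ≤ m ∧ m < (k + 1 - if v < a then 1 else 0 : ℤ)) := by
      intro m
      apply and_congr
      · split_ifs with h
        · constructor
          · intro h1
            by_contra h2
            have : m ≤ -1 := by omega
            have : (m : ℝ) ≤ -1 := by exact_mod_cast this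
            nlinarith
          · intro h1
            have : (0 : ℝ) ≤ m := by exact_mod_cast (by omega : 0 ≤ m)
            nlinarith
        · constructor
          · intro h1
            by_contra h2
            have : (m : ℝ) ≤ 0 := by exact_mod_cast (by omega : m ≤ 0)
            nlinarith
          · intro h1
            have : (1 : ℝ) ≤ m := by exact_mod_cast (by omega : 1 ≤ m)
            nlinarith
      · split_ifs with h
        · constructor
          · intro h1
            by_contra h2
            have : (k : ℝ) ≤ m := by exact_mod_cast (by omega : (k : ℤ) ≤ m)
            nlinarith
          · intro h1
            have : (m : ℝ) ≤ k - 1 := by exact_mod_cast (by omega : m ≤ (k : ℤ) - 1)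
            nlinarith
        · constructor
          · intro h1
            by_contra h2
            have : (k : ℝ) + 1 ≤ m := by exact_mod_cast (by omega : (k : ℤ) + 1 ≤ m)
            nlinarith
          · intro h1
            have : (m : ℝ) ≤ k := by exact_mod_cast (by omega : m ≤ (k : ℤ))
            nlinarith
    constructor
    · rintro ⟨⟨h0, h1⟩, m, hm⟩
      refine ⟨m, (key m).1 ⟨?_, ?_⟩, ?_⟩
      · rw [← hm]; positivity
      · rw [← hm, mul_comm]; exact (le_div_iff₀ hw').1 h1
      · rw [← hm]; field_simp
    · rintro ⟨m, hm, rfl⟩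
      obtain ⟨h0, h1⟩ := (key m).2 hm
      exact ⟨⟨by positivity, by gcongr⟩, m, by field_simp⟩
  rw [hset, ncard_image_int]
  · rw [Int.toNat_of_nonneg]
    · ring
    · rcases Nat.eq_zero_or_pos k with hk | hk
      · subst hk
        norm_num at hL
        split_ifs <;> first | (exfalso; linarith) | norm_num
      · split_ifs <;> omega
  · intro m m' h
    have h1 : a - u + m * T = a - u + m' * T := by
      field_simp at h; linarith
    have h2 : (m : ℝ) * T = m' * T := by linarith
    exact_mod_cast mul_right_cancel₀ hT.ne' h2

end


namespace CurledPearlChain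

variable {T : ℝ} {Δ : Multiset ℤ} {d₁ d₂ g n : ℕ} {r : Fin n → ℝ}

/-- A presentation of a curled pearl chain by a floor diagram with points at the positions `r`. -/
structure Marking (c : CurledPearlChain T Δ d₂ g fun i => (r i : AddCircle T))
    (δ : FloorDiagram n) where
  vtx : Fin n ≃ c.W ⊕ c.B
  edge : δ.Half ≃ c.E
  pos : ∀ i, c.pos (vtx i) = r i
  isLeft : ∀ i, (vtx i).isLeft ↔ δ.wt i = 0
  white : ∀ e, vtx (δ.floor e.1.1 e.1.2) = .inl (c.white (edge e))
  black : ∀ e, vtx e.1.1 = .inr (c.black (edge e))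
  fwd : ∀ e, c.fwd (edge e) = e.1.2
  wt : ∀ e, c.wt (edge e) = δ.wt e.1.1
  len : ∀ e, c.len (edge e) =
    (r (δ.finish e.1.1 e.1.2) - r (δ.start e.1.1 e.1.2) + δ.wind e.1.1 e.1.2 * T) / δ.wt e.1.1
  floor_white : ∀ i, δ.wt i = 0 → ∀ s, δ.floor i s = i
  wind_white : ∀ i, δ.wt i = 0 → ∀ s, δ.wind i s = 0

namespace Marking

variable {c c' : CurledPearlChain T Δ d₂ g fun i => (r i : AddCircle T)} {δ δ' : FloorDiagram n}

theorem start_eq (m : Marking c δ) (e : δ.Half) :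
    c.start (m.edge e) = r (δ.start e.1.1 e.1.2) := by
  unfold CurledPearlChain.start FloorDiagram.start
  rw [m.fwd, ← m.pos]
  split_ifs with h
  · rw [m.white]
  · rw [m.black]

theorem wt_floor (m : Marking c δ) (i : Fin n) (s : Bool) : δ.wt (δ.floor i s) = 0 := by
  rcases Nat.eq_zero_or_pos (δ.wt i) with hi | hi
  · rw [m.floor_white i hi, hi]
  · rw [← m.isLeft, m.white ⟨(i, s), hi⟩]; rfl

theorem length_pos (m : Marking c δ) (e : δ.Half) :
    0 < r (δ.finish e.1.1 e.1.2) - r (δ.start e.1.1 e.1.2) + δ.wind e.1.1 e.1.2 * T := by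
  have h := c.len_pos (m.edge e)
  rw [m.len] at h
  have hw : (0 : ℝ) < δ.wt e.1.1 := by exact_mod_cast e.2
  exact (div_pos_iff_of_pos_right hw).1 h

theorem floor_ne (m : Marking c δ) (i : Fin n) (hi : 0 < δ.wt i) :
    δ.floor i true ≠ δ.floor i false := by
  intro h
  have h1 := m.white ⟨(i, true), hi⟩
  have h2 := m.white ⟨(i, false), hi⟩
  simp only at h1 h2
  rw [h, h2] at h1
  have h3 := m.black ⟨(i, true), hi⟩
  have h4 := m.black ⟨(i, false), hi⟩
  simp only at h3 h4
  rw [h4] at h3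
  have := c.no_two_cycle _ _ (Sum.inl_injective h1).symm (Sum.inr_injective h3).symm
  simpa using m.edge.injective this

variable (hT : 0 < T) (hr : ∀ i, r i ∈ Set.Ico 0 T)
include hT hr

theorem degOut_eq (m : Marking c δ) {a : ℝ} (ha : a ∈ Set.Ico 0 T) :
    (c.degOut a : ℤ) = δ.base - ∑ i ∈ univ.filter (fun i => r i ≤ a), δ.leak i := by
  rw [FloorDiagram.base_sub_sum]
  unfold degOut
  rw [← Equiv.sum_comp m.edge, ← δ.sum_half _ (fun b s h => by simp [h])]
  push_cast
  refine Finset.sum_congr rfl fun e _ => ?_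
  rw [m.start_eq, m.wt, m.len, ncard_Ico_fibre hT (hr _).1 (hr _).2 (hr _).1 (hr _).2 ha.1 ha.2 e.2
    (m.length_pos e)]
  simp

theorem degIn_eq (m : Marking c δ) {a : ℝ} (ha : a ∈ Set.Ico 0 T) :
    (c.degIn a : ℤ) = δ.base - ∑ i ∈ univ.filter (fun i => r i < a), δ.leak i := by
  rw [FloorDiagram.base_sub_sum]
  unfold degIn
  rw [← Equiv.sum_comp m.edge, ← δ.sum_half _ (fun b s h => by simp [h])]
  push_cast
  refine Finset.sum_congr rfl fun e _ => ?_
  rw [m.start_eq, m.wt, m.len, ncard_Ioc_fibre hT (hr _).1 (hr _).2 (hr _).1 (hr _).2 ha.1 ha.2 e.2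
    (m.length_pos e)]
  simp

theorem degrees_eq (m : Marking c δ) :
    δ.degrees r = (fun k : ℕ => (k : ℤ)) '' (Set.range c.degOut ∪ Set.range c.degIn) := by
  have hrep : ∀ a : AddCircle T, ∃ x ∈ Set.Ico 0 T, (x : AddCircle T) = a := by
    have : Fact (0 < T) := ⟨hT⟩
    intro a
    refine ⟨(AddCircle.equivIco T 0 a).1, ?_, AddCircle.coe_equivIco⟩
    simpa using (AddCircle.equivIco T 0 a).2
  ext k
  constructor
  · rintro ⟨S, hS, rfl⟩
    rcases S.eq_empty_or_nonempty with rfl | hne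
    · refine ⟨_, Or.inr ⟨((0 : ℝ) : AddCircle T), rfl⟩, ?_⟩
      have : univ.filter (fun i => r i < 0) = ∅ :=
        Finset.filter_false_of_mem fun i _ => not_lt.2 (hr i).1
      change (c.degIn _ : ℤ) = _
      rw [m.degIn_eq hT hr ⟨le_rfl, hT⟩, this]
    · obtain ⟨j, hj, hmax⟩ := S.exists_max_image r hne
      refine ⟨_, Or.inl ⟨(r j : AddCircle T), rfl⟩, ?_⟩
      change (c.degOut _ : ℤ) = _
      rw [m.degOut_eq hT hr (hr j)]
      have : univ.filter (fun i => r i ≤ r j) = S ∪ univ.filter (fun i => r i = r j ∧ i ∉ S) := by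
        ext i
        simp only [mem_filter, mem_univ, true_and, mem_union]
        constructor
        · intro h
          by_cases hi : i ∈ S
          · exact Or.inl hi
          · exact Or.inr ⟨h.antisymm (not_lt.1 fun h' => hi (hS j hj i h')), hi⟩
        · rintro (h | h)
          · exact hmax i h
          · exact h.1.le
      have hinj : univ.filter (fun i => r i = r j ∧ i ∉ S) = ∅ := by
        refine Finset.filter_false_of_mem fun i _ hi => hi.2 ?_
        have : m.vtx i = m.vtx j := by
          obtain ⟨v, -, hv⟩ := c.point j
          rw [hv (m.vtx i) (by simp only [m.pos, hi.1]), hv (m.vtx j) (m.pos j)]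
        rw [m.vtx.injective this]
        exact hj
      rw [this, hinj, Finset.union_empty]
  · rintro ⟨k, h | h, rfl⟩
    · obtain ⟨a, rfl⟩ := h
      obtain ⟨x, hx, rfl⟩ := hrep a
      refine ⟨_, ?_, m.degOut_eq hT hr hx⟩
      intro i hi j hj
      simp only [mem_filter, mem_univ, true_and] at hi ⊢
      exact hj.le.trans hi
    · obtain ⟨a, rfl⟩ := h
      obtain ⟨x, hx, rfl⟩ := hrep a
      refine ⟨_, ?_, m.degIn_eq hT hr hx⟩
      intro i hi j hj
      simp only [mem_filter, mem_univ, true_and] at hi ⊢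
      exact hj.trans hi

theorem hasDegree_iff (m : Marking c δ) : c.HasDegree d₁ ↔ IsLeast (δ.degrees r) d₁ := by
  rw [m.degrees_eq hT hr, HasDegree]
  constructor
  · rintro ⟨h1, h2⟩
    refine ⟨⟨_, h1, rfl⟩, ?_⟩
    rintro _ ⟨k, hk, rfl⟩
    exact Int.ofNat_le.2 (h2 hk)
  · rintro ⟨⟨k, h1, hk⟩, h2⟩
    obtain rfl : k = d₁ := Int.ofNat_injective hk
    exact ⟨h1, fun l hl => Int.ofNat_le.1 (h2 ⟨l, hl, rfl⟩)⟩

omit hT hr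

theorem card_whites (m : Marking c δ) : #δ.whites = d₂ := by
  rw [← c.card_white, ← Finset.card_univ,
    ← Finset.card_map (Function.Embedding.inl (α := c.W) (β := c.B))]
  refine Finset.card_bij (fun i _ => m.vtx i) (fun i hi => ?_) (fun i _ j _ h => m.vtx.injective h)
    fun v hv => ?_
  · rw [FloorDiagram.mem_whites, ← m.isLeft] at hi
    obtain ⟨w, hw⟩ := Sum.isLeft_iff.1 hi
    simp [hw]
  · obtain ⟨w, -, rfl⟩ := Finset.mem_map.1 hv
    refine ⟨m.vtx.symm (.inl w), ?_, by simp⟩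
    rw [FloorDiagram.mem_whites, ← m.isLeft]
    simp

theorem leaking_eq (m : Marking c δ) (v : c.W) {i : Fin n} (hi : m.vtx i = .inl v) :
    ∑ᶠ (e : c.E) (_ : c.white e = v), (if c.fwd e then -(c.wt e : ℤ) else (c.wt e : ℤ)) =
      δ.leak i := by
  classical
  have hw : δ.wt i = 0 := by rw [← m.isLeft, hi]; rfl
  rw [finsum_cond_eq_sum, ← Equiv.sum_comp m.edge]
  have h1 : ∀ e, c.white (m.edge e) = v ↔ δ.floor e.1.1 e.1.2 = i := by
    intro e
    rw [← m.vtx.apply_eq_iff_eq, m.white, hi, Sum.inl.injEq]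
  simp only [h1, m.fwd, m.wt]
  rw [δ.sum_half (fun b s => if δ.floor b s = i then (if s then -(δ.wt b : ℤ) else δ.wt b) else 0)
    (fun b s h => by simp [h])]
  refine Finset.sum_congr rfl fun b _ => ?_
  rw [FloorDiagram.coef_eq hw, Fintype.sum_bool]
  by_cases h1 : δ.floor b false = i <;> by_cases h2 : δ.floor b true = i <;> simp [h1, h2]

theorem leaky (m : Marking c δ) : δ.whites.val.map δ.leak = Δ := by
  classical
  rw [← c.leaking]
  have h : (univ : Finset c.W).map Function.Embedding.inl = δ.whites.map m.vtx.toEmbedding := by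
    ext v
    simp only [mem_map, mem_univ, true_and, Function.Embedding.inl_apply,
      FloorDiagram.mem_whites, ← m.isLeft, Equiv.coe_toEmbedding]
    constructor
    · rintro ⟨w, rfl⟩
      exact ⟨m.vtx.symm (.inl w), by simp, by simp⟩
    · rintro ⟨i, hi, rfl⟩
      obtain ⟨w, hw⟩ := Sum.isLeft_iff.1 hi
      exact ⟨w, hw.symm⟩
  have h2 := congrArg (fun s : Finset (c.W ⊕ c.B) => s.val.map (δ.leak ∘ m.vtx.symm)) h
  simp only [Finset.map_val, Multiset.map_map] at h2
  calc _ = δ.whites.val.map ((δ.leak ∘ m.vtx.symm) ∘ m.vtx.toEmbedding) :=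
        Multiset.map_congr rfl fun i _ => by simp
    _ = _ := h2.symm
    _ = _ := Multiset.map_congr rfl fun w _ => by
        rw [m.leaking_eq w (i := m.vtx.symm (.inl w)) (by simp)]
        rfl

theorem mult_eq (m : Marking c δ) : c.mult = δ.mult :=
  (Fintype.prod_equiv m.edge _ _ fun e => (m.wt e).symm).symm

theorem connected (m : Marking c δ) : δ.graph.Connected := by
  let φ : δ.graph ≃g (SimpleGraph.fromRel fun a b : c.W ⊕ c.B =>
      ∃ e, a = .inl (c.white e) ∧ b = .inr (c.black e)) := by
    refine ⟨m.vtx, fun {i j} => ?_⟩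
    have key : ∀ i j, i ≠ j → ((∃ e, m.vtx i = .inl (c.white e) ∧ m.vtx j = .inr (c.black e)) ↔
        ∃ s, i = δ.floor j s) := by
      intro i j hij
      constructor
      · rintro ⟨e, h1, h2⟩
        obtain ⟨e, rfl⟩ := m.edge.surjective e
        rw [← m.white, m.vtx.apply_eq_iff_eq] at h1
        rw [← m.black, m.vtx.apply_eq_iff_eq] at h2
        exact ⟨e.1.2, by rw [h1, h2]⟩
      · rintro ⟨s, rfl⟩
        have hj : 0 < δ.wt j := by
          by_contra h
          exact hij (m.floor_white j (by omega) s)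
        exact ⟨m.edge ⟨(j, s), hj⟩, m.white ⟨(j, s), hj⟩, m.black ⟨(j, s), hj⟩⟩
    simp only [SimpleGraph.fromRel_adj, FloorDiagram.graph]
    refine ⟨fun ⟨h, h'⟩ => ?_, fun ⟨h, h'⟩ => ?_⟩
    · have hij : i ≠ j := fun e => h (by rw [e])
      rw [key i j hij, key j i hij.symm] at h'
      exact ⟨hij, h'.symm⟩
    · refine ⟨fun e => h (m.vtx.injective e), ?_⟩
      rw [key i j h, key j i h.symm]
      exact h'.symm
  exact φ.connected_iff.2 c.connected

theorem valid (m : Marking c δ) (hT : 0 < T) (hr : ∀ i, r i ∈ Set.Ico 0 T)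
    (hd : c.HasDegree d₁) : δ.Valid r Δ d₁ d₂ where
  floor_white := m.floor_white
  wind_white := m.wind_white
  wt_floor := m.wt_floor
  floor_ne := m.floor_ne
  lt_or_wind i hi s := by
    have h := m.length_pos ⟨(i, s), hi⟩
    rcases Nat.eq_zero_or_pos (δ.wind i s) with h0 | h0
    · left
      simp only [h0, Nat.cast_zero, zero_mul, add_zero, sub_pos] at h
      exact h
    · exact Or.inr h0
  card_whites := m.card_whites
  leaky := m.leaky
  connected := m.connected
  degree := (m.hasDegree_iff hT hr).1 hd

/-- Curled pearl chains with the same floor diagram are isomorphic. -/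
theorem nonempty_iso (m : Marking c δ) (m' : Marking c' δ) : Nonempty (Iso c c') := by
  have hL : ∀ v : c.W ⊕ c.B, v.isLeft ↔ ((m.vtx.symm.trans m'.vtx) v).isLeft := by
    intro v
    obtain ⟨i, rfl⟩ := m.vtx.surjective v
    simp [m.isLeft, m'.isLeft]
  let φ := m.vtx.symm.trans m'.vtx
  have hW : ∀ w : c.W, ∃ w', φ (.inl w) = .inl w' := fun w =>
    Sum.isLeft_iff.1 ((hL (.inl w)).1 rfl)
  have hB : ∀ b : c.B, ∃ b', φ (.inr b) = .inr b' := fun b => by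
    refine Sum.isRight_iff.1 ?_
    rw [← Sum.not_isLeft]
    simpa [φ] using (hL (.inr b)).not.1 (by simp)
  choose fW hfW using hW
  choose fB hfB using hB
  have bW : Function.Bijective fW := by
    rw [Fintype.bijective_iff_injective_and_card]
    refine ⟨fun a b h => Sum.inl_injective (φ.injective (by rw [hfW, hfW, h])), ?_⟩
    rw [c.card_white, c'.card_white]
  have bB : Function.Bijective fB := by
    rw [Fintype.bijective_iff_injective_and_card]
    refine ⟨fun a b h => Sum.inr_injective (φ.injective (by rw [hfB, hfB, h])), ?_⟩
    have h1 := c.card_black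
    have h2 := c'.card_black
    omega
  refine ⟨⟨Equiv.ofBijective fW bW, Equiv.ofBijective fB bB, m.edge.symm.trans m'.edge,
    fun e => ?_, fun e => ?_, fun e => ?_, fun e => ?_, fun e => ?_, fun v => ?_⟩⟩
  · obtain ⟨e, rfl⟩ := m.edge.surjective e
    apply Sum.inl_injective (β := c'.B)
    simp only [Equiv.trans_apply, Equiv.symm_apply_apply, Equiv.ofBijective_apply, ← hfW,
      ← m'.white, ← m.white, φ]
  · obtain ⟨e, rfl⟩ := m.edge.surjective e
    apply Sum.inr_injective (α := c'.W)
    simp only [Equiv.trans_apply, Equiv.symm_apply_apply, Equiv.ofBijective_apply, ← hfB,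
      ← m'.black, ← m.black, φ]
  · obtain ⟨e, rfl⟩ := m.edge.surjective e
    simp [m.len, m'.len]
  · obtain ⟨e, rfl⟩ := m.edge.surjective e
    simp [m.fwd, m'.fwd]
  · obtain ⟨e, rfl⟩ := m.edge.surjective e
    simp [m.wt, m'.wt]
  · have hv : Sum.map (Equiv.ofBijective fW bW) (Equiv.ofBijective fB bB) v = φ v := by
      rcases v with w | b
      · exact (hfW w).symm
      · exact (hfB b).symm
    rw [hv]
    obtain ⟨i, rfl⟩ := m.vtx.surjective v
    simp [φ, m.pos, m'.pos]

/-- Markings are transported along isomorphisms. -/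
def map (m : Marking c δ) (i : Iso c c') : Marking c' δ where
  vtx := m.vtx.trans (Equiv.sumCongr i.eW i.eB)
  edge := m.edge.trans i.eE
  pos j := by
    have := i.pos (m.vtx j)
    rw [m.pos] at this
    exact this
  isLeft j := by
    rw [← m.isLeft]
    simp only [Equiv.trans_apply]
    rcases m.vtx j with w | b <;> simp
  white e := by simp [m.white, i.white]
  black e := by simp [m.black, i.black]
  fwd e := by simp [m.fwd, i.fwd]
  wt e := by simp [m.wt, i.wt]
  len e := by simp [m.len, i.len]
  floor_white := m.floor_white
  wind_white := m.wind_white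

/-- The floor diagram of a curled pearl chain is unique. -/
theorem eq_of_marking (hT : 0 < T) (m : Marking c δ) (m' : Marking c δ') : δ = δ' := by
  have hv : ∀ i, m.vtx i = m'.vtx i := by
    intro i
    obtain ⟨v, -, hv⟩ := c.point i
    rw [hv _ (m.pos i), hv _ (m'.pos i)]
  have hvv : m.vtx = m'.vtx := Equiv.ext hv
  have hw0 : ∀ i, δ.wt i = 0 ↔ δ'.wt i = 0 := by
    intro i
    rw [← m.isLeft, ← m'.isLeft, hv]
  have he : ∀ (i : Fin n) (s : Bool) (h : 0 < δ.wt i) (h' : 0 < δ'.wt i),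
      m.edge ⟨(i, s), h⟩ = m'.edge ⟨(i, s), h'⟩ := by
    intro i s h h'
    obtain ⟨e', he'⟩ := m'.edge.surjective (m.edge ⟨(i, s), h⟩)
    have h1 := m'.black e'
    rw [he', ← m.black, hvv, m'.vtx.apply_eq_iff_eq] at h1
    have h2 := m'.fwd e'
    rw [he', m.fwd] at h2
    rw [← he']
    congr 1
    exact Subtype.ext (Prod.ext h1 h2.symm)
  have hwt : ∀ i, δ.wt i = δ'.wt i := by
    intro i
    rcases Nat.eq_zero_or_pos (δ.wt i) with h | h
    · rw [h, (hw0 i).1 h]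
    · have h' : 0 < δ'.wt i := Nat.pos_of_ne_zero fun e => h.ne' ((hw0 i).2 e)
      have := m.wt ⟨(i, true), h⟩
      rw [he i true h h', m'.wt] at this
      exact this.symm
  have hfl : ∀ i s, δ.floor i s = δ'.floor i s := by
    intro i s
    rcases Nat.eq_zero_or_pos (δ.wt i) with h | h
    · rw [m.floor_white i h, m'.floor_white i ((hw0 i).1 h)]
    · have h' : 0 < δ'.wt i := by rwa [← hwt]
      have h1 := m.white ⟨(i, s), h⟩
      rw [he i s h h', ← m'.white, hvv, m'.vtx.apply_eq_iff_eq] at h1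
      exact h1
  refine FloorDiagram.ext (funext fun i => funext fun s => hfl i s)
    (funext fun i => funext fun s => ?_) (funext hwt)
  rcases Nat.eq_zero_or_pos (δ.wt i) with h | h
  · rw [m.wind_white i h, m'.wind_white i ((hw0 i).1 h)]
  · have h' : 0 < δ'.wt i := by rwa [← hwt]
    have h1 := m.len ⟨(i, s), h⟩
    rw [he i s h h', m'.len] at h1
    have hw : (0 : ℝ) < δ'.wt i := by exact_mod_cast h'
    simp only [hwt] at h1
    rw [div_left_inj' hw.ne'] at h1
    have hs : δ.start i s = δ'.start i s := by simp [FloorDiagram.start, hfl]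
    have hf : δ.finish i s = δ'.finish i s := by simp [FloorDiagram.finish, hfl]
    rw [hs, hf] at h1
    have h2 : (δ.wind i s : ℝ) * T = δ'.wind i s * T := by linarith
    exact_mod_cast mul_right_cancel₀ hT.ne' h2

end Marking

end CurledPearlChain


theorem FloorDiagram.card_half {n : ℕ} (δ : FloorDiagram n) :
    Fintype.card δ.Half = 2 * Fintype.card {i // 0 < δ.wt i} := by
  rw [mul_comm, ← Fintype.card_bool, ← Fintype.card_prod]
  exact Fintype.card_congr ⟨fun e => (⟨e.1.1, e.2⟩, e.1.2), fun e => ⟨(e.1.1, e.2), e.1.2⟩,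
    fun _ => rfl, fun _ => rfl⟩

theorem FloorDiagram.card_black_add {n : ℕ} (δ : FloorDiagram n) :
    Fintype.card {i // 0 < δ.wt i} + #δ.whites = n := by
  rw [Fintype.card_subtype, add_comm]
  have := Finset.card_filter_add_card_filter_not (s := (univ : Finset (Fin n)))
    (fun i => δ.wt i = 0)
  simp only [← Nat.pos_iff_ne_zero, Finset.card_univ, Fintype.card_fin] at this
  exact this

namespace CurledPearlChain

variable {T : ℝ} {Δ : Multiset ℤ} {d₁ d₂ g n : ℕ} {r : Fin n → ℝ} {δ : FloorDiagram n}

/-- The vertices of the pearl chain of a floor diagram. -/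
def diagramVtx (δ : FloorDiagram n) : Fin n ≃ {i // δ.wt i = 0} ⊕ {i // 0 < δ.wt i} where
  toFun i := if h : δ.wt i = 0 then .inl ⟨i, h⟩ else .inr ⟨i, Nat.pos_of_ne_zero h⟩
  invFun := Sum.elim Subtype.val Subtype.val
  left_inv i := by by_cases h : δ.wt i = 0 <;> simp [h]
  right_inv v := by
    rcases v with ⟨i, h⟩ | ⟨i, h⟩
    · simp [h]
    · simp [h.ne']

/-- The pearl chain of a floor diagram. -/
def diagramChain (h : δ.Valid r Δ d₁ d₂) (hn : n + 1 = 2 * d₂ + g) : PearlChain d₂ g where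
  W := {i // δ.wt i = 0}
  B := {i // 0 < δ.wt i}
  E := δ.Half
  white e := ⟨δ.floor e.1.1 e.1.2, h.wt_floor _ _⟩
  black e := ⟨e.1.1, e.2⟩
  card_white := by rw [Fintype.card_subtype]; exact h.card_whites
  card_black := by
    have := δ.card_black_add
    rw [h.card_whites] at this
    omega
  two_valent b := by
    rw [← Nat.card_eq_two_iff.2 ⟨true, false, by simp, by ext x; cases x <;> simp⟩]
    exact Nat.card_congr ⟨fun e => e.1.1.2, fun s => ⟨⟨(b.1, s), b.2⟩, rfl⟩, by
      rintro ⟨⟨⟨i, s⟩, h⟩, rfl⟩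
      rfl, fun _ => rfl⟩
  no_two_cycle := by
    rintro ⟨⟨i, s⟩, hi⟩ ⟨⟨j, t⟩, hj⟩ hw hb
    obtain rfl : i = j := congrArg Subtype.val hb
    have hw : δ.floor i s = δ.floor i t := congrArg Subtype.val hw
    have := h.floor_ne i hi
    cases s <;> cases t <;> first | rfl | exact absurd hw this | exact absurd hw.symm this
  connected := by
    let φ : δ.graph ≃g (SimpleGraph.fromRel fun a b : {i // δ.wt i = 0} ⊕ {i // 0 < δ.wt i} =>
        ∃ e : δ.Half, a = .inl ⟨δ.floor e.1.1 e.1.2, h.wt_floor _ _⟩ ∧ b = .inr ⟨e.1.1, e.2⟩) := by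
      refine ⟨diagramVtx δ, fun {i j} => ?_⟩
      have key : ∀ i j, i ≠ j → ((∃ e : δ.Half, diagramVtx δ i =
          .inl ⟨δ.floor e.1.1 e.1.2, h.wt_floor _ _⟩ ∧ diagramVtx δ j = .inr ⟨e.1.1, e.2⟩) ↔
          ∃ s, i = δ.floor j s) := by
        intro i j hij
        constructor
        · rintro ⟨e, h1, h2⟩
          have h1 := (diagramVtx δ).eq_symm_apply.2 h1
          have h2 := (diagramVtx δ).eq_symm_apply.2 h2
          exact ⟨e.1.2, by rw [h1, h2]; rfl⟩
        · rintro ⟨s, rfl⟩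
          have hj : 0 < δ.wt j := by
            by_contra h'
            exact hij (h.floor_white j (by omega) s)
          refine ⟨⟨(j, s), hj⟩, ?_, ?_⟩
          · rw [← (diagramVtx δ).eq_symm_apply]; rfl
          · rw [← (diagramVtx δ).eq_symm_apply]; rfl
      simp only [SimpleGraph.fromRel_adj, FloorDiagram.graph]
      refine ⟨fun ⟨h, h'⟩ => ?_, fun ⟨h, h'⟩ => ?_⟩
      · have hij : i ≠ j := fun e => h (by rw [e])
        rw [key i j hij, key j i hij.symm] at h'
        exact ⟨hij, h'.symm⟩
      · refine ⟨fun e => h ((diagramVtx δ).injective e), ?_⟩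
        rw [key i j h, key j i h.symm]
        exact h'.symm
    exact φ.connected_iff.1 h.connected
  genus_eq := by
    have h1 := δ.card_half
    have h2 := δ.card_black_add
    have h3 := Fintype.card_congr (diagramVtx δ)
    rw [h.card_whites] at h2
    rw [← h3, Fintype.card_fin]
    omega

theorem diagram_length_pos (hT : 0 < T) (hr : ∀ i, r i ∈ Set.Ico 0 T) (h : δ.Valid r Δ d₁ d₂)
    (e : δ.Half) :
    0 < r (δ.finish e.1.1 e.1.2) - r (δ.start e.1.1 e.1.2) + δ.wind e.1.1 e.1.2 * T := by
  rcases h.lt_or_wind e.1.1 e.2 e.1.2 with hlt | hw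
  · have : 0 ≤ δ.wind e.1.1 e.1.2 * T := by positivity
    linarith
  · have : (1 : ℝ) ≤ δ.wind e.1.1 e.1.2 := by exact_mod_cast hw
    have h1 := (hr (δ.finish e.1.1 e.1.2)).1
    have h2 := (hr (δ.start e.1.1 e.1.2)).2
    nlinarith

theorem elim_diagramVtx {α : Type*} (P : Fin n → α) (i : Fin n) :
    Sum.elim (fun i => P i.1) (fun i => P i.1) (diagramVtx δ i) = P i := by
  unfold diagramVtx
  by_cases hi : δ.wt i = 0 <;> simp [hi]

theorem isLeft_diagramVtx (i : Fin n) : (diagramVtx δ i).isLeft ↔ δ.wt i = 0 := by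
  unfold diagramVtx
  by_cases hi : δ.wt i = 0 <;> simp [hi]

theorem diagramVtx_white (i : {i // δ.wt i = 0}) : diagramVtx δ i.1 = .inl i := by
  rw [← Equiv.eq_symm_apply]; rfl

theorem diagramVtx_black (i : {i // 0 < δ.wt i}) : diagramVtx δ i.1 = .inr i := by
  rw [← Equiv.eq_symm_apply]; rfl

theorem diagramVtx_unique {α : Type*} {P : Fin n → α} (hP : Function.Injective P) {i : Fin n}
    {v : {i // δ.wt i = 0} ⊕ {i // 0 < δ.wt i}}
    (hv : Sum.elim (fun i => P i.1) (fun i => P i.1) v = P i) : v = diagramVtx δ i := by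
  rw [← Equiv.symm_apply_eq]
  apply hP
  rw [← hv]
  rcases v with v | v <;> rfl

theorem diagram_leaking (h : δ.Valid r Δ d₁ d₂) :
    (univ : Finset {i // δ.wt i = 0}).val.map (fun v => ∑ᶠ (e : δ.Half)
        (_ : (⟨δ.floor e.1.1 e.1.2, h.wt_floor _ _⟩ : {i // δ.wt i = 0}) = v),
        (if e.1.2 then -(δ.wt e.1.1 : ℤ) else (δ.wt e.1.1 : ℤ))) = Δ := by
  classical
  have : ∀ v : {i // δ.wt i = 0}, ∑ᶠ (e : δ.Half)
      (_ : (⟨δ.floor e.1.1 e.1.2, h.wt_floor _ _⟩ : {i // δ.wt i = 0}) = v),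
      (if e.1.2 then -(δ.wt e.1.1 : ℤ) else (δ.wt e.1.1 : ℤ)) = δ.leak v.1 := by
    intro v
    rw [finsum_cond_eq_sum]
    simp only [Subtype.ext_iff]
    rw [δ.sum_half (fun b s => if δ.floor b s = v then (if s then -(δ.wt b : ℤ) else δ.wt b)
      else 0) (fun b s h => by simp [h])]
    refine Finset.sum_congr rfl fun b _ => ?_
    rw [FloorDiagram.coef_eq v.2, Fintype.sum_bool]
    by_cases h1 : δ.floor b false = v <;> by_cases h2 : δ.floor b true = v <;> simp [h1, h2]
  refine (Multiset.map_congr rfl fun v _ => this v).trans ?_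
  have h2 : δ.whites = (univ : Finset {i // δ.wt i = 0}).map (Function.Embedding.subtype _) := by
    ext i
    simp
  refine Eq.trans ?_ h.leaky
  rw [h2, Finset.map_val, Multiset.map_map]
  rfl

theorem diagram_balanced (b : {i // 0 < δ.wt i}) :
    ∑ᶠ (e : δ.Half) (_ : (⟨e.1.1, e.2⟩ : {i // 0 < δ.wt i}) = b),
        (if e.1.2 then (δ.wt e.1.1 : ℤ) else -(δ.wt e.1.1 : ℤ)) = 0 := by
  classical
  rw [finsum_cond_eq_sum]
  simp only [Subtype.ext_iff]
  rw [δ.sum_half (fun c s => if c = b then (if s then (δ.wt c : ℤ) else -δ.wt c)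
      else 0) (fun b s h => by simp [h])]
  refine Finset.sum_eq_zero fun c _ => ?_
  rw [Fintype.sum_bool]
  by_cases h1 : c = b <;> simp [h1]

theorem diagram_affine (e : δ.Half) : (r (δ.finish e.1.1 e.1.2) : AddCircle T) =
    r (δ.start e.1.1 e.1.2) + (((δ.wt e.1.1 : ℝ) * ((r (δ.finish e.1.1 e.1.2) -
      r (δ.start e.1.1 e.1.2) + δ.wind e.1.1 e.1.2 * T) / δ.wt e.1.1) : ℝ) : AddCircle T) := by
  have hw : (δ.wt e.1.1 : ℝ) ≠ 0 := by exact_mod_cast e.2.ne'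
  rw [mul_div_cancel₀ _ hw]
  symm
  rw [AddCircle.coe_add_eq_coe_iff]
  exact ⟨δ.wind e.1.1 e.1.2, by rw [Int.cast_natCast]⟩

theorem diagram_pos (P : Fin n → AddCircle T) (h : ∀ i s, δ.wt (δ.floor i s) = 0) (e : δ.Half)
    (s : Bool) :
    Sum.elim (fun i => P i.1) (fun i => P i.1) (if s then
      (Sum.inl ⟨δ.floor e.1.1 e.1.2, h _ _⟩ : {i // δ.wt i = 0} ⊕ {i // 0 < δ.wt i})
      else .inr ⟨e.1.1, e.2⟩) = P (if s then δ.floor e.1.1 e.1.2 else e.1.1) := by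
  cases s <;> rfl

/-- The curled pearl chain of a floor diagram. -/
noncomputable def ofDiagram (hT : 0 < T) (hr : ∀ i, r i ∈ Set.Ico 0 T)
    (hP : Function.Injective fun i => (r i : AddCircle T)) (hd : 0 < d₁)
    (hn : n + 1 = 2 * d₂ + g) (h : δ.Valid r Δ d₁ d₂) :
    CurledPearlChain T Δ d₂ g fun i => (r i : AddCircle T) where
  toPearlChain := diagramChain h hn
  len := fun e : δ.Half =>
    (r (δ.finish e.1.1 e.1.2) - r (δ.start e.1.1 e.1.2) + δ.wind e.1.1 e.1.2 * T) / δ.wt e.1.1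
  len_pos := fun e : δ.Half =>
    div_pos (diagram_length_pos hT hr h e) (by exact_mod_cast e.2)
  pos := Sum.elim (fun i => r i.1) (fun i => r i.1)
  fwd := fun e : δ.Half => e.1.2
  wt := fun e : δ.Half => δ.wt e.1.1
  wt_pos := fun e : δ.Half => e.2
  affine := fun e : δ.Half => by
    have h1 := diagram_pos (fun i => (r i : AddCircle T)) h.wt_floor e e.1.2
    have h2 := diagram_pos (fun i => (r i : AddCircle T)) h.wt_floor e (!e.1.2)
    have hs : (if (!e.1.2) = true then δ.floor e.1.1 e.1.2 else e.1.1) =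
        δ.finish e.1.1 e.1.2 := by
      unfold FloorDiagram.finish; cases e.1.2 <;> rfl
    rw [hs] at h2
    refine Eq.trans ?_ (h2.trans ((diagram_affine e).trans (congrArg (· + _) h1.symm)))
    congr 1
    obtain ⟨⟨i, s⟩, he⟩ := e
    cases s <;> rfl
  surjective a := by
    by_contra hcon
    have : Fact (0 < T) := ⟨hT⟩
    obtain ⟨x, hx, rfl⟩ : ∃ x ∈ Set.Ico 0 T, (x : AddCircle T) = a :=
      ⟨(AddCircle.equivIco T 0 a).1, by simpa using (AddCircle.equivIco T 0 a).2,
        AddCircle.coe_equivIco⟩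
    have h0 : δ.base - ∑ i ∈ univ.filter (fun i => r i ≤ x), δ.leak i = 0 := by
      rw [FloorDiagram.base_sub_sum, ← δ.sum_half _ (fun b s h => by simp [h])]
      refine Finset.sum_eq_zero fun e _ => ?_
      have h1 := ncard_Ico_fibre hT (hr (δ.start e.1.1 e.1.2)).1 (hr _).2
        (hr (δ.finish e.1.1 e.1.2)).1 (hr _).2 hx.1 hx.2 e.2 (diagram_length_pos hT hr h e)
      simp only [mem_filter, mem_univ, true_and]
      rw [← h1]
      simp only [mul_eq_zero, Nat.cast_eq_zero]
      right
      convert Set.ncard_empty ℝ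
      refine Set.eq_empty_of_forall_notMem fun t ht => hcon ⟨e, t, ⟨ht.1.1, ht.1.2.le⟩, ?_⟩
      exact (congrArg (· + _) (diagram_pos (fun i => (r i : AddCircle T)) h.wt_floor e
        e.1.2)).trans ht.2
    have := h.degree.2 ⟨univ.filter (fun i => r i ≤ x), fun i hi j hj => by
      simp only [mem_filter, mem_univ, true_and] at hi ⊢
      exact hj.le.trans hi, rfl⟩
    rw [h0] at this
    omega
  point i := ⟨diagramVtx δ i, elim_diagramVtx (fun i => (r i : AddCircle T)) i,
    fun v hv => diagramVtx_unique hP hv⟩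
  leaking := diagram_leaking h
  balanced b := diagram_balanced b

/-- The tautological marking. -/
noncomputable def ofDiagramMarking (hT : 0 < T) (hr : ∀ i, r i ∈ Set.Ico 0 T)
    (hP : Function.Injective fun i => (r i : AddCircle T)) (hd : 0 < d₁)
    (hn : n + 1 = 2 * d₂ + g) (h : δ.Valid r Δ d₁ d₂) :
    Marking (ofDiagram hT hr hP hd hn h) δ where
  vtx := diagramVtx δ
  edge := Equiv.refl _
  pos i := elim_diagramVtx (fun i => (r i : AddCircle T)) i
  isLeft i := isLeft_diagramVtx i
  white e := diagramVtx_white ⟨δ.floor e.1.1 e.1.2, h.wt_floor _ _⟩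
  black e := diagramVtx_black ⟨e.1.1, e.2⟩
  fwd _ := rfl
  wt _ := rfl
  len _ := rfl
  floor_white := h.floor_white
  wind_white := h.wind_white

/-- Every curled pearl chain has a floor diagram. -/
theorem exists_marking (hT : 0 < T) (hr : ∀ i, r i ∈ Set.Ico 0 T)
    (hP : Function.Injective fun i => (r i : AddCircle T))
    (hn : n + 1 = 2 * d₂ + g)
    (c : CurledPearlChain T Δ d₂ g fun i => (r i : AddCircle T)) :
    ∃ δ, Nonempty (Marking c δ) := by
  classical
  choose ν hν using fun i => (c.point i).exists
  have bν : Function.Bijective ν := by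
    rw [Fintype.bijective_iff_injective_and_card]
    refine ⟨fun i j h => hP (by simp only [← hν, h]), ?_⟩
    have h1 := c.card_white
    have h2 := c.card_black
    rw [Fintype.card_fin, Fintype.card_sum]
    omega
  let φ : Fin n ≃ c.W ⊕ c.B := Equiv.ofBijective ν bν
  have hφ : ∀ i, c.pos (φ i) = r i := hν
  have hedge : ∀ (b : c.B), ∃ f : Bool → c.E, (∀ s, c.black (f s) = b ∧ c.fwd (f s) = s) ∧
      (∀ e, c.black e = b → e = f (c.fwd e)) ∧ c.wt (f true) = c.wt (f false) := by
    intro b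
    obtain ⟨⟨x, hx⟩, ⟨y, hy⟩, hxy, hall⟩ := Nat.card_eq_two_iff.1 (c.two_valent b)
    have hne : x ≠ y := fun h => hxy (Subtype.ext h)
    have hall' : ∀ e, c.black e = b ↔ e = x ∨ e = y := by
      intro e
      constructor
      · intro he
        have : (⟨e, he⟩ : {e // c.black e = b}) ∈ ({⟨x, hx⟩, ⟨y, hy⟩} : Set _) := by
          rw [hall]; trivial
        simpa using this
      · rintro (rfl | rfl) <;> assumption
    have hbal := c.balanced b
    rw [finsum_cond_eq_sum, ← Finset.sum_filter] at hbal
    have hf : univ.filter (fun e => c.black e = b) = {x, y} := by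
      ext e; simp [hall']
    rw [hf, Finset.sum_pair hne] at hbal
    have hwx := c.wt_pos x
    have hwy := c.wt_pos y
    rcases hfx : c.fwd x with _ | _ <;> rcases hfy : c.fwd y with _ | _ <;>
      simp only [hfx, hfy, if_true, Bool.false_eq_true, if_false] at hbal
    · omega
    · refine ⟨fun s => if s then y else x, ?_, ?_, ?_⟩
      · intro s; cases s <;> simp [hx, hy, hfx, hfy]
      · intro e he
        rcases (hall' e).1 he with rfl | rfl <;> simp [hfx, hfy]
      · simp only [if_true, Bool.false_eq_true, if_false]; omega
    · refine ⟨fun s => if s then x else y, ?_, ?_, ?_⟩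
      · intro s; cases s <;> simp [hx, hy, hfx, hfy]
      · intro e he
        rcases (hall' e).1 he with rfl | rfl <;> simp [hfx, hfy]
      · simp only [if_true, Bool.false_eq_true, if_false]; omega
    · omega
  choose f hf1 hf2 hf3 using hedge
  have hstart : ∀ e, ∃ k : ℕ, c.wt e * c.len e =
      r (φ.symm (if c.fwd e then .inr (c.black e) else .inl (c.white e))) -
      r (φ.symm (if c.fwd e then .inl (c.white e) else .inr (c.black e))) + k * T := by
    intro e
    have h := c.affine e
    have h1 : ∀ v, c.pos v = r (φ.symm v) := fun v => by rw [← hφ, φ.apply_symm_apply]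
    rw [h1, h1] at h
    obtain ⟨m, hm⟩ := AddCircle.coe_add_eq_coe_iff.1 h.symm
    have hpos : 0 < c.wt e * c.len e := mul_pos (by exact_mod_cast c.wt_pos e) (c.len_pos e)
    have hm0 : 0 ≤ m := by
      by_contra hlt
      have : (m : ℝ) ≤ -1 := by exact_mod_cast (by omega : m ≤ -1)
      have h2 := (hr (φ.symm (if c.fwd e then .inr (c.black e) else .inl (c.white e)))).2
      have h3 := (hr (φ.symm (if c.fwd e then .inl (c.white e) else .inr (c.black e)))).1
      nlinarith
    refine ⟨m.toNat, ?_⟩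
    have : ((m.toNat : ℕ) : ℝ) = m := by
      exact_mod_cast Int.toNat_of_nonneg hm0
    rw [this]
    exact hm
  choose k hk using hstart
  let δ : FloorDiagram n :=
    { floor := fun i s => Sum.elim (fun _ => i) (fun b => φ.symm (.inl (c.white (f b s)))) (φ i)
      wind := fun i s => Sum.elim (fun _ => 0) (fun b => k (f b s)) (φ i)
      wt := fun i => Sum.elim (fun _ => 0) (fun b => c.wt (f b true)) (φ i) }
  have hwt0 : ∀ i, (φ i).isLeft ↔ δ.wt i = 0 := by
    intro i
    change _ ↔ Sum.elim (fun _ => 0) (fun b => c.wt (f b true)) (φ i) = 0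
    rcases φ i with w | b
    · simp
    · simpa using (c.wt_pos (f b true)).ne'
  have hR : ∀ e : δ.Half, ∃ b, φ e.1.1 = .inr b := by
    intro e
    refine Sum.isRight_iff.1 ?_
    rw [← Sum.not_isLeft, hwt0]
    exact e.2.ne'
  choose β hβ using hR
  have hedge : ∀ e : δ.Half, c.black (f (β e) e.1.2) = β e ∧ c.fwd (f (β e) e.1.2) = e.1.2 :=
    fun e => hf1 _ _
  have bE : Function.Bijective fun e : δ.Half => f (β e) e.1.2 := by
    constructor
    · intro e e' h
      simp only at h
      have h1 := (hedge e).1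
      have h2 := (hedge e).2
      rw [h, (hedge e').1] at h1
      rw [h, (hedge e').2] at h2
      have h3 : φ e.1.1 = φ e'.1.1 := by rw [hβ, hβ, h1]
      exact Subtype.ext (Prod.ext (φ.injective h3) h2.symm)
    · intro e
      have h1 : ¬ δ.wt (φ.symm (.inr (c.black e))) = 0 := by
        rw [← hwt0]; simp
      let x : δ.Half := ⟨(φ.symm (.inr (c.black e)), c.fwd e), Nat.pos_of_ne_zero h1⟩
      refine ⟨x, ?_⟩
      have hx := hβ x
      simp only [x, φ.apply_symm_apply] at hx
      change f (β x) (c.fwd e) = e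
      rw [← Sum.inr_injective hx]
      exact (hf2 _ e rfl).symm
  have hfloor : ∀ e : δ.Half, φ (δ.floor e.1.1 e.1.2) = .inl (c.white (f (β e) e.1.2)) := by
    intro e
    simp only [δ, hβ, Sum.elim_inr, φ.apply_symm_apply]
  have hwt : ∀ e : δ.Half, c.wt (f (β e) e.1.2) = δ.wt e.1.1 := by
    intro e
    simp only [δ, hβ, Sum.elim_inr]
    cases e.1.2
    · exact (hf3 _).symm
    · rfl
  refine ⟨δ, ⟨⟨φ, Equiv.ofBijective _ bE, hφ, hwt0, hfloor, fun e => ?_, fun e => (hedge e).2, hwt,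
    fun e => ?_, fun i hi s => ?_, fun i hi s => ?_⟩⟩⟩
  · rw [hβ, Equiv.ofBijective_apply, (hedge e).1]
  · rw [Equiv.ofBijective_apply]
    have hw : (0 : ℝ) < δ.wt e.1.1 := by exact_mod_cast e.2
    rw [eq_div_iff hw.ne', mul_comm, ← hwt, hk, (hedge e).1, (hedge e).2, ← hfloor, ← hβ]
    have hwd : δ.wind e.1.1 e.1.2 = k (f (β e) e.1.2) := by
      simp only [δ, hβ, Sum.elim_inr]
    rw [hwd]
    unfold FloorDiagram.start FloorDiagram.finish
    cases e.1.2 <;> simp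
  · rw [← hwt0] at hi
    obtain ⟨w, hw⟩ := Sum.isLeft_iff.1 hi
    simp only [δ, hw, Sum.elim_inl]
  · rw [← hwt0] at hi
    obtain ⟨w, hw⟩ := Sum.isLeft_iff.1 hi
    simp only [δ, hw, Sum.elim_inl]

/-- Isomorphism classes of curled pearl chains correspond to floor diagrams. -/
theorem exists_bijective_class (hT : 0 < T) (hr : ∀ i, r i ∈ Set.Ico 0 T)
    (hP : Function.Injective fun i => (r i : AddCircle T)) (hd : 0 < d₁)
    (hn : n + 1 = 2 * d₂ + g) :
    ∃ f : {δ : FloorDiagram n // δ.Valid r Δ d₁ d₂} →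
      Class (g := g) T Δ d₁ d₂ (fun i => (r i : AddCircle T)),
      Function.Bijective f ∧ ∀ δ, (f δ).mult = δ.1.mult := by
  refine ⟨fun δ => Quotient.mk _ ⟨ofDiagram hT hr hP hd hn δ.2,
    ((ofDiagramMarking hT hr hP hd hn δ.2).hasDegree_iff hT hr).2 δ.2.degree⟩, ⟨?_, ?_⟩, ?_⟩
  · intro δ ε h
    obtain ⟨i⟩ := Quotient.exact h
    exact Subtype.ext (((ofDiagramMarking hT hr hP hd hn δ.2).map i).eq_of_marking hT
      (ofDiagramMarking hT hr hP hd hn ε.2))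
  · intro q
    induction q using Quotient.inductionOn with
    | h c =>
      obtain ⟨δ, ⟨m⟩⟩ := exists_marking hT hr hP hn c.1
      have hv := m.valid hT hr c.2
      exact ⟨⟨δ, hv⟩, Quotient.sound ((ofDiagramMarking hT hr hP hd hn hv).nonempty_iso m)⟩
  · intro δ
    exact (ofDiagramMarking hT hr hP hd hn δ.2).mult_eq

end CurledPearlChain

/-- The count of curled pearl chains is a count of floor diagrams. -/
theorem finite_class_and_pearlCount_eq {T : ℝ} {Δ : Multiset ℤ} {d₁ d₂ g n : ℕ} {r : Fin n → ℝ}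
    (hT : 0 < T) (hr : ∀ i, r i ∈ Set.Ico 0 T)
    (hP : Function.Injective fun i => (r i : AddCircle T)) (hd : 0 < d₁)
    (hn : n + 1 = 2 * d₂ + g) :
    Finite (CurledPearlChain.Class (g := g) T Δ d₁ d₂ (fun i => (r i : AddCircle T))) ∧
    pearlCount T Δ d₁ d₂ g (fun i => (r i : AddCircle T)) = FloorDiagram.count r Δ d₁ d₂ := by
  obtain ⟨f, hf, hm⟩ :=
    CurledPearlChain.exists_bijective_class (Δ := Δ) (d₂ := d₂) (g := g) hT hr hP hd hn
  have := FloorDiagram.finite_valid r Δ d₁ d₂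
  exact ⟨Finite.of_surjective f hf.2, (finsum_eq_of_bijective f hf fun δ => (hm δ).symm).symm⟩


namespace CutStableMap

variable {n : ℕ} (C : CutStableMap n)

theorem sum_flags {M : Type*} [AddCommMonoid M] (S : C.V → Prop) [DecidablePred S]
    (F : C.Flag → M) :
    ∑ v, (if S v then ∑ f ∈ C.flagsAt v, F f else 0) =
      ∑ f, if S (C.flagVert f) then F f else 0 := by
  classical
  have : ∀ v, (if S v then ∑ f ∈ C.flagsAt v, F f else 0) =
      ∑ f ∈ univ.filter (fun f => C.flagVert f = v), if S (C.flagVert f) then F f else 0 := by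
    intro v
    split_ifs with h
    · refine Finset.sum_congr ?_ fun f hf => ?_
      · unfold CutData.flagsAt; ext; simp
      · rw [(mem_filter.1 hf).2, if_pos h]
    · symm
      refine Finset.sum_eq_zero fun f hf => ?_
      rw [(mem_filter.1 hf).2, if_neg h]
  simp only [this]
  exact Finset.sum_fiberwise _ _ _

theorem mem_flagsAt {v : C.V} {f : C.Flag} : f ∈ C.flagsAt v ↔ C.flagVert f = v := by
  simp [CutData.flagsAt]

/-- The directions of the flags leaving a set of vertices sum up to zero. -/
theorem cut_sum (S : C.V → Prop) [DecidablePred S] :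
    (∑ h, if S (C.vert h) ∧ ¬ S (C.vert (C.opp h)) then C.dir h else 0) +
      (∑ d, if S (C.dnVert d) then ((0, -1) : ℤ × ℤ) else 0) +
      (∑ u, if S (C.upVert u) then ((C.leak u, 1) : ℤ × ℤ) else 0) +
      (∑ r, if S (C.rtVert r) then (((C.rtWt r : ℤ), 0) : ℤ × ℤ) else 0) +
      (∑ l, if S (C.lfVert l) then ((-(C.lfWt l : ℤ), 0) : ℤ × ℤ) else 0) = 0 := by
  classical
  have h0 := C.sum_flags S C.flagDir
  simp only [C.balanced, ite_self, Finset.sum_const_zero] at h0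
  rw [Fintype.sum_sum_type, Fintype.sum_sum_type, Fintype.sum_sum_type, Fintype.sum_sum_type] at h0
  have h1 : (∑ h, if S (C.vert h) then C.dir h else 0) =
      ∑ h, if S (C.vert h) ∧ ¬ S (C.vert (C.opp h)) then C.dir h else 0 := by
    rw [← sub_eq_zero, ← Finset.sum_sub_distrib]
    have : ∀ h, ((if S (C.vert h) then C.dir h else 0) -
        if S (C.vert h) ∧ ¬ S (C.vert (C.opp h)) then C.dir h else 0) =
        if S (C.vert h) ∧ S (C.vert (C.opp h)) then C.dir h else 0 := by
      intro h
      by_cases h1 : S (C.vert h) <;> by_cases h2 : S (C.vert (C.opp h)) <;> simp [h1, h2]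
    simp only [this]
    refine Finset.sum_involution (fun h _ => C.opp h) (fun h _ => ?_) (fun h _ _ => C.opp_ne h)
      (fun h _ => Finset.mem_univ _) (fun h _ => C.opp_opp h)
    rw [C.opp_opp, C.dir_opp]
    by_cases h1 : S (C.vert h) <;> by_cases h2 : S (C.vert (C.opp h)) <;> simp [h1, h2]
  rw [← h1, add_assoc, add_assoc, add_assoc]
  exact h0.symm

theorem lt_of_dir_fst_pos {h : C.H} (hd : 0 < (C.dir h).1) :
    (C.pos (C.vert h)).1 < (C.pos (C.vert (C.opp h))).1 := by
  rw [C.affine]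
  have : (0 : ℝ) < C.len h * ((C.dir h).1 : ℝ) := mul_pos (C.len_pos h) (by exact_mod_cast hd)
  simpa using this

theorem dir_fst_pos_of_lt {h : C.H}
    (hd : (C.pos (C.vert h)).1 < (C.pos (C.vert (C.opp h))).1) : 0 < (C.dir h).1 := by
  rw [C.affine] at hd
  simp only [Prod.fst_add, lt_add_iff_pos_right] at hd
  exact_mod_cast (mul_pos_iff_of_pos_left (C.len_pos h)).1 hd

theorem lt_of_dir_snd_pos {h : C.H} (hd : 0 < (C.dir h).2) :
    (C.pos (C.vert h)).2 < (C.pos (C.vert (C.opp h))).2 := by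
  rw [C.affine]
  have : (0 : ℝ) < C.len h * ((C.dir h).2 : ℝ) := mul_pos (C.len_pos h) (by exact_mod_cast hd)
  simpa using this

theorem dir_snd_pos_of_lt {h : C.H}
    (hd : (C.pos (C.vert h)).2 < (C.pos (C.vert (C.opp h))).2) : 0 < (C.dir h).2 := by
  rw [C.affine] at hd
  simp only [Prod.snd_add, lt_add_iff_pos_right] at hd
  exact_mod_cast (mul_pos_iff_of_pos_left (C.len_pos h)).1 hd

/-- The intersection number with a vertical line changes exactly at the ends of direction
`(L, 1)`. -/
theorem crossing_eq {a : ℝ} (ha : ∀ v, (C.pos v).1 ≠ a) :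
    C.crossing a = (∑ l, (C.lfWt l : ℤ)) + (∑ z, (C.lineWt z : ℤ)) -
      ∑ u ∈ univ.filter (fun u => (C.pos (C.upVert u)).1 < a), C.leak u := by
  classical
  have h := congrArg Prod.fst (C.cut_sum fun v => (C.pos v).1 < a)
  simp only [Prod.fst_add, Prod.fst_sum, Prod.fst_zero, apply_ite Prod.fst] at h
  unfold CutData.crossing
  have hl : (∑ l, (C.lfWt l : ℤ)) = (∑ l, if a < (C.pos (C.lfVert l)).1 then (C.lfWt l : ℤ) else 0) -
      ∑ l, if (C.pos (C.lfVert l)).1 < a then -(C.lfWt l : ℤ) else 0 := by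
    rw [← Finset.sum_sub_distrib]
    refine Finset.sum_congr rfl fun l _ => ?_
    rcases (ha (C.lfVert l)).lt_or_gt with h | h
    · simp [h, h.not_gt]
    · simp [h, h.not_gt]
  have hh : ∀ h, ((C.pos (C.vert h)).1 < a ∧ ¬ (C.pos (C.vert (C.opp h))).1 < a) ↔
      ((C.pos (C.vert h)).1 < a ∧ a < (C.pos (C.vert (C.opp h))).1) := fun h => by
    refine and_congr_right fun _ => ?_
    rw [not_lt, le_iff_lt_or_eq, or_iff_left (ha _).symm]
  simp only [hh, Finset.sum_const_zero, ite_self] at h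
  rw [hl]
  simp only [Finset.sum_filter]
  linarith

theorem crossing_terms_nonneg (a : ℝ) (h : C.H)
    (hh : h ∈ univ.filter fun h => (C.pos (C.vert h)).1 < a ∧ a < (C.pos (C.vert (C.opp h))).1) :
    0 ≤ (C.dir h).1 := by
  simp only [mem_filter, mem_univ, true_and] at hh
  exact (C.dir_fst_pos_of_lt (hh.1.trans hh.2)).le

theorem dir_le_crossing {a : ℝ} {h : C.H} (h1 : (C.pos (C.vert h)).1 < a)
    (h2 : a < (C.pos (C.vert (C.opp h))).1) : (C.dir h).1 ≤ C.crossing a := by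
  classical
  have := Finset.single_le_sum (C.crossing_terms_nonneg a) (a := h) (by simp [h1, h2])
  refine this.trans ?_
  unfold CutData.crossing
  have p1 : 0 ≤ ∑ r ∈ univ.filter (fun r => (C.pos (C.rtVert r)).1 < a), (C.rtWt r : ℤ) := by
    positivity
  have p2 : 0 ≤ ∑ l ∈ univ.filter (fun l => a < (C.pos (C.lfVert l)).1), (C.lfWt l : ℤ) := by
    positivity
  have p3 : 0 ≤ ∑ z, (C.lineWt z : ℤ) := by positivity
  linarith

theorem rtWt_le_crossing {a : ℝ} {r : C.Rt} (h1 : (C.pos (C.rtVert r)).1 < a) :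
    (C.rtWt r : ℤ) ≤ C.crossing a := by
  classical
  have := Finset.single_le_sum (s := univ.filter (fun r => (C.pos (C.rtVert r)).1 < a))
    (f := fun r => (C.rtWt r : ℤ)) (fun r _ => by positivity) (a := r) (by simp [h1])
  refine this.trans ?_
  unfold CutData.crossing
  have p1 := Finset.sum_nonneg (C.crossing_terms_nonneg a)
  have p2 : 0 ≤ ∑ l ∈ univ.filter (fun l => a < (C.pos (C.lfVert l)).1), (C.lfWt l : ℤ) := by
    positivity
  have p3 : 0 ≤ ∑ z, (C.lineWt z : ℤ) := by positivity
  linarith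

theorem exists_generic {x y : ℝ} (h : x < y) : ∃ a ∈ Set.Ioo x y, ∀ v, (C.pos v).1 ≠ a := by
  classical
  obtain ⟨a, ha, hn⟩ := (Set.Ioo_infinite h).exists_notMem_finset
    (univ.image fun v => (C.pos v).1)
  exact ⟨a, ha, fun v hv => hn (mem_image.2 ⟨v, mem_univ _, hv⟩)⟩

section Bound

variable {C} {Δ : Multiset ℤ} {d₁ d₂ : ℕ}

theorem crossing_le (hΔ : C.HasLeakyDegree Δ) (hd : C.HasBidegree d₁ d₂) {a : ℝ}
    (ha : ∀ v, (C.pos v).1 ≠ a) : C.crossing a ≤ FloorDiagram.degreeBound Δ d₁ := by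
  classical
  obtain ⟨b, hb, hb'⟩ := hd.2.2.1
  rw [C.crossing_eq ha]
  rw [C.crossing_eq hb] at hb'
  have h1 := abs_le.1 (FloorDiagram.abs_sum_le _ univ C.leak
    (Finset.subset_univ (univ.filter (fun u => (C.pos (C.upVert u)).1 < a))))
  have h2 := abs_le.1 (FloorDiagram.abs_sum_le _ univ C.leak
    (Finset.subset_univ (univ.filter (fun u => (C.pos (C.upVert u)).1 < b))))
  rw [show (univ : Finset C.Up).val.map C.leak = Δ from hΔ] at h1 h2
  unfold FloorDiagram.degreeBound
  rw [Nat.cast_add, Nat.cast_mul, Nat.cast_two]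
  linarith [h1.1, h2.2]

theorem abs_dir_le (hΔ : C.HasLeakyDegree Δ) (hd : C.HasBidegree d₁ d₂) (h : C.H) :
    |(C.dir h).1| ≤ FloorDiagram.degreeBound Δ d₁ := by
  have key : ∀ h, 0 < (C.dir h).1 → (C.dir h).1 ≤ FloorDiagram.degreeBound Δ d₁ := by
    intro h hpos
    obtain ⟨a, ha, hg⟩ := C.exists_generic (C.lt_of_dir_fst_pos hpos)
    exact (C.dir_le_crossing ha.1 ha.2).trans (crossing_le hΔ hd hg)
  rcases lt_trichotomy (C.dir h).1 0 with hn | h0 | hp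
  · have := key (C.opp h) (by rw [C.dir_opp]; simpa using hn)
    rw [C.dir_opp] at this
    rwa [abs_of_neg hn]
  · rw [h0]; simp
  · rw [abs_of_pos hp]; exact key h hp

theorem rtWt_le (hΔ : C.HasLeakyDegree Δ) (hd : C.HasBidegree d₁ d₂) (r : C.Rt) :
    (C.rtWt r : ℤ) ≤ FloorDiagram.degreeBound Δ d₁ := by
  obtain ⟨a, ha, hg⟩ := C.exists_generic (lt_add_one (C.pos (C.rtVert r)).1)
  exact (C.rtWt_le_crossing ha.1).trans (crossing_le hΔ hd hg)

end Bound

/-! ### Valences and genus -/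

theorem sum_valence : ∑ v, C.valence v = Fintype.card C.Flag + n := by
  classical
  unfold CutData.valence
  rw [Finset.sum_add_distrib]
  congr 1
  · have := C.sum_flags (fun _ => True) (fun _ => 1)
    simpa using this
  · have := Finset.sum_fiberwise (univ : Finset (Fin n)) C.markVert (fun _ => 1)
    simp only [Finset.sum_const, smul_eq_mul, mul_one, Finset.card_univ, Fintype.card_fin] at this
    convert this

theorem even_card_H : Even (Fintype.card C.H) := by
  classical
  have h : ∑ _h : C.H, (1 : ZMod 2) = 0 :=
    Finset.sum_involution (fun h _ => C.opp h) (fun h _ => by decide) (fun h _ _ => C.opp_ne h)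
      (fun h _ => Finset.mem_univ _) (fun h _ => C.opp_opp h)
  rw [Finset.sum_const, Finset.card_univ, nsmul_eq_mul, mul_one] at h
  exact (ZMod.natCast_eq_zero_iff_even).1 h

theorem card_rt_eq : Fintype.card C.Rt = Fintype.card C.Lf := by
  have := Fintype.card_congr C.glue
  simpa using this

theorem two_mul_genus (h3 : C.Trivalent) : 2 * C.genus = (Fintype.card C.V : ℤ) -
    Fintype.card C.Dn - Fintype.card C.Up - n + 2 := by
  have h1 := C.sum_valence
  simp only [h3 _, Finset.sum_const, Finset.card_univ, smul_eq_mul] at h1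
  obtain ⟨k, hk⟩ := C.even_card_H
  have h2 := C.card_rt_eq
  unfold CutData.genus
  simp only [Fintype.card_sum] at h1 ⊢
  have : (Fintype.card C.H) / 2 = k := by omega
  rw [this]
  push_cast
  omega

/-! ### Connectedness -/

theorem eq_univ_of_closed (hc : C.gluedGraph.Connected) {S : Set (C.V ⊕ C.Z)} (hne : S.Nonempty)
    (hH : ∀ h, .inl (C.vert h) ∈ S → .inl (C.vert (C.opp h)) ∈ S)
    (hR : ∀ r, C.rightBase r ∈ S ↔ C.leftBase (C.glue r) ∈ S) : S = Set.univ := by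
  have hstep : ∀ a b, C.gluedGraph.Adj a b → a ∈ S → b ∈ S := by
    intro a b hab ha
    obtain ⟨-, (⟨h, rfl, rfl⟩ | ⟨r, rfl, rfl⟩) | (⟨h, rfl, rfl⟩ | ⟨r, rfl, rfl⟩)⟩ := hab
    · exact hH h ha
    · exact (hR r).1 ha
    · have := hH (C.opp h) ha
      rwa [C.opp_opp] at this
    · exact (hR r).2 ha
  obtain ⟨s, hs⟩ := hne
  refine Set.eq_univ_of_forall fun t => ?_
  obtain ⟨w⟩ := hc.preconnected s t
  induction w with
  | nil => exact hs
  | cons h _ ih => exact ih (hstep _ _ h hs)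

end CutStableMap

/-! ### Chains of vertexless lines -/

section Walk

variable {R L Z : Type*} (e : R ⊕ Z ≃ L ⊕ Z)

/-- Follow the glueing from an end in `R` along vertexless lines. -/
def glueWalk (r : R) : ℕ → L ⊕ Z
  | 0 => e (.inl r)
  | j + 1 => Sum.elim .inl (fun z => e (.inr z)) (glueWalk r j)

/-- The chain starting at `r` consists of `k` lines and ends with `l`. -/
def GlueChain (r : R) (k : ℕ) (l : L) : Prop :=
  glueWalk e r k = .inl l ∧ ∀ j < k, (glueWalk e r j).isRight

variable {e}

theorem GlueChain.exists_right {r : R} {k : ℕ} {l : L} (h : GlueChain e r k l) {j : ℕ}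
    (hj : j < k) : ∃ z, glueWalk e r j = .inr z ∧ glueWalk e r (j + 1) = e (.inr z) := by
  obtain ⟨z, hz⟩ := Sum.isRight_iff.1 (h.2 j hj)
  exact ⟨z, hz, by simp [glueWalk, hz]⟩

theorem glueWalk_injective {r r' : R} {j j' : ℕ} (h : glueWalk e r j = glueWalk e r' j')
    (hj : ∀ i < j, (glueWalk e r i).isRight) (hj' : ∀ i < j', (glueWalk e r' i).isRight) :
    r = r' ∧ j = j' := by
  induction j generalizing j' with
  | zero =>
    cases j' with
    | zero => exact ⟨Sum.inl_injective (e.injective h), rfl⟩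
    | succ j' =>
      obtain ⟨z, hz⟩ := Sum.isRight_iff.1 (hj' j' (Nat.lt_succ_self _))
      simp only [glueWalk, hz, Sum.elim_inr] at h
      exact absurd (e.injective h) (by simp)
  | succ j ih =>
    obtain ⟨z, hz⟩ := Sum.isRight_iff.1 (hj j (Nat.lt_succ_self _))
    cases j' with
    | zero =>
      simp only [glueWalk, hz, Sum.elim_inr] at h
      exact absurd (e.injective h) (by simp)
    | succ j' =>
      obtain ⟨z', hz'⟩ := Sum.isRight_iff.1 (hj' j' (Nat.lt_succ_self _))
      simp only [glueWalk, hz, hz', Sum.elim_inr] at h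
      have := Sum.inr_injective (e.injective h)
      obtain ⟨h1, h2⟩ := ih (j' := j') (by rw [hz, hz', this])
        (fun i hi => hj i (hi.trans (Nat.lt_succ_self _)))
        (fun i hi => hj' i (hi.trans (Nat.lt_succ_self _)))
      exact ⟨h1, by rw [h2]⟩

theorem GlueChain.unique {r : R} {k k' : ℕ} {l l' : L} (h : GlueChain e r k l)
    (h' : GlueChain e r k' l') : k = k' ∧ l = l' := by
  have hk : k = k' := by
    rcases lt_trichotomy k k' with hlt | rfl | hlt
    · have := h'.2 k hlt
      rw [h.1] at this; simp at this
    · rfl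
    · have := h.2 k' hlt
      rw [h'.1] at this; simp at this
  subst hk
  exact ⟨rfl, Sum.inl_injective (h.1.symm.trans h'.1)⟩

theorem GlueChain.unique_left {r r' : R} {k k' : ℕ} {l : L} (h : GlueChain e r k l)
    (h' : GlueChain e r' k' l) : r = r' :=
  (glueWalk_injective (h.1.trans h'.1.symm) h.2 h'.2).1

theorem exists_glueChain [Finite Z] (r : R) : ∃ k l, GlueChain e r k l := by
  by_contra hcon
  have hall : ∀ j, (glueWalk e r j).isRight := by
    intro j
    induction j using Nat.strong_induction_on with
    | _ j ih =>
      rcases hj : glueWalk e r j with l | z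
      · exact absurd ⟨j, l, hj, ih⟩ hcon
      · rfl
  choose z hz using fun j => Sum.isRight_iff.1 (hall j)
  obtain ⟨i, j, hij, h⟩ := Finite.exists_ne_map_eq_of_infinite z
  exact hij (glueWalk_injective (by rw [hz, hz, h]) (fun i _ => hall i) (fun i _ => hall i)).2

/-- If no set of lines is invariant under the glueing, then every line lies on a chain. -/
theorem exists_glueWalk_eq [Finite Z]
    (hinv : ∀ S : Set Z, S.Nonempty → ¬ ∀ z, z ∈ S ↔ ∃ z' ∈ S, e (.inr z) = .inr z')
    (z : Z) : ∃ r j, glueWalk e r j = .inr z := by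
  by_contra hcon
  let S : Set Z := {z | ¬ ∃ r j, glueWalk e r j = .inr z}
  have hprev : ∀ z : S, ∃ z' : S, e (.inr z'.1) = .inr z.1 := by
    rintro ⟨z, hz⟩
    rcases hy : e.symm (.inr z) with r | z'
    · exact absurd ⟨r, 0, by rw [glueWalk, ← hy, e.apply_symm_apply]⟩ hz
    · refine ⟨⟨z', fun ⟨r, j, hj⟩ => hz ⟨r, j + 1, ?_⟩⟩, ?_⟩
      · simp [glueWalk, hj, ← hy]
      · simp [← hy]
  choose f hf using hprev
  have hinj : Function.Injective f := by
    intro a b hab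
    have := hf a
    rw [hab, hf b] at this
    exact Subtype.ext (Sum.inr_injective this).symm
  have hsurj : Function.Surjective f := Finite.surjective_of_injective hinj
  refine hinv S ⟨z, hcon⟩ fun x => ⟨fun hx => ?_, fun ⟨x', hx', hxx⟩ => ?_⟩
  · obtain ⟨y, hy⟩ := hsurj ⟨x, hx⟩
    have := hf y
    rw [hy] at this
    exact ⟨y.1, y.2, this⟩
  · have := hf ⟨x', hx'⟩
    rw [← hxx] at this
    have := Sum.inr_injective (e.injective this)
    rw [← this]
    exact (f ⟨x', hx'⟩).2

end Walk


namespace CutData.Iso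

variable {n : ℕ} {C D : CutData n}

theorem crossing_eq (e : Iso C D) (a : ℝ) : D.crossing a = C.crossing a := by
  classical
  unfold CutData.crossing
  simp only [Finset.sum_filter]
  rw [← Equiv.sum_comp e.eH, ← Equiv.sum_comp e.eRt, ← Equiv.sum_comp e.eLf, ← Equiv.sum_comp e.eZ]
  simp only [e.vert, e.opp, e.pos, e.dir, e.rtVert, e.rtWt, e.lfVert, e.lfWt, e.lineWt]

theorem hasBidegree (e : Iso C D) {d₁ d₂ : ℕ} (h : D.HasBidegree d₁ d₂) : C.HasBidegree d₁ d₂ := by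
  refine ⟨(Fintype.card_congr e.eDn).trans h.1, (Fintype.card_congr e.eUp).trans h.2.1, ?_⟩
  convert h.2.2 using 1
  ext k
  simp only [e.crossing_eq]
  refine exists_congr fun a => and_congr_left fun _ => ?_
  constructor
  · intro h v
    obtain ⟨v, rfl⟩ := e.eV.surjective v
    rw [e.pos]
    exact h v
  · intro h v
    rw [← e.pos]
    exact h _

theorem hasLeakyDegree (e : Iso C D) {Δ : Multiset ℤ} (h : D.HasLeakyDegree Δ) :
    C.HasLeakyDegree Δ := by
  refine Eq.trans ?_ h
  have : (univ : Finset D.Up) = (univ : Finset C.Up).map e.eUp.toEmbedding := by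
    rw [Finset.map_univ_equiv]
  rw [this, Finset.map_val, Multiset.map_map]
  exact Multiset.map_congr rfl fun u _ => (e.leak u).symm

theorem rightBase_eq (e : Iso C D) (r : C.Rt ⊕ C.Z) :
    D.rightBase (Sum.map e.eRt e.eZ r) = Sum.map e.eV e.eZ (C.rightBase r) := by
  rcases r with r | z
  · simp [rightBase, e.rtVert]
  · simp [rightBase]

theorem leftBase_eq (e : Iso C D) (l : C.Lf ⊕ C.Z) :
    D.leftBase (Sum.map e.eLf e.eZ l) = Sum.map e.eV e.eZ (C.leftBase l) := by
  rcases l with r | z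
  · simp [leftBase, e.lfVert]
  · simp [leftBase]

theorem connected (e : Iso C D) (h : D.gluedGraph.Connected) : C.gluedGraph.Connected := by
  let f : D.V ⊕ D.Z → C.V ⊕ C.Z := Sum.map e.eV.symm e.eZ.symm
  have key : ∀ a b, D.gluedGraph.Adj a b → C.gluedGraph.Adj (f a) (f b) := by
    have h1 : ∀ a b, ((∃ h, a = .inl (D.vert h) ∧ b = .inl (D.vert (D.opp h))) ∨
        ∃ r, a = D.rightBase r ∧ b = D.leftBase (D.glue r)) →
        ((∃ h, f a = .inl (C.vert h) ∧ f b = .inl (C.vert (C.opp h))) ∨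
        ∃ r, f a = C.rightBase r ∧ f b = C.leftBase (C.glue r)) := by
      rintro a b (⟨h, rfl, rfl⟩ | ⟨r, rfl, rfl⟩)
      · obtain ⟨h, rfl⟩ := e.eH.surjective h
        left
        exact ⟨h, by simp [f, e.vert], by simp [f, e.vert, e.opp]⟩
      · right
        obtain ⟨r, rfl⟩ := (Equiv.sumCongr e.eRt e.eZ).surjective r
        refine ⟨r, ?_, ?_⟩
        · rw [Equiv.sumCongr_apply, e.rightBase_eq]
          simp [f, Sum.map_map]
        · rw [Equiv.sumCongr_apply, e.glue, e.leftBase_eq]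
          simp [f, Sum.map_map]
    intro a b hab
    refine ⟨fun h => hab.1 ?_, hab.2.imp (h1 a b) (h1 b a)⟩
    exact (Equiv.sumCongr e.eV.symm e.eZ.symm).injective h
  have hsurj : Function.Surjective f := (Equiv.sumCongr e.eV.symm e.eZ.symm).surjective
  have := h.nonempty
  refine SimpleGraph.Connected.map (f := ⟨f, fun {a b} => key a b⟩) hsurj h

theorem glueWalk_eq (e : Iso C D) (r : C.Rt) (j : ℕ) :
    glueWalk D.glue (e.eRt r) j = Sum.map e.eLf e.eZ (glueWalk C.glue r j) := by
  induction j with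
  | zero => exact e.glue (.inl r)
  | succ j ih =>
    simp only [glueWalk, ih]
    rcases glueWalk C.glue r j with l | z
    · rfl
    · exact e.glue (.inr z)

theorem glueChain_iff (e : Iso C D) {r : C.Rt} {k : ℕ} {l : C.Lf} :
    GlueChain D.glue (e.eRt r) k (e.eLf l) ↔ GlueChain C.glue r k l := by
  unfold GlueChain
  simp only [e.glueWalk_eq, Sum.isRight_map]
  refine and_congr ⟨fun h => ?_, fun h => by rw [h]; rfl⟩ Iff.rfl
  exact (Equiv.sumCongr e.eLf e.eZ).injective h

end CutData.Iso


namespace FloorDiagram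

variable {n : ℕ} (δ : FloorDiagram n) (p : Fin n → ℝ × ℝ)

/-!
### The floors of a floor diagram in the plane
-/

/-- The vertices of the tropical curve of a floor diagram: the marked points, and the ends of the
half elevators at the floors. -/
abbrev Vtx : Type := Fin n ⊕ δ.Half

variable {δ}

/-- The floor of a vertex; a black point is considered as a floor of its own. -/
def onFloor : δ.Vtx → Fin n := Sum.elim id fun e => δ.floor e.1.1 e.1.2

/-- The marked point at the height of a vertex. -/
def level : δ.Vtx → Fin n := Sum.elim id fun e => e.1.1

/-- The height of a vertex. -/
def height (v : δ.Vtx) : ℝ := (p (level v)).2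

variable (δ) in
/-- The `x`-coordinate of a floor as a function of the height. -/
noncomputable def floorX (i : Fin n) (y : ℝ) : ℝ :=
  (p i).1 + ∑ b, (δ.coef i b : ℝ) * (max (y - (p b).2) 0 - max ((p i).2 - (p b).2) 0)

/-- The position of a vertex. -/
noncomputable def position (v : δ.Vtx) : ℝ × ℝ := (δ.floorX p (onFloor v) (height p v), height p v)

/-- The slope of a floor above a vertex. -/
noncomputable def slopeAbove (v : δ.Vtx) : ℤ :=
  ∑ b, if (p b).2 ≤ height p v then δ.coef (onFloor v) b else 0

/-- The slope of a floor below a vertex. -/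
noncomputable def slopeBelow (v : δ.Vtx) : ℤ :=
  ∑ b, if (p b).2 < height p v then δ.coef (onFloor v) b else 0

/-- The vertices `u` and `v` are consecutive on a floor. -/
def Below (u v : δ.Vtx) : Prop :=
  onFloor u = onFloor v ∧ height p u < height p v ∧
    ∀ w : δ.Vtx, onFloor w = onFloor u → height p u < height p w → height p v ≤ height p w

variable (δ) in
/-- The conditions on a floor diagram and the point conditions under which it is realized by a
tropical stable map. -/
structure Admissible : Prop where
  floor_white : ∀ i, δ.wt i = 0 → ∀ s, δ.floor i s = i
  wt_floor : ∀ i s, δ.wt (δ.floor i s) = 0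
  floor_ne : ∀ i, 0 < δ.wt i → δ.floor i true ≠ δ.floor i false
  lt_or_wind : ∀ i, 0 < δ.wt i → ∀ s,
    (p (δ.start i s)).1 < (p (δ.finish i s)).1 ∨ 0 < δ.wind i s
  fst_injective : ∀ i j, (p i).1 = (p j).1 → i = j
  snd_injective : ∀ i j, (p i).2 = (p j).2 → i = j
  floorX_lt : ∀ i j b c, (p i).1 < (p j).1 → δ.floorX p i (p b).2 < δ.floorX p j (p c).2

variable {p}

theorem position_inl (i : Fin n) : position p (.inl i : δ.Vtx) = p i := by
  simp [position, height, level, onFloor, floorX]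

namespace Admissible

variable (h : δ.Admissible p)
include h

theorem vtx_ext {u v : δ.Vtx} (h1 : onFloor u = onFloor v) (h2 : level u = level v) : u = v := by
  have key : ∀ (i : Fin n) (e : δ.Half), δ.floor e.1.1 e.1.2 = i → e.1.1 = i → False := by
    rintro i ⟨⟨b, s⟩, hb⟩ h1 rfl
    have := h.wt_floor b s
    simp only at h1 hb
    rw [h1] at this
    omega
  rcases u with i | e <;> rcases v with j | f
  · exact congrArg _ h1
  · exact (key i f h1.symm h2.symm).elim
  · exact (key j e h1 h2).elim
  · obtain ⟨⟨b, s⟩, hb⟩ := e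
    obtain ⟨⟨c, t⟩, hc⟩ := f
    obtain rfl : b = c := h2
    have h1 : δ.floor b s = δ.floor b t := h1
    have := h.floor_ne b hb
    cases s <;> cases t <;> first | rfl | exact absurd h1 this | exact absurd h1.symm this

theorem eq_of_height {u v : δ.Vtx} (h1 : onFloor u = onFloor v) (h2 : height p u = height p v) :
    u = v :=
  h.vtx_ext h1 (h.snd_injective _ _ h2)

omit h in
theorem exists_above {u v : δ.Vtx} (h1 : onFloor u = onFloor v) (h2 : height p u < height p v) :
    ∃ w, Below p u w := by
  classical
  obtain ⟨w, hw, hmin⟩ := Finset.exists_min_image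
    (univ.filter fun w : δ.Vtx => onFloor w = onFloor u ∧ height p u < height p w) (height p)
    ⟨v, by simp [h1, h2]⟩
  simp only [mem_filter, mem_univ, true_and] at hw hmin
  exact ⟨w, hw.1.symm, hw.2, fun x hx hx' => hmin x ⟨hx, hx'⟩⟩

omit h in
theorem exists_below {u v : δ.Vtx} (h1 : onFloor u = onFloor v) (h2 : height p u < height p v) :
    ∃ w, Below p w v ∧ height p u ≤ height p w := by
  classical
  obtain ⟨w, hw, hmax⟩ := Finset.exists_max_image
    (univ.filter fun w : δ.Vtx => onFloor w = onFloor v ∧ height p w < height p v) (height p)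
    ⟨u, by simp [h1, h2]⟩
  simp only [mem_filter, mem_univ, true_and] at hw hmax
  refine ⟨w, ⟨hw.1, hw.2, fun x hx hx' => ?_⟩, hmax u ⟨h1, h2⟩⟩
  by_contra hlt
  exact absurd (hmax x ⟨hx.trans hw.1, not_le.1 hlt⟩) (not_le.2 hx')

theorem above_unique {u v w : δ.Vtx} (h1 : Below p u v) (h2 : Below p u w) : v = w :=
  h.eq_of_height (h1.1.symm.trans h2.1)
    ((h1.2.2 w h2.1.symm h2.2.1).antisymm (h2.2.2 v h1.1.symm h1.2.1))

theorem below_unique {u v w : δ.Vtx} (h1 : Below p u w) (h2 : Below p v w) : u = v := by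
  have h3 : onFloor u = onFloor v := h1.1.trans h2.1.symm
  refine h.eq_of_height h3 ?_
  rcases lt_trichotomy (height p u) (height p v) with hlt | heq | hlt
  · exact absurd (h1.2.2 v h3.symm hlt) (not_le.2 h2.2.1)
  · exact heq
  · exact absurd (h2.2.2 u h3 hlt) (not_le.2 h1.2.1)

/-- Consecutive vertices generate the relation of lying on the same floor. -/
theorem floor_induction {R : δ.Vtx → δ.Vtx → Prop} (hR : Equivalence R)
    (hB : ∀ u v, Below p u v → R u v) {u v : δ.Vtx} (huv : onFloor u = onFloor v) : R u v := by
  have key : ∀ v, ∀ u, onFloor u = onFloor v → height p u ≤ height p v → R u v := by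
    intro v
    induction v using (Finite.wellFounded_of_trans_of_irrefl
      (fun u v : δ.Vtx => height p u < height p v)).induction with
    | _ v ih =>
      intro u huv hle
      rcases hle.eq_or_lt with heq | hlt
      · rw [h.eq_of_height huv heq]; exact hR.refl _
      · obtain ⟨w, hw, hw'⟩ := exists_below huv hlt
        exact hR.trans (ih w hw.2.1 u (huv.trans hw.1.symm) hw') (hB _ _ hw)
  rcases le_total (height p u) (height p v) with hle | hle
  · exact key v u huv hle
  · exact hR.symm (key u v huv.symm hle)

omit h in
theorem exists_vtx_of_coef (h : δ.Admissible p) {i b : Fin n} (hc : δ.coef i b ≠ 0) :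
    ∃ w : δ.Vtx, onFloor w = i ∧ level w = b := by
  by_cases hi : δ.wt i = 0
  · rw [coef_eq hi] at hc
    have hb : 0 < δ.wt b := by
      by_contra hb
      have : δ.wt b = 0 := by omega
      simp [this] at hc
    by_cases h1 : δ.floor b false = i
    · exact ⟨.inr ⟨(b, false), hb⟩, h1, rfl⟩
    · by_cases h2 : δ.floor b true = i
      · exact ⟨.inr ⟨(b, true), hb⟩, h2, rfl⟩
      · simp [h1, h2] at hc
  · exact absurd (coef_black hi h.wt_floor b) hc

theorem slopeAbove_sub (v : δ.Vtx) :
    slopeAbove p v - slopeBelow p v = δ.coef (onFloor v) (level v) := by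
  unfold slopeAbove slopeBelow
  rw [← Finset.sum_sub_distrib, Finset.sum_eq_single (level v)]
  · simp [height]
  · intro b _ hb
    have hne : (p b).2 ≠ height p v := fun e => hb (h.snd_injective _ _ e)
    rcases hne.lt_or_gt with hlt | hlt
    · simp [hlt, hlt.le]
    · simp [hlt.not_gt, hlt.not_ge]
  · simp

theorem slope_eq {u v : δ.Vtx} (huv : Below p u v) : slopeAbove p u = slopeBelow p v := by
  unfold slopeAbove slopeBelow
  refine Finset.sum_congr rfl fun b _ => ?_
  rw [← huv.1]
  by_cases hc : δ.coef (onFloor u) b = 0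
  · simp [hc]
  obtain ⟨w, hw, rfl⟩ := h.exists_vtx_of_coef hc
  have : (p (level w)).2 ≤ height p u ↔ (p (level w)).2 < height p v := by
    refine ⟨fun h' => h'.trans_lt huv.2.1, fun h' => ?_⟩
    by_contra hlt
    exact absurd (huv.2.2 w hw (not_le.1 hlt)) (not_le.2 h')
  simp only [this]

theorem slopeBelow_of_bottom {v : δ.Vtx} (hv : ∀ w, ¬ Below p w v) : slopeBelow p v = 0 := by
  refine Finset.sum_eq_zero fun b _ => ?_
  split_ifs with hb
  · by_contra hc
    obtain ⟨w, hw, rfl⟩ := h.exists_vtx_of_coef hc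
    obtain ⟨x, hx, -⟩ := exists_below hw hb
    exact hv x hx
  · rfl

theorem slopeAbove_of_top {v : δ.Vtx} (hv : ∀ w, ¬ Below p v w) :
    slopeAbove p v = δ.leak (onFloor v) := by
  refine Finset.sum_congr rfl fun b _ => ?_
  split_ifs with hb
  · rfl
  · by_contra hc
    obtain ⟨w, hw, rfl⟩ := h.exists_vtx_of_coef (Ne.symm hc)
    obtain ⟨x, hx⟩ := exists_above hw.symm (not_le.1 hb)
    exact hv x hx

theorem floorX_sub {u v : δ.Vtx} (huv : Below p u v) :
    δ.floorX p (onFloor v) (height p v) = δ.floorX p (onFloor u) (height p u) +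
      (height p v - height p u) * slopeAbove p u := by
  unfold floorX slopeAbove
  rw [← huv.1]
  push_cast
  rw [Finset.mul_sum, add_assoc, ← Finset.sum_add_distrib]
  congr 1
  refine Finset.sum_congr rfl fun b _ => ?_
  by_cases hc : δ.coef (onFloor u) b = 0
  · simp [hc]
  obtain ⟨w, hw, rfl⟩ := h.exists_vtx_of_coef hc
  split_ifs with hb
  · rw [max_eq_left (sub_nonneg.2 hb), max_eq_left (sub_nonneg.2 (hb.trans huv.2.1.le))]
    ring
  · have h1 := huv.2.2 w hw (not_le.1 hb)
    unfold height at h1 hb ⊢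
    rw [max_eq_right (sub_nonpos.2 h1), max_eq_right (sub_nonpos.2 (not_le.1 hb).le)]
    ring

omit h in
theorem exists_top (i : Fin n) : ∃ v : δ.Vtx, onFloor v = i ∧ ∀ w, ¬ Below p v w := by
  classical
  obtain ⟨v, hv, hmax⟩ := Finset.exists_max_image
    (univ.filter fun w : δ.Vtx => onFloor w = i) (height p) ⟨.inl i, mem_filter.2 ⟨mem_univ _, rfl⟩⟩
  simp only [mem_filter, mem_univ, true_and] at hv hmax
  exact ⟨v, hv, fun w hw => absurd (hmax w (hw.1.symm.trans hv)) (not_le.2 hw.2.1)⟩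

omit h in
theorem exists_bottom (i : Fin n) : ∃ v : δ.Vtx, onFloor v = i ∧ ∀ w, ¬ Below p w v := by
  classical
  obtain ⟨v, hv, hmin⟩ := Finset.exists_min_image
    (univ.filter fun w : δ.Vtx => onFloor w = i) (height p) ⟨.inl i, mem_filter.2 ⟨mem_univ _, rfl⟩⟩
  simp only [mem_filter, mem_univ, true_and] at hv hmin
  exact ⟨v, hv, fun w hw => absurd (hmin w (hw.1.trans hv)) (not_le.2 hw.2.1)⟩

theorem top_unique {u v : δ.Vtx} (huv : onFloor u = onFloor v) (hu : ∀ w, ¬ Below p u w)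
    (hv : ∀ w, ¬ Below p v w) : u = v := by
  refine h.eq_of_height huv ?_
  rcases lt_trichotomy (height p u) (height p v) with hlt | heq | hlt
  · obtain ⟨w, hw⟩ := exists_above huv hlt; exact absurd hw (hu w)
  · exact heq
  · obtain ⟨w, hw⟩ := exists_above huv.symm hlt; exact absurd hw (hv w)

theorem bottom_unique {u v : δ.Vtx} (huv : onFloor u = onFloor v) (hu : ∀ w, ¬ Below p w u)
    (hv : ∀ w, ¬ Below p w v) : u = v := by
  refine h.eq_of_height huv ?_
  rcases lt_trichotomy (height p u) (height p v) with hlt | heq | hlt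
  · obtain ⟨w, hw, -⟩ := exists_below huv hlt; exact absurd hw (hv w)
  · exact heq
  · obtain ⟨w, hw, -⟩ := exists_below huv.symm hlt; exact absurd hw (hu w)

end Admissible

end FloorDiagram


namespace FloorDiagram

variable {n : ℕ} (δ : FloorDiagram n) (p : Fin n → ℝ × ℝ)

/-!
### The tropical stable map of a floor diagram
-/

variable {δ} in
/-- The left vertex of a half elevator. -/
def leftVtx (e : δ.Half) : δ.Vtx := if e.1.2 then .inr e else .inl e.1.1

variable {δ} in
/-- The right vertex of a half elevator. -/
def rightVtx (e : δ.Half) : δ.Vtx := if e.1.2 then .inl e.1.1 else .inr e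

/-- The bounded edges: pieces of floors, and half elevators which do not cross the cut. -/
abbrev CurveEdge : Type :=
  {q : δ.Vtx × δ.Vtx // Below p q.1 q.2} ⊕ {e : δ.Half // δ.wind e.1.1 e.1.2 = 0}

variable {δ p} in
/-- The lower or left vertex of a bounded edge. -/
def CurveEdge.tail : CurveEdge δ p → δ.Vtx := Sum.elim (fun q => q.1.1) fun e => leftVtx e.1

variable {δ p} in
/-- The upper or right vertex of a bounded edge. -/
def CurveEdge.head : CurveEdge δ p → δ.Vtx := Sum.elim (fun q => q.1.2) fun e => rightVtx e.1

variable {δ p} in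
/-- The direction of a bounded edge. -/
noncomputable def CurveEdge.dir : CurveEdge δ p → ℤ × ℤ :=
  Sum.elim (fun q => (slopeAbove p q.1.1, 1)) fun e => (δ.wt e.1.1.1, 0)

variable {δ p} in
/-- The length of a bounded edge. -/
noncomputable def CurveEdge.len : CurveEdge δ p → ℝ :=
  Sum.elim (fun q => height p q.1.2 - height p q.1.1) fun e =>
    ((position p (rightVtx e.1)).1 - (position p (leftVtx e.1)).1) / δ.wt e.1.1.1

/-- The half elevators which cross the cut. -/
abbrev Winding : Type := {e : δ.Half // 0 < δ.wind e.1.1 e.1.2}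

/-- The vertexless lines. -/
abbrev Line : Type := {q : δ.Half × ℕ // q.2 + 1 < δ.wind q.1.1.1 q.1.1.2}

/-- The crossings of half elevators with the cut. -/
abbrev Slot : Type := {q : δ.Half × ℕ // q.2 < δ.wind q.1.1.1 q.1.1.2}

/-- Crossings as lists by half elevators. -/
def slotEquiv : δ.Slot ≃ Σ e : δ.Half, Fin (δ.wind e.1.1 e.1.2) where
  toFun q := ⟨q.1.1, q.1.2, q.2⟩
  invFun q := ⟨(q.1, q.2.1), q.2.2⟩
  left_inv _ := rfl
  right_inv _ := rfl

instance : Finite δ.Slot := Finite.of_equiv _ δ.slotEquiv.symm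

instance : Finite δ.Line :=
  Finite.of_injective (β := δ.Slot) (fun q => ⟨q.1, (Nat.lt_succ_self _).trans q.2⟩)
    fun _ _ h => Subtype.ext (congrArg (fun q : δ.Slot => q.1) h)

noncomputable instance : Fintype δ.Line := Fintype.ofFinite _

noncomputable instance : Fintype δ.Slot := Fintype.ofFinite _

variable {δ} in
/-- The crossing after which an end of direction `(1,0)` continues. -/
def rightSlot : δ.Winding ⊕ δ.Line → δ.Slot :=
  Sum.elim (fun e => ⟨(e.1, 0), e.2⟩) fun q => ⟨(q.1.1, q.1.2 + 1), q.2⟩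

variable {δ} in
/-- The crossing before an end of direction `(-1,0)`. -/
def leftSlot : δ.Winding ⊕ δ.Line → δ.Slot :=
  Sum.elim (fun e => ⟨(e.1, δ.wind e.1.1.1 e.1.1.2 - 1), Nat.sub_lt e.2 Nat.one_pos⟩)
    fun q => ⟨q.1, (Nat.lt_succ_self _).trans q.2⟩

theorem rightSlot_bijective : Function.Bijective (rightSlot (δ := δ)) := by
  constructor
  · rintro (e | q) (e' | q') h <;> simp [rightSlot] at h
    · exact congrArg _ (Subtype.ext h)
    · exact congrArg _ (Subtype.ext (Prod.ext h.1 h.2))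
  · rintro ⟨⟨e, j⟩, hj⟩
    cases j with
    | zero => exact ⟨.inl ⟨e, hj⟩, rfl⟩
    | succ j => exact ⟨.inr ⟨(e, j), hj⟩, rfl⟩

theorem leftSlot_bijective : Function.Bijective (leftSlot (δ := δ)) := by
  constructor
  · rintro (⟨e, he⟩ | ⟨⟨e, j⟩, hj⟩) (⟨e', he'⟩ | ⟨⟨e', j'⟩, hj'⟩) h <;>
      simp only [leftSlot, Sum.elim_inl, Sum.elim_inr, Subtype.mk.injEq, Prod.mk.injEq] at h
    · obtain ⟨rfl, -⟩ := h; rfl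
    · obtain ⟨rfl, h⟩ := h
      simp only at hj'
      omega
    · obtain ⟨rfl, h⟩ := h
      simp only at hj
      omega
    · obtain ⟨rfl, rfl⟩ := h; rfl
  · rintro ⟨⟨e, j⟩, hj⟩
    simp only at hj
    by_cases h : j + 1 < δ.wind e.1.1 e.1.2
    · exact ⟨.inr ⟨(e, j), h⟩, rfl⟩
    · refine ⟨.inl ⟨e, by omega⟩, Subtype.ext (Prod.ext rfl ?_)⟩
      simp only [leftSlot, Sum.elim_inl]
      omega

/-- The glueing of the ends. -/
noncomputable def glueEquiv : δ.Winding ⊕ δ.Line ≃ δ.Winding ⊕ δ.Line :=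
  (Equiv.ofBijective _ δ.rightSlot_bijective).trans
    (Equiv.ofBijective _ δ.leftSlot_bijective).symm

theorem glueEquiv_eq_iff {r l : δ.Winding ⊕ δ.Line} :
    δ.glueEquiv r = l ↔ rightSlot r = leftSlot l := by
  unfold glueEquiv
  rw [Equiv.trans_apply, Equiv.symm_apply_eq, Equiv.ofBijective_apply, Equiv.ofBijective_apply]

theorem leftSlot_glueEquiv (r : δ.Winding ⊕ δ.Line) : leftSlot (δ.glueEquiv r) = rightSlot r :=
  (δ.glueEquiv_eq_iff.1 rfl).symm

open Classical in
/-- The data of the tropical stable map of a floor diagram. -/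
@[reducible] noncomputable def curveData : CutData n where
  V := δ.Vtx
  H := CurveEdge δ p × Bool
  Dn := {v : δ.Vtx // δ.wt (onFloor v) = 0 ∧ ∀ w, ¬ Below p w v}
  Up := {v : δ.Vtx // δ.wt (onFloor v) = 0 ∧ ∀ w, ¬ Below p v w}
  Rt := δ.Winding
  Lf := δ.Winding
  Z := δ.Line
  vert h := if h.2 then h.1.tail else h.1.head
  opp h := (h.1, !h.2)
  len h := h.1.len
  dir h := if h.2 then h.1.dir else -h.1.dir
  dnVert v := v.1
  upVert v := v.1
  leak v := δ.leak (onFloor v.1)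
  rtVert e := leftVtx e.1
  rtWt e := δ.wt e.1.1.1
  lfVert e := rightVtx e.1
  lfWt e := δ.wt e.1.1.1
  lineWt q := δ.wt q.1.1.1.1
  lineY q := (p q.1.1.1.1).2
  markVert i := .inl i
  pos := position p
  glue := δ.glueEquiv

/-- All flags of the tropical stable map of a floor diagram: two for each vertex on a white floor
(`true` for the upper one), and two for each half elevator (`true` for the left one). -/
abbrev FlagIndex : Type := ({v : δ.Vtx // δ.wt (onFloor v) = 0} × Bool) ⊕ (δ.Half × Bool)

variable {δ} in
/-- The vertex of a flag. -/
def FlagIndex.vert : δ.FlagIndex → δ.Vtx :=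
  Sum.elim (fun v => v.1.1) fun e => if e.2 then leftVtx e.1 else rightVtx e.1

variable {δ} in
/-- The direction of a flag. -/
noncomputable def FlagIndex.dir : δ.FlagIndex → ℤ × ℤ :=
  Sum.elim (fun v => if v.2 then (slopeAbove p v.1.1, 1) else (-slopeBelow p v.1.1, -1))
    fun e => if e.2 then ((δ.wt e.1.1.1 : ℤ), 0) else (-(δ.wt e.1.1.1 : ℤ), 0)

variable {δ p}

theorem wt_onFloor_of_below (h : δ.Admissible p) {u v : δ.Vtx} (huv : Below p u v) :
    δ.wt (onFloor u) = 0 := by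
  rcases u with i | e
  · rcases v with j | f
    · have h1 : i = j := huv.1
      subst h1
      exact absurd huv.2.1 (lt_irrefl _)
    · have h1 : i = δ.floor f.1.1 f.1.2 := huv.1
      change δ.wt i = 0
      rw [h1]
      exact h.wt_floor _ _
  · exact h.wt_floor _ _

theorem wt_onFloor_of_below' (h : δ.Admissible p) {u v : δ.Vtx} (huv : Below p u v) :
    δ.wt (onFloor v) = 0 := huv.1 ▸ wt_onFloor_of_below h huv

/-- The index of a flag. -/
def flagIndex (h : δ.Admissible p) : (δ.curveData p).Flag → δ.FlagIndex
  | .inl (.inl q, true) => .inl (⟨q.1.1, wt_onFloor_of_below h q.2⟩, true)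
  | .inl (.inl q, false) => .inl (⟨q.1.2, wt_onFloor_of_below' h q.2⟩, false)
  | .inl (.inr e, s) => .inr (e.1, s)
  | .inr (.inl v) => .inl (⟨v.1, v.2.1⟩, false)
  | .inr (.inr (.inl v)) => .inl (⟨v.1, v.2.1⟩, true)
  | .inr (.inr (.inr (.inl e))) => .inr (e.1, true)
  | .inr (.inr (.inr (.inr e))) => .inr (e.1, false)

theorem flagIndex_bijective (h : δ.Admissible p) : Function.Bijective (flagIndex h) := by
  constructor
  · rintro (⟨⟨⟨u, v⟩, huv⟩ | ⟨e, he⟩, _ | _⟩ | ⟨v, hv⟩ | ⟨v, hv⟩ | ⟨e, he⟩ | ⟨e, he⟩)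
      (⟨⟨⟨u', v'⟩, huv'⟩ | ⟨e', he'⟩, _ | _⟩ | ⟨v', hv'⟩ | ⟨v', hv'⟩ | ⟨e', he'⟩ | ⟨e', he'⟩) heq <;>
      simp only [flagIndex, Sum.inl.injEq, Sum.inr.injEq, Prod.mk.injEq, Subtype.mk.injEq,
        reduceCtorEq, and_true, and_false] at heq <;>
      (try subst heq)
    · obtain rfl := h.below_unique huv huv'; rfl
    · exact absurd huv (hv'.2 _)
    · obtain rfl := h.above_unique huv huv'; rfl
    · exact absurd huv (hv'.2 _)
    · rfl
    · exact absurd he he'.ne'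
    · rfl
    · exact absurd he he'.ne'
    · exact absurd huv' (hv.2 _)
    · rfl
    · exact absurd huv' (hv.2 _)
    · rfl
    · exact absurd he' he.ne'
    · rfl
    · exact absurd he' he.ne'
    · rfl
  · rintro (⟨⟨v, hv⟩, _ | _⟩ | ⟨e, s⟩)
    · by_cases hb : ∃ w, Below p w v
      · obtain ⟨w, hw⟩ := hb
        exact ⟨.inl (.inl ⟨(w, v), hw⟩, false), rfl⟩
      · exact ⟨.inr (.inl ⟨v, hv, fun w hw => hb ⟨w, hw⟩⟩), rfl⟩
    · by_cases hb : ∃ w, Below p v w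
      · obtain ⟨w, hw⟩ := hb
        exact ⟨.inl (.inl ⟨(v, w), hw⟩, true), rfl⟩
      · exact ⟨.inr (.inr (.inl ⟨v, hv, fun w hw => hb ⟨w, hw⟩⟩)), rfl⟩
    · by_cases he : δ.wind e.1.1 e.1.2 = 0
      · exact ⟨.inl (.inr ⟨e, he⟩, s), rfl⟩
      · cases s
        · exact ⟨.inr (.inr (.inr (.inr ⟨e, Nat.pos_of_ne_zero he⟩))), rfl⟩
        · exact ⟨.inr (.inr (.inr (.inl ⟨e, Nat.pos_of_ne_zero he⟩))), rfl⟩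

/-- The flags are in bijection with their indices. -/
noncomputable def flagEquiv (h : δ.Admissible p) : (δ.curveData p).Flag ≃ δ.FlagIndex :=
  Equiv.ofBijective _ (flagIndex_bijective h)

theorem vert_flagIndex (h : δ.Admissible p) (f : (δ.curveData p).Flag) :
    (flagIndex h f).vert = (δ.curveData p).flagVert f := by
  rcases f with (⟨⟨⟨u, v⟩, huv⟩ | ⟨e, he⟩, _ | _⟩ | ⟨v, hv⟩ | ⟨v, hv⟩ | ⟨e, he⟩ | ⟨e, he⟩) <;> rfl

theorem dir_flagIndex (h : δ.Admissible p) (f : (δ.curveData p).Flag) :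
    (flagIndex h f).dir p = (δ.curveData p).flagDir f := by
  rcases f with (⟨⟨⟨u, v⟩, huv⟩ | ⟨e, he⟩, _ | _⟩ | ⟨v, hv⟩ | ⟨v, hv⟩ | ⟨e, he⟩ | ⟨e, he⟩)
  · change (-slopeBelow p v, (-1 : ℤ)) = -(slopeAbove p u, (1 : ℤ))
    rw [h.slope_eq huv]; rfl
  · rfl
  · change (-(δ.wt e.1.1 : ℤ), (0 : ℤ)) = -((δ.wt e.1.1 : ℤ), (0 : ℤ))
    rw [Prod.neg_mk, neg_zero]
  · rfl
  · change (-slopeBelow p v, (-1 : ℤ)) = (0, -1)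
    rw [h.slopeBelow_of_bottom hv.2, neg_zero]
  · change (slopeAbove p v, (1 : ℤ)) = (δ.leak (onFloor v), 1)
    rw [h.slopeAbove_of_top hv.2]
  · rfl
  · rfl

end FloorDiagram


namespace FloorDiagram

variable {n : ℕ} {δ : FloorDiagram n} {p : Fin n → ℝ × ℝ}

noncomputable instance : DecidableEq δ.FlagIndex := Classical.decEq _

theorem flagsAt_eq (h : δ.Admissible p) (v : δ.Vtx) : (δ.curveData p).flagsAt v =
    (univ.filter fun k : δ.FlagIndex => k.vert = v).map (flagEquiv h).symm.toEmbedding := by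
  ext f
  have h1 := vert_flagIndex h f
  rw [mem_map_equiv, Equiv.symm_symm]
  unfold CutData.flagsAt
  simp only [mem_filter, mem_univ, true_and]
  rw [← h1]
  rfl

/-- The flags at an end of a half elevator at a floor. -/
theorem filter_vert_inr (h : δ.Admissible p) (e : δ.Half) :
    (univ.filter fun k : δ.FlagIndex => k.vert = .inr e) =
      {.inl (⟨.inr e, h.wt_floor _ _⟩, true), .inl (⟨.inr e, h.wt_floor _ _⟩, false),
        .inr (e, e.1.2)} := by
  ext k
  simp only [mem_filter, mem_univ, true_and, mem_insert, mem_singleton]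
  rcases k with ⟨⟨v, hv⟩, s⟩ | ⟨f, s⟩
  · simp only [FlagIndex.vert, Sum.elim_inl, Sum.inl.injEq, Prod.mk.injEq, Subtype.ext_iff,
      reduceCtorEq, or_false]
    cases s <;> simp
  · obtain ⟨⟨b, t⟩, hf⟩ := f
    simp only [FlagIndex.vert, Sum.elim_inr, Sum.inr.injEq, Prod.mk.injEq, reduceCtorEq, false_or]
    constructor
    · intro heq
      cases s <;> cases t <;> simp [leftVtx, rightVtx] at heq <;> subst heq <;> simp
    · rintro ⟨rfl, rfl⟩
      cases s <;> simp [leftVtx, rightVtx]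

/-- The flags at a white marked point. -/
theorem filter_vert_white {i : Fin n} (hi : δ.wt i = 0) :
    (univ.filter fun k : δ.FlagIndex => k.vert = .inl i) =
      {.inl (⟨.inl i, hi⟩, true), .inl (⟨.inl i, hi⟩, false)} := by
  ext k
  simp only [mem_filter, mem_univ, true_and, mem_insert, mem_singleton]
  rcases k with ⟨⟨v, hv⟩, s⟩ | ⟨f, s⟩
  · simp only [FlagIndex.vert, Sum.elim_inl, Sum.inl.injEq, Prod.mk.injEq, Subtype.ext_iff]
    cases s <;> simp
  · obtain ⟨⟨b, t⟩, hf⟩ := f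
    simp only [FlagIndex.vert, Sum.elim_inr, reduceCtorEq, or_false, iff_false]
    intro heq
    cases s <;> cases t <;> simp [leftVtx, rightVtx] at heq <;> subst heq <;> simp [hi] at hf

/-- The flags at a black marked point. -/
theorem filter_vert_black {i : Fin n} (hi : 0 < δ.wt i) :
    (univ.filter fun k : δ.FlagIndex => k.vert = .inl i) =
      {.inr (⟨(i, true), hi⟩, false), .inr (⟨(i, false), hi⟩, true)} := by
  ext k
  simp only [mem_filter, mem_univ, true_and, mem_insert, mem_singleton]
  rcases k with ⟨⟨v, hv⟩, s⟩ | ⟨f, s⟩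
  · simp only [FlagIndex.vert, Sum.elim_inl, reduceCtorEq, or_false, iff_false]
    rintro rfl
    exact hi.ne' hv
  · obtain ⟨⟨b, t⟩, hf⟩ := f
    simp only [FlagIndex.vert, Sum.elim_inr, Sum.inr.injEq, Prod.mk.injEq, Subtype.mk.injEq]
    cases s <;> cases t <;> simp [leftVtx, rightVtx]

theorem coef_floor (h : δ.Admissible p) (e : δ.Half) :
    δ.coef (δ.floor e.1.1 e.1.2) e.1.1 = if e.1.2 then -(δ.wt e.1.1 : ℤ) else δ.wt e.1.1 := by
  obtain ⟨⟨b, s⟩, hb⟩ := e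
  rw [coef_eq (h.wt_floor _ _)]
  have := h.floor_ne b hb
  cases s
  · simp [this]
  · simp [this.symm]

theorem coef_white_self (h : δ.Admissible p) (i : Fin n) : δ.coef i i = 0 :=
  coef_self i h.wt_floor

theorem sum_flagsAt {M : Type*} [AddCommMonoid M] (h : δ.Admissible p) (v : δ.Vtx)
    (F : ℤ × ℤ → M) : ∑ f ∈ (δ.curveData p).flagsAt v, F ((δ.curveData p).flagDir f) =
      ∑ k ∈ univ.filter (fun k : δ.FlagIndex => k.vert = v), F (k.dir p) := by
  rw [flagsAt_eq h, Finset.sum_map]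
  refine Finset.sum_congr rfl fun k _ => ?_
  rw [← dir_flagIndex h]
  exact congrArg (fun k => F (FlagIndex.dir p k)) ((flagEquiv h).apply_symm_apply k)

theorem curveData_balanced (h : δ.Admissible p) (v : δ.Vtx) :
    ∑ f ∈ (δ.curveData p).flagsAt v, (δ.curveData p).flagDir f = 0 := by
  rw [sum_flagsAt h v (fun x => x)]
  have hs := h.slopeAbove_sub v
  rcases v with i | e
  · rcases Nat.eq_zero_or_pos (δ.wt i) with hi | hi
    · rw [filter_vert_white hi, Finset.sum_pair (by simp)]
      simp only [onFloor, level, Sum.elim_inl, id, coef_white_self h] at hs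
      simp only [FlagIndex.dir, Sum.elim_inl, if_true, Bool.false_eq_true, if_false,
        Prod.mk_add_mk, ← sub_eq_add_neg, hs]
      rfl
    · rw [filter_vert_black hi, Finset.sum_pair (by simp)]
      simp [FlagIndex.dir]
  · rw [filter_vert_inr h, Finset.sum_insert (by simp), Finset.sum_pair (by simp)]
    have hs' := hs.trans (coef_floor h e)
    simp only [FlagIndex.dir, Sum.elim_inl, Sum.elim_inr, if_true, Bool.false_eq_true, if_false]
    rcases hb : e.1.2 with _ | _ <;>
      simp only [hb, if_true, Bool.false_eq_true, if_false, Prod.mk_add_mk, Prod.mk_eq_zero] at hs' ⊢ <;>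
      constructor <;> linarith

theorem card_flagsAt (h : δ.Admissible p) (v : δ.Vtx) :
    #((δ.curveData p).flagsAt v) = if v.isLeft then 2 else 3 := by
  rw [flagsAt_eq h, Finset.card_map]
  rcases v with i | e
  · rcases Nat.eq_zero_or_pos (δ.wt i) with hi | hi
    · rw [filter_vert_white hi, Finset.card_pair (by simp)]; rfl
    · rw [filter_vert_black hi, Finset.card_pair (by simp)]; rfl
  · rw [filter_vert_inr h, Finset.card_insert_of_notMem (by simp), Finset.card_pair (by simp)]
    rfl

theorem curveData_trivalent (h : δ.Admissible p) : (δ.curveData p).Trivalent := by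
  classical
  intro v
  unfold CutData.valence
  rw [card_flagsAt h]
  rcases v with i | e
  · rw [Finset.card_eq_one.2 ⟨i, ?_⟩]
    · rfl
    · ext j
      simp only [mem_filter, mem_univ, true_and, mem_singleton]
      exact Sum.inl_injective.eq_iff
  · refine congrArg (3 + ·) (Finset.card_eq_zero.2 (Finset.eq_empty_of_forall_notMem
      fun j hj => ?_))
    simp only [mem_filter, mem_univ, true_and, reduceCtorEq] at hj

theorem marked_curveData (v : δ.Vtx) : (δ.curveData p).Marked v ↔ v.isLeft := by
  rcases v with i | e
  · exact ⟨fun _ => rfl, fun _ => ⟨i, rfl⟩⟩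
  · constructor
    · rintro ⟨j, hj⟩
      exact absurd (show (Sum.inl j : δ.Vtx) = .inr e from hj) (by simp)
    · intro hf; cases hf

theorem not_sameRay_of_snd {x y : ℤ × ℤ} (hx : x ≠ 0) (hy : y ≠ 0)
    (h : ∀ a b : ℤ, 0 < a → 0 < b → a * x.2 ≠ b * y.2) : ¬ SameRay ℤ x y := by
  rintro (h1 | h1 | ⟨a, b, ha, hb, hab⟩)
  · exact hx h1
  · exact hy h1
  · exact h a b ha hb (by simpa using congrArg Prod.snd hab)

theorem exists_dir_index (h : δ.Admissible p) (e : δ.Half) : ∃ a b w : ℤ,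
    FlagIndex.dir p (.inl (⟨.inr e, h.wt_floor _ _⟩, true)) = (a, 1) ∧
    FlagIndex.dir p (.inl (⟨.inr e, h.wt_floor _ _⟩, false)) = (b, -1) ∧
    FlagIndex.dir p (.inr (e, e.1.2)) = (w, 0) ∧ a + b + w = 0 ∧ w.natAbs = δ.wt e.1.1 := by
  have hs := (h.slopeAbove_sub (.inr e)).trans (coef_floor h e)
  refine ⟨slopeAbove p (.inr e), -slopeBelow p (.inr e), if e.1.2 then δ.wt e.1.1 else -δ.wt e.1.1,
    rfl, rfl, ?_, ?_, ?_⟩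
  · simp only [FlagIndex.dir, Sum.elim_inr]
    split_ifs <;> rfl
  · split_ifs at hs ⊢ <;> linarith
  · split_ifs <;> simp

theorem curveData_locallyEmbedded (h : δ.Admissible p) : (δ.curveData p).LocallyEmbedded := by
  intro v hv f hf f' hf' hne
  rcases v with i | e
  · exact absurd ((marked_curveData _).2 rfl) hv
  rw [flagsAt_eq h, mem_map_equiv, Equiv.symm_symm, filter_vert_inr h] at hf hf'
  rw [← dir_flagIndex h, ← dir_flagIndex h]
  have hne' : flagEquiv h f ≠ flagEquiv h f' := (flagEquiv h).injective.ne hne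
  change flagIndex h f ∈ _ at hf
  change flagIndex h f' ∈ _ at hf'
  change flagIndex h f ≠ flagIndex h f' at hne'
  generalize flagIndex h f = k at *
  generalize flagIndex h f' = k' at *
  obtain ⟨a, b, w, h1, h2, h3, -, h5⟩ := exists_dir_index h e
  have hw : w ≠ 0 := by
    rintro rfl
    exact e.2.ne h5
  simp only [mem_insert, mem_singleton] at hf hf'
  rcases hf with rfl | rfl | rfl <;> rcases hf' with rfl | rfl | rfl <;>
    first
    | exact absurd rfl hne'
    | (simp only [h1, h2, h3]
       refine not_sameRay_of_snd ?_ ?_ ?_ <;> simp [hw] <;> intros <;> omega)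

theorem vertexMult_inr (h : δ.Admissible p) (e : δ.Half) :
    (δ.curveData p).vertexMult (.inr e : δ.Vtx) = δ.wt e.1.1 := by
  obtain ⟨a, b, w, h1, h2, h3, h4, h5⟩ := exists_dir_index h e
  let G : δ.FlagIndex → δ.FlagIndex → ℕ := fun k k' =>
    ((k.dir p).1 * (k'.dir p).2 - (k.dir p).2 * (k'.dir p).1).natAbs
  have hG : ∀ f f' : (δ.curveData p).Flag,
      (((δ.curveData p).flagDir f).1 * ((δ.curveData p).flagDir f').2 -
        ((δ.curveData p).flagDir f).2 * ((δ.curveData p).flagDir f').1).natAbs =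
      G (flagIndex h f) (flagIndex h f') := by
    intro f f'
    simp only [G, dir_flagIndex]
  have hmem : ∀ f, f ∈ (δ.curveData p).flagsAt (.inr e : δ.Vtx) ↔
      flagIndex h f ∈ ({.inl (⟨.inr e, h.wt_floor _ _⟩, true),
        .inl (⟨.inr e, h.wt_floor _ _⟩, false), .inr (e, e.1.2)} : Finset δ.FlagIndex) := by
    intro f
    rw [← filter_vert_inr h, flagsAt_eq h, mem_map_equiv, Equiv.symm_symm]
    rfl
  have hcases : ∀ k ∈ ({.inl (⟨.inr e, h.wt_floor _ _⟩, true),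
      .inl (⟨.inr e, h.wt_floor _ _⟩, false), .inr (e, e.1.2)} : Finset δ.FlagIndex),
      ∀ k' ∈ ({.inl (⟨.inr e, h.wt_floor _ _⟩, true),
        .inl (⟨.inr e, h.wt_floor _ _⟩, false), .inr (e, e.1.2)} : Finset δ.FlagIndex),
      G k k' ≤ δ.wt e.1.1 := by
    intro k hk k' hk'
    simp only [mem_insert, mem_singleton] at hk hk'
    rcases hk with rfl | rfl | rfl <;> rcases hk' with rfl | rfl | rfl <;>
      (simp only [G, h1, h2, h3]; omega)
  unfold CutData.vertexMult
  apply le_antisymm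
  · refine Finset.sup_le fun q hq => ?_
    rw [mem_product, hmem, hmem] at hq
    rw [hG]
    exact hcases _ hq.1 _ hq.2
  · obtain ⟨f, hf⟩ := (flagIndex_bijective h).2 (.inl (⟨.inr e, h.wt_floor _ _⟩, true))
    obtain ⟨f', hf'⟩ := (flagIndex_bijective h).2 (.inr (e, e.1.2))
    refine le_trans (le_of_eq ?_) (Finset.le_sup (b := (f, f')) ?_)
    · rw [hG, hf, hf']
      simp only [G, h1, h3]
      omega
    · rw [mem_product, hmem, hmem, hf, hf']
      simp

theorem curveData_mult (h : δ.Admissible p) : (δ.curveData p).mult = δ.mult := by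
  classical
  unfold CutData.mult mult
  have : (univ.filter fun v => ¬ (δ.curveData p).Marked v) =
      (univ : Finset δ.Half).map (Function.Embedding.inr (α := Fin n)) := by
    ext v
    simp only [mem_filter, mem_univ, true_and, mem_map, Function.Embedding.inr_apply]
    rw [marked_curveData]
    rcases v with i | e
    · constructor
      · intro h; exact absurd rfl h
      · rintro ⟨e, he⟩; cases he
    · exact ⟨fun _ => ⟨e, rfl⟩, fun _ h => by cases h⟩
  rw [this, Finset.prod_map]
  exact Finset.prod_congr rfl fun e _ => vertexMult_inr h e

theorem wt_cast_pos (e : δ.Half) : (0 : ℝ) < δ.wt e.1.1 := by exact_mod_cast e.2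

theorem onFloor_leftVtx (e : δ.Half) : onFloor (leftVtx e) = δ.start e.1.1 e.1.2 := by
  unfold leftVtx start
  split_ifs <;> rfl

theorem onFloor_rightVtx (e : δ.Half) : onFloor (rightVtx e) = δ.finish e.1.1 e.1.2 := by
  unfold rightVtx finish
  split_ifs <;> rfl

theorem level_leftVtx (e : δ.Half) : level (leftVtx e) = e.1.1 := by
  unfold leftVtx
  split_ifs <;> rfl

theorem level_rightVtx (e : δ.Half) : level (rightVtx e) = e.1.1 := by
  unfold rightVtx
  split_ifs <;> rfl

theorem left_lt_right (h : δ.Admissible p) {e : δ.Half} (he : δ.wind e.1.1 e.1.2 = 0) :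
    (position p (leftVtx e)).1 < (position p (rightVtx e)).1 := by
  have := (h.lt_or_wind e.1.1 e.2 e.1.2).resolve_right (by omega)
  unfold position
  rw [onFloor_leftVtx, onFloor_rightVtx]
  exact h.floorX_lt _ _ _ _ this

theorem curveEdge_len_pos (h : δ.Admissible p) (e : CurveEdge δ p) : 0 < e.len := by
  rcases e with q | e
  · exact sub_pos.2 q.2.2.1
  · exact div_pos (sub_pos.2 (left_lt_right h e.2)) (wt_cast_pos _)

theorem curveEdge_affine (h : δ.Admissible p) (e : CurveEdge δ p) : position p e.head =
    position p e.tail + (e.len * (e.dir.1 : ℝ), e.len * (e.dir.2 : ℝ)) := by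
  rcases e with q | e
  · refine Prod.ext ?_ ?_
    · exact h.floorX_sub q.2
    · simp [CurveEdge.head, CurveEdge.tail, CurveEdge.len, CurveEdge.dir, position]
  · refine Prod.ext ?_ ?_
    · have := (wt_cast_pos e.1).ne'
      simp only [CurveEdge.head, CurveEdge.tail, CurveEdge.len, CurveEdge.dir, Sum.elim_inr,
        Prod.fst_add, Int.cast_natCast]
      rw [div_mul_cancel₀ _ this]
      ring
    · simp [CurveEdge.head, CurveEdge.tail, CurveEdge.len, CurveEdge.dir, position, height,
        level_leftVtx, level_rightVtx]

/-- The tropical stable map of a floor diagram. -/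
noncomputable def curveMap (h : δ.Admissible p) : CutStableMap n where
  toCutData := δ.curveData p
  opp_opp := fun x => Prod.ext rfl (Bool.not_not _)
  opp_ne := fun x hx => by
    have : (!x.2) = x.2 := congrArg Prod.snd hx
    cases hb : x.2 <;> simp [hb] at this
  len_pos := fun x => curveEdge_len_pos h x.1
  len_opp _ := rfl
  dir_opp := fun x => by
    obtain ⟨e, s⟩ := x
    cases s
    · exact (neg_neg _).symm
    · rfl
  affine := fun x => by
    obtain ⟨e, s⟩ := x
    have := curveEdge_affine h e
    cases s
    · change position p e.tail = position p e.head +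
        (e.len * (((-e.dir).1 : ℤ) : ℝ), e.len * (((-e.dir).2 : ℤ) : ℝ))
      rw [this]
      simp [add_assoc]
    · exact this
  rtWt_pos e := e.1.2
  lfWt_pos e := e.1.2
  lineWt_pos q := q.1.1.2
  three_le_valence v := (curveData_trivalent h v).ge
  balanced := curveData_balanced h
  glue_wt := fun r => by
    have h1 : ∀ l, (δ.curveData p).leftWt l = δ.wt (leftSlot l).1.1.1.1 := by
      rintro (l | l) <;> rfl
    have h2 : ∀ l, (δ.curveData p).rightWt l = δ.wt (rightSlot l).1.1.1.1 := by
      rintro (l | l) <;> rfl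
    rw [h1, h2]
    exact congrArg (fun q : δ.Slot => δ.wt q.1.1.1.1) (δ.leftSlot_glueEquiv r)
  glue_y := fun r => by
    have h1 : ∀ l, (δ.curveData p).leftY l = (p (leftSlot l).1.1.1.1).2 := by
      rintro (l | l)
      · change (p (level (rightVtx l.1))).2 = _
        rw [level_rightVtx]; rfl
      · rfl
    have h2 : ∀ l, (δ.curveData p).rightY l = (p (rightSlot l).1.1.1.1).2 := by
      rintro (l | l)
      · change (p (level (leftVtx l.1))).2 = _
        rw [level_leftVtx]; rfl
      · rfl
    rw [h1, h2]
    exact congrArg (fun q : δ.Slot => (p q.1.1.1.1).2) (δ.leftSlot_glueEquiv r)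

end FloorDiagram


/-! ### Reachability in the glued graph -/

namespace CutData

variable {n : ℕ} (C : CutData n)

theorem reachable_opp (h : C.H) :
    C.gluedGraph.Reachable (.inl (C.vert h)) (.inl (C.vert (C.opp h))) := by
  by_cases heq : (Sum.inl (C.vert h) : C.V ⊕ C.Z) = .inl (C.vert (C.opp h))
  · rw [heq]
  · exact SimpleGraph.Adj.reachable ⟨heq, Or.inl (Or.inl ⟨h, rfl, rfl⟩)⟩

theorem reachable_glue (r : C.Rt ⊕ C.Z) :
    C.gluedGraph.Reachable (C.rightBase r) (C.leftBase (C.glue r)) := by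
  by_cases heq : C.rightBase r = C.leftBase (C.glue r)
  · rw [heq]
  · exact SimpleGraph.Adj.reachable ⟨heq, Or.inl (Or.inr ⟨r, rfl, rfl⟩)⟩

theorem reachable_glueWalk (r : C.Rt) (j : ℕ) :
    C.gluedGraph.Reachable (.inl (C.rtVert r)) (C.leftBase (glueWalk C.glue r j)) := by
  induction j with
  | zero => exact C.reachable_glue (.inl r)
  | succ j ih =>
    rw [glueWalk]
    rcases hj : glueWalk C.glue r j with l | z
    · rw [hj] at ih
      exact ih
    · rw [hj] at ih
      exact ih.trans (C.reachable_glue (.inr z))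

end CutData

theorem SimpleGraph.Reachable.of_adj_imp {V W : Type*} {G : SimpleGraph V} {R : W → W → Prop}
    (hR : Equivalence R) (f : V → W) (hf : ∀ a b, G.Adj a b → R (f a) (f b)) {a b : V}
    (h : G.Reachable a b) : R (f a) (f b) := by
  obtain ⟨w⟩ := h
  induction w with
  | nil => exact hR.refl _
  | cons hab _ ih => exact hR.trans (hf _ _ hab) ih

theorem SimpleGraph.reachable_equivalence {V : Type*} (G : SimpleGraph V) :
    Equivalence G.Reachable :=
  ⟨fun _ => .rfl, fun h => h.symm, fun h h' => h.trans h'⟩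

/-- A cut of a finite family of reals can be realized by a real outside of a finite set. -/
theorem exists_cut {ι : Type*} [Fintype ι] (f : ι → ℝ) (S : Finset ι)
    (hS : ∀ i ∈ S, ∀ j, j ∉ S → f i < f j) (F : Finset ℝ) :
    ∃ a, a ∉ F ∧ ∀ i, i ∈ S ↔ f i < a := by
  classical
  obtain ⟨m, h1, h2⟩ := Order.exists_between_finsets (S.image f) (Sᶜ.image f) (by
    simp only [mem_image, mem_compl]
    rintro _ ⟨i, hi, rfl⟩ _ ⟨j, hj, rfl⟩
    exact hS i hi j hj)
  obtain ⟨M, h3, h4⟩ := Order.exists_between_finsets {m} (Sᶜ.image f) (by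
    intro x hx y hy
    rw [mem_singleton.1 hx]
    exact h2 y hy)
  obtain ⟨a, ha, hF⟩ := (Set.Ioo_infinite (h3 m (mem_singleton_self m))).exists_notMem_finset F
  refine ⟨a, hF, fun i => ⟨fun hi => (h1 _ (mem_image_of_mem f hi)).trans ha.1, fun hi => ?_⟩⟩
  by_contra hn
  exact absurd (ha.2.trans (h4 _ (mem_image_of_mem f (mem_compl.2 hn)))) (not_lt.2 hi.le)

namespace FloorDiagram

variable {n : ℕ} {δ : FloorDiagram n} {p : Fin n → ℝ × ℝ}

/-! ### Global properties of the tropical stable map of a floor diagram -/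

theorem glueWalk_line (e : δ.Winding) (j : ℕ) (hj : j + 1 < δ.wind e.1.1.1 e.1.1.2) :
    glueWalk δ.glueEquiv e j = .inr ⟨(e.1, j), hj⟩ := by
  induction j with
  | zero => exact (δ.glueEquiv_eq_iff).2 rfl
  | succ j ih =>
    rw [glueWalk, ih (by omega), Sum.elim_inr]
    exact (δ.glueEquiv_eq_iff).2 rfl

theorem glueChain_winding (e : δ.Winding) :
    GlueChain δ.glueEquiv e (δ.wind e.1.1.1 e.1.1.2 - 1) e := by
  have he := e.2
  refine ⟨?_, fun j hj => by rw [glueWalk_line e j (by omega)]; rfl⟩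
  obtain ⟨k, hk⟩ := Nat.exists_eq_add_of_lt he
  rw [zero_add] at hk
  cases k with
  | zero =>
    rw [hk]
    refine (δ.glueEquiv_eq_iff).2 (Subtype.ext (Prod.ext rfl ?_))
    change 0 = δ.wind e.1.1.1 e.1.1.2 - 1
    rw [hk]
  | succ k =>
    have : δ.wind e.1.1.1 e.1.1.2 - 1 = k + 1 := by omega
    rw [this, glueWalk, glueWalk_line e k (by omega), Sum.elim_inr]
    refine (δ.glueEquiv_eq_iff).2 (Subtype.ext (Prod.ext rfl ?_))
    exact this.symm

theorem curve_reachable_left_right (p : Fin n → ℝ × ℝ) (e : δ.Half) :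
    (δ.curveData p).gluedGraph.Reachable (.inl (leftVtx e)) (.inl (rightVtx e)) := by
  by_cases he : δ.wind e.1.1 e.1.2 = 0
  · exact (δ.curveData p).reachable_opp (.inr ⟨e, he⟩, true)
  · have := (δ.curveData p).reachable_glueWalk (⟨e, Nat.pos_of_ne_zero he⟩ : δ.Winding)
      (δ.wind e.1.1 e.1.2 - 1)
    rw [(glueChain_winding ⟨e, Nat.pos_of_ne_zero he⟩).1] at this
    exact this

theorem graph_reachable_floor (b : Fin n) (s : Bool) : δ.graph.Reachable b (δ.floor b s) := by
  by_cases heq : b = δ.floor b s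
  · rw [← heq]
  · exact SimpleGraph.Adj.reachable ⟨heq, Or.inl ⟨s, rfl⟩⟩

theorem curveData_connected (h : δ.Admissible p) (hc : δ.graph.Connected) :
    (δ.curveData p).gluedGraph.Connected := by
  let R : δ.Vtx → δ.Vtx → Prop := fun u v =>
    (δ.curveData p).gluedGraph.Reachable (.inl u) (.inl v)
  have hR : Equivalence R := ⟨fun _ => .rfl, fun h => h.symm, fun h h' => h.trans h'⟩
  have hfl : ∀ u v : δ.Vtx, onFloor u = onFloor v → R u v := fun u v huv =>
    h.floor_induction hR (fun u v huv =>
      (δ.curveData p).reachable_opp (.inl ⟨(u, v), huv⟩, true)) huv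
  have hlr : ∀ e : δ.Half, R (.inl e.1.1) (.inr e) := by
    intro e
    have := curve_reachable_left_right p e
    unfold leftVtx rightVtx at this
    split_ifs at this
    · exact this.symm
    · exact this
  have hfloor : ∀ (b : Fin n) (s : Bool), R (.inl b) (.inl (δ.floor b s)) := by
    intro b s
    rcases Nat.eq_zero_or_pos (δ.wt b) with hb | hb
    · rw [h.floor_white b hb]
    · exact hR.trans (hlr ⟨(b, s), hb⟩) (hfl _ _ rfl)
  have hall : ∀ i j : Fin n, R (.inl i) (.inl j) := fun i j =>
    SimpleGraph.Reachable.of_adj_imp (G := δ.graph) hR (fun i => (.inl i : δ.Vtx)) (by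
      rintro a b ⟨-, ⟨s, rfl⟩ | ⟨s, rfl⟩⟩
      · exact hfloor a s
      · exact hR.symm (hfloor b s)) (hc.preconnected i j)
  have hv : ∀ (i : Fin n) (x : δ.Vtx ⊕ δ.Line),
      (δ.curveData p).gluedGraph.Reachable (.inl (.inl i : δ.Vtx)) x := by
    rintro i (v | q)
    · exact hR.trans (hall i (onFloor v)) (hfl (.inl (onFloor v)) v rfl)
    · have hw : 0 < δ.wind q.1.1.1.1 q.1.1.1.2 := (Nat.zero_lt_succ _).trans q.2
      have := (δ.curveData p).reachable_glueWalk (⟨q.1.1, hw⟩ : δ.Winding) q.1.2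
      rw [show (δ.curveData p).glue = δ.glueEquiv from rfl, glueWalk_line _ _ q.2] at this
      exact (hR.trans (hall i _) (hfl (.inl (onFloor (leftVtx q.1.1))) (leftVtx q.1.1) rfl)).trans
        this
  obtain ⟨i⟩ := hc.nonempty
  exact SimpleGraph.connected_iff_exists_forall_reachable _ |>.2 ⟨_, hv i⟩

theorem graph_connected_of_curveData (hc : (δ.curveData p).gluedGraph.Connected) :
    δ.graph.Connected := by
  let φ : δ.Vtx ⊕ δ.Line → Fin n := Sum.elim onFloor fun q => q.1.1.1.1
  have hl : ∀ e : δ.Half, δ.graph.Reachable (onFloor (leftVtx e)) e.1.1 := by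
    intro e
    rw [onFloor_leftVtx]
    unfold start
    split_ifs
    · exact (graph_reachable_floor _ _).symm
    · exact .rfl
  have hr : ∀ e : δ.Half, δ.graph.Reachable (onFloor (rightVtx e)) e.1.1 := by
    intro e
    rw [onFloor_rightVtx]
    unfold finish
    split_ifs
    · exact .rfl
    · exact (graph_reachable_floor _ _).symm
  have hR : ∀ r, δ.graph.Reachable (φ ((δ.curveData p).rightBase r)) (rightSlot r).1.1.1.1 := by
    rintro (e | q)
    · exact hl e.1
    · exact .rfl
  have hL : ∀ r, δ.graph.Reachable (φ ((δ.curveData p).leftBase r)) (leftSlot r).1.1.1.1 := by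
    rintro (e | q)
    · exact hr e.1
    · exact .rfl
  have hedge : ∀ e : CurveEdge δ p, δ.graph.Reachable (onFloor e.tail) (onFloor e.head) := by
    rintro (q | e)
    · change δ.graph.Reachable (onFloor q.1.1) (onFloor q.1.2)
      rw [q.2.1]
    · exact (hl e.1).trans (hr e.1).symm
  have h1 : ∀ a b, ((∃ h, a = .inl ((δ.curveData p).vert h) ∧
      b = .inl ((δ.curveData p).vert ((δ.curveData p).opp h))) ∨
      ∃ r, a = (δ.curveData p).rightBase r ∧
        b = (δ.curveData p).leftBase ((δ.curveData p).glue r)) →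
      δ.graph.Reachable (φ a) (φ b) := by
    rintro a b (⟨⟨e, s⟩, rfl, rfl⟩ | ⟨r, rfl, rfl⟩)
    · cases s
      · exact (hedge e).symm
      · exact hedge e
    · refine (hR r).trans (.trans ?_ (hL _).symm)
      rw [show leftSlot ((δ.curveData p).glue r) = rightSlot r from δ.leftSlot_glueEquiv r]
  have h2 : ∀ a b, (δ.curveData p).gluedGraph.Adj a b → δ.graph.Reachable (φ a) (φ b) := by
    rintro a b ⟨-, hab | hab⟩
    · exact h1 a b hab
    · exact (h1 b a hab).symm
  have h3 : ∀ i j : Fin n, δ.graph.Reachable i j := fun i j =>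
    SimpleGraph.Reachable.of_adj_imp δ.graph.reachable_equivalence φ h2
      (hc.preconnected (.inl (.inl i : δ.Vtx)) (.inl (.inl j : δ.Vtx)))
  obtain ⟨x⟩ := hc.nonempty
  exact SimpleGraph.connected_iff_exists_forall_reachable _ |>.2 ⟨φ x, h3 _⟩

noncomputable instance : Fintype (δ.curveData p).Up := (δ.curveData p).fUp

noncomputable instance : Fintype (δ.curveData p).Dn := (δ.curveData p).fDn

variable (δ p) in
/-- The top vertex of a floor. -/
noncomputable def topVtx (i : Fin n) : δ.Vtx := (Admissible.exists_top (δ := δ) (p := p) i).choose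

theorem onFloor_topVtx (i : Fin n) : onFloor (topVtx δ p i) = i :=
  (Admissible.exists_top (δ := δ) (p := p) i).choose_spec.1

theorem not_below_topVtx (i : Fin n) (w : δ.Vtx) : ¬ Below p (topVtx δ p i) w :=
  (Admissible.exists_top (δ := δ) (p := p) i).choose_spec.2 w

theorem sum_up {M : Type*} [AddCommMonoid M] (h : δ.Admissible p) (F : δ.Vtx → M) :
    ∑ u : (δ.curveData p).Up, F ((δ.curveData p).upVert u) =
      ∑ i, if δ.wt i = 0 then F (topVtx δ p i) else 0 := by
  classical
  rw [← Finset.sum_filter]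
  refine Finset.sum_bij (fun u _ => onFloor u.1) (fun u _ => ?_) (fun u _ v _ huv => ?_)
    (fun i hi => ?_) fun u _ => ?_
  · simpa using u.2.1
  · exact Subtype.ext (h.top_unique huv u.2.2 v.2.2)
  · exact ⟨⟨topVtx δ p i, by rw [onFloor_topVtx]; simpa using hi, not_below_topVtx i⟩, mem_univ _,
      onFloor_topVtx i⟩
  · exact congrArg F (h.top_unique (onFloor_topVtx _).symm u.2.2 (not_below_topVtx _))

theorem card_up (h : δ.Admissible p) : Fintype.card (δ.curveData p).Up = #δ.whites := by
  have := sum_up h fun _ => 1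
  rw [← Finset.sum_filter] at this
  simpa [whites] using this

theorem card_dn (h : δ.Admissible p) : Fintype.card (δ.curveData p).Dn = #δ.whites := by
  classical
  rw [← Finset.card_univ]
  refine Finset.card_bij (fun u _ => onFloor u.1) (fun u _ => ?_) (fun u _ v _ huv => ?_)
    (fun i hi => ?_)
  · simpa using u.2.1
  · exact Subtype.ext (h.bottom_unique huv u.2.2 v.2.2)
  · obtain ⟨v, hv, hv'⟩ := Admissible.exists_bottom (δ := δ) (p := p) i
    exact ⟨⟨v, by rw [hv]; simpa using hi, hv'⟩, mem_univ _, hv⟩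

theorem curveData_leaks (h : δ.Admissible p) :
    (univ : Finset (δ.curveData p).Up).val.map (δ.curveData p).leak = δ.whites.val.map δ.leak := by
  have : (univ : Finset (δ.curveData p).Up).val.map
      (fun u => onFloor ((δ.curveData p).upVert u)) = δ.whites.val := by
    have h2 := sum_up h fun u => ({onFloor u} : Multiset (Fin n))
    simp only [onFloor_topVtx] at h2
    rw [← Finset.sum_filter, Finset.sum_multiset_singleton] at h2
    rw [show δ.whites.val = (univ.filter fun i => δ.wt i = 0).val from rfl, ← h2]
    refine (Multiset.sum_map_singleton _).symm.trans ?_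
    rw [Multiset.map_map]
    rfl
  rw [← this, Multiset.map_map]
  rfl

theorem sum_weights (p : Fin n → ℝ × ℝ) :
    (∑ l, ((δ.curveData p).lfWt l : ℤ)) + (∑ z, ((δ.curveData p).lineWt z : ℤ)) = δ.base := by
  have h1 := Fintype.sum_equiv (Equiv.ofBijective _ δ.leftSlot_bijective)
    (fun l => (δ.wt (leftSlot l).1.1.1.1 : ℤ)) (fun q => (δ.wt q.1.1.1.1 : ℤ)) fun _ => rfl
  rw [Fintype.sum_sum_type] at h1
  have h2 : ∑ q : δ.Slot, (δ.wt q.1.1.1.1 : ℤ) = δ.base := by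
    refine (Fintype.sum_equiv δ.slotEquiv _ (fun x => (δ.wt x.1.1.1 : ℤ)) fun _ => rfl).trans ?_
    rw [Fintype.sum_sigma]
    simp only [Finset.sum_const, Finset.card_univ, Fintype.card_fin, nsmul_eq_mul]
    rw [base, ← δ.sum_half _ (fun b s hb => by simp [hb])]
    exact Finset.sum_congr rfl fun e _ => mul_comm _ _
  rw [← h2, ← h1]
  rfl

theorem crossings_eq (h : δ.Admissible p) :
    {k : ℤ | ∃ a : ℝ, (∀ v, ((δ.curveData p).pos v).1 ≠ a) ∧ (δ.curveData p).crossing a = k} =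
      δ.degrees fun i => (p i).1 := by
  classical
  let x : Fin n → ℝ := fun i => (position p (topVtx δ p i)).1
  have hx : ∀ i j, (p i).1 < (p j).1 → x i < x j := by
    intro i j hij
    change δ.floorX p (onFloor (topVtx δ p i)) _ < δ.floorX p (onFloor (topVtx δ p j)) _
    rw [onFloor_topVtx, onFloor_topVtx]
    exact h.floorX_lt _ _ _ _ hij
  have hcross : ∀ a : ℝ, (∀ v, ((δ.curveData p).pos v).1 ≠ a) → (δ.curveData p).crossing a =
      δ.base - ∑ i ∈ univ.filter (fun i => x i < a), δ.leak i := by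
    intro a ha
    refine ((curveMap h).crossing_eq ha).trans ?_
    rw [← sum_weights p]
    refine congrArg₂ _ rfl ?_
    rw [Finset.sum_filter, Finset.sum_filter]
    refine (sum_up h fun v => if (position p v).1 < a then δ.leak (onFloor v) else 0).trans ?_
    refine Finset.sum_congr rfl fun i _ => ?_
    rw [onFloor_topVtx]
    split_ifs with h1 h2
    · rfl
    · rfl
    · exact (leak_black h1 h.wt_floor).symm
    · rfl
  ext k
  constructor
  · rintro ⟨a, ha, rfl⟩
    refine ⟨univ.filter (fun i => x i < a), fun i hi j hj => ?_, hcross a ha⟩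
    simp only [mem_filter, mem_univ, true_and] at hi ⊢
    exact (hx j i hj).trans hi
  · rintro ⟨S, hS, rfl⟩
    obtain ⟨a, ha, haS⟩ := exists_cut x S (fun i hi j hj => hx i j (by
      rcases lt_trichotomy (p i).1 (p j).1 with hlt | heq | hlt
      · exact hlt
      · exact absurd (h.fst_injective _ _ heq ▸ hi) hj
      · exact absurd (hS i hi j hlt) hj)) (univ.image fun v : δ.Vtx => (position p v).1)
    have ha' : ∀ v, ((δ.curveData p).pos v).1 ≠ a := fun v hv =>
      ha (mem_image.2 ⟨v, mem_univ _, hv⟩)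
    refine ⟨a, ha', ?_⟩
    rw [hcross a ha']
    congr 2
    ext i
    simp [haS]

theorem curveData_hasBidegree_iff (h : δ.Admissible p) {d₁ d₂ : ℕ} :
    (δ.curveData p).HasBidegree d₁ d₂ ↔
      #δ.whites = d₂ ∧ IsLeast (δ.degrees fun i => (p i).1) d₁ := by
  unfold CutData.HasBidegree
  rw [crossings_eq h, card_up h, card_dn h]
  tauto

theorem curveData_genus (h : δ.Admissible p) {d₂ g : ℕ} (hn : n + 1 = 2 * d₂ + g)
    (hw : #δ.whites = d₂) : (δ.curveData p).genus = g := by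
  have h1 := (curveMap h).two_mul_genus (curveData_trivalent h)
  have h2 : Fintype.card (curveMap h).Up = #δ.whites := card_up h
  have h3 : Fintype.card (curveMap h).Dn = #δ.whites := card_dn h
  have h4 : Fintype.card (curveMap h).V = n + Fintype.card δ.Half := by
    rw [show Fintype.card (curveMap h).V = Fintype.card (Fin n ⊕ δ.Half) from rfl,
      Fintype.card_sum, Fintype.card_fin]
  have h5 := δ.card_half
  have h6 := δ.card_black_add
  rw [h2, h3, h4] at h1
  change 2 * (δ.curveData p).genus = _ at h1
  omega

/-- The tropical stable map of a valid floor diagram is counted. -/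
noncomputable def countedMap {Δ : Multiset ℤ} {d₁ d₂ g : ℕ} (h : δ.Admissible p)
    (hv : δ.Valid (fun i => (p i).1) Δ d₁ d₂) (hn : n + 1 = 2 * d₂ + g) :
    CountedMap Δ d₁ d₂ g p where
  toCutStableMap := curveMap h
  leakyDegree := (curveData_leaks h).trans hv.leaky
  bidegree := (curveData_hasBidegree_iff h).2 ⟨hv.card_whites, hv.degree⟩
  connected := curveData_connected h hv.connected
  genus_eq := curveData_genus h hn hv.card_whites
  trivalent := curveData_trivalent h
  locallyEmbedded := curveData_locallyEmbedded h
  point := position_inl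

end FloorDiagram


/-! ### The shape of tropical stable maps through horizontally stretched points -/

/-- The assumptions on the point conditions. -/
structure WellStretched (Δ : Multiset ℤ) (d₁ d₂ g : ℕ) {n : ℕ} (p : Fin n → ℝ × ℝ) : Prop where
  pos : 0 < d₂
  card : n + 1 = 2 * d₂ + g
  snd_injective : ∀ i j, (p i).2 = (p j).2 → i = j
  stretched : HorizontallyStretched (8 * n * FloorDiagram.degreeBound Δ d₁) p

namespace CountedMap

variable {Δ : Multiset ℤ} {d₁ d₂ g n : ℕ} {p : Fin n → ℝ × ℝ} {X : CountedMap Δ d₁ d₂ g p}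

theorem markVert_injective (w : WellStretched Δ d₁ d₂ g p) : Function.Injective X.markVert := by
  intro i j h
  refine w.snd_injective i j ?_
  rw [← X.point, ← X.point, h]

theorem card_flagsAt_of_marked (w : WellStretched Δ d₁ d₂ g p) {v : X.V} (hv : X.Marked v) :
    #(X.flagsAt v) = 2 := by
  classical
  obtain ⟨i, rfl⟩ := hv
  have h := X.trivalent (X.markVert i)
  unfold CutData.valence at h
  have h1 : #(univ.filter fun j => X.markVert j = X.markVert i) = 1 := by
    rw [Finset.card_eq_one]
    refine ⟨i, ?_⟩
    ext j
    simp [(markVert_injective w).eq_iff]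
  have h2 : #(univ.filter fun j => X.markVert j = X.markVert i) = 1 := by convert h1
  omega

theorem card_flagsAt_of_not_marked {v : X.V} (hv : ¬ X.Marked v) : #(X.flagsAt v) = 3 := by
  classical
  have h := X.trivalent v
  unfold CutData.valence at h
  rw [Finset.card_eq_zero.2 (Finset.filter_eq_empty_iff.2 fun i _ hi => hv ⟨i, hi⟩)] at h
  exact h

theorem mem_flagsAt {v : X.V} {f : X.Flag} : f ∈ X.flagsAt v ↔ X.flagVert f = v :=
  X.toCutStableMap.mem_flagsAt

/-- The two flags at a marked vertex have opposite directions. -/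
theorem dir_add_of_marked (w : WellStretched Δ d₁ d₂ g p) {v : X.V} (hv : X.Marked v)
    {f f' : X.Flag} (hf : X.flagVert f = v) (hf' : X.flagVert f' = v) (hne : f ≠ f') :
    X.flagDir f + X.flagDir f' = 0 := by
  classical
  have h : X.flagsAt v = {f, f'} := by
    refine (Finset.eq_of_subset_of_card_le (fun x hx => ?_) ?_).symm
    · rcases mem_insert.1 hx with rfl | hx
      · exact mem_flagsAt.2 hf
      · rw [mem_singleton.1 hx]; exact mem_flagsAt.2 hf'
    · rw [card_flagsAt_of_marked w hv, Finset.card_pair hne]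
  rw [← X.balanced v, h, Finset.sum_pair hne]

theorem dir_add_of_not_marked {v : X.V} (hv : ¬ X.Marked v)
    {f f' f'' : X.Flag} (hf : X.flagVert f = v) (hf' : X.flagVert f' = v)
    (hf'' : X.flagVert f'' = v) (h1 : f ≠ f') (h2 : f ≠ f'') (h3 : f' ≠ f'') :
    X.flagDir f + (X.flagDir f' + X.flagDir f'') = 0 := by
  classical
  have hc : #({f, f', f''} : Finset X.Flag) = 3 := Finset.card_eq_three.2 ⟨_, _, _, h1, h2, h3, rfl⟩
  have h : X.flagsAt v = {f, f', f''} := by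
    refine (Finset.eq_of_subset_of_card_le (fun x hx => ?_) ?_).symm
    · simp only [mem_insert, mem_singleton] at hx
      rcases hx with rfl | rfl | rfl
      · exact mem_flagsAt.2 hf
      · exact mem_flagsAt.2 hf'
      · exact mem_flagsAt.2 hf''
    · rw [card_flagsAt_of_not_marked hv, hc]
  rw [← X.balanced v, h, Finset.sum_insert (by simp [h1, h2]), Finset.sum_pair h3]

/-- A proper subset of the glued graph which contains no end of direction `(0,-1)` is not
closed. -/
theorem false_of_closed (w : WellStretched Δ d₁ d₂ g p) {S : Set (X.V ⊕ X.Z)} (hne : S.Nonempty)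
    (hH : ∀ h, .inl (X.vert h) ∈ S → .inl (X.vert (X.opp h)) ∈ S)
    (hR : ∀ r, X.rightBase r ∈ S ↔ X.leftBase (X.glue r) ∈ S)
    (hD : ∀ d, .inl (X.dnVert d) ∉ S) : False := by
  have h := X.toCutStableMap.eq_univ_of_closed X.connected hne hH hR
  have hc : 0 < Fintype.card X.Dn := by rw [X.bidegree.1]; exact w.pos
  obtain ⟨d⟩ := Fintype.card_pos_iff.1 hc
  exact hD d (h ▸ Set.mem_univ _)

theorem exists_ne_flag (w : WellStretched Δ d₁ d₂ g p) (v : X.V) (f : X.Flag) : ∃ f', X.flagVert f' = v ∧ f' ≠ f := by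
  have hc : 1 < #(X.flagsAt v) := by
    by_cases hv : X.Marked v
    · rw [card_flagsAt_of_marked w hv]; norm_num
    · rw [card_flagsAt_of_not_marked hv]; norm_num
  obtain ⟨f', hf', hne⟩ := Finset.exists_mem_ne hc f
  exact ⟨f', mem_flagsAt.1 hf', hne⟩

theorem flagDir_ne_zero (w : WellStretched Δ d₁ d₂ g p) (f : X.Flag) : X.flagDir f ≠ 0 := by
  intro h0
  have hmark : ∀ f, X.flagDir f = 0 → X.Marked (X.flagVert f) := by
    intro f h0
    by_contra hv
    obtain ⟨f', hf', hne⟩ := exists_ne_flag w (X.flagVert f) f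
    refine X.locallyEmbedded _ hv f (mem_flagsAt.2 rfl) f' (mem_flagsAt.2 hf') hne.symm ?_
    rw [h0]
    exact SameRay.zero_left _
  rcases f with h | d | u | r | l
  · have h0' : X.dir h = 0 := h0
    have h1 : X.dir (X.opp h) = 0 := by rw [X.dir_opp, h0', neg_zero]
    obtain ⟨i, hi⟩ := hmark (.inl h) h0
    obtain ⟨j, hj⟩ := hmark (.inl (X.opp h)) h1
    change X.markVert i = X.vert h at hi
    change X.markVert j = X.vert (X.opp h) at hj
    have hij : j = i := by
      refine w.snd_injective _ _ ?_
      rw [← X.point, ← X.point, hi, hj, X.affine, h0']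
      simp
    subst hij
    have hall : ∀ f, X.flagVert f = X.vert h → f = .inl h ∨ f = .inl (X.opp h) := by
      intro f hf
      classical
      have hs : X.flagsAt (X.vert h) = {.inl h, .inl (X.opp h)} := by
        refine (Finset.eq_of_subset_of_card_le (fun x hx => ?_) ?_).symm
        · rcases mem_insert.1 hx with rfl | hx
          · exact mem_flagsAt.2 rfl
          · rw [mem_singleton.1 hx]; exact mem_flagsAt.2 (hj.symm.trans hi)
        · rw [card_flagsAt_of_marked w ⟨j, hi⟩, Finset.card_pair]
          exact fun h' => X.opp_ne h (Sum.inl_injective h').symm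
      have := mem_flagsAt.2 hf
      rw [hs] at this
      simpa using this
    refine false_of_closed w (S := {.inl (X.vert h)}) ⟨_, rfl⟩ (fun h' hh => ?_) (fun r => ?_)
      fun d hd => ?_
    · have hv : X.flagVert (.inl h') = X.vert h := Sum.inl_injective hh
      rcases hall _ hv with h2 | h2
      · rw [Sum.inl_injective h2]; exact congrArg Sum.inl (hj.symm.trans hi)
      · rw [Sum.inl_injective h2, X.opp_opp]; rfl
    · constructor
      · intro hr
        rcases r with r | z
        · have hv : X.flagVert (.inr (.inr (.inr (.inl r)))) = X.vert h := Sum.inl_injective hr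
          rcases hall _ hv with h2 | h2 <;> cases h2
        · cases hr
      · intro hr
        rcases hl : X.glue r with l | z <;> rw [hl] at hr
        · have hv : X.flagVert (.inr (.inr (.inr (.inr l)))) = X.vert h := Sum.inl_injective hr
          rcases hall _ hv with h2 | h2 <;> cases h2
        · cases hr
    · have hv : X.flagVert (.inr (.inl d)) = X.vert h := Sum.inl_injective hd
      rcases hall _ hv with h2 | h2 <;> cases h2
  · exact absurd (congrArg Prod.snd h0) (by simp [CutData.flagDir])
  · exact absurd (congrArg Prod.snd h0) (by simp [CutData.flagDir])
  · exact absurd (congrArg Prod.fst h0) (by simpa [CutData.flagDir] using (X.rtWt_pos r).ne')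
  · exact absurd (congrArg Prod.fst h0) (by simpa [CutData.flagDir] using (X.lfWt_pos l).ne')

theorem sameRay_of_horizontal {a b : ℤ × ℤ} (ha : a.2 = 0) (hb : b.2 = 0)
    (h : 0 < a.1 ∧ 0 < b.1 ∨ a.1 < 0 ∧ b.1 < 0) : SameRay ℤ a b := by
  obtain ⟨a1, a2⟩ := a
  obtain ⟨b1, b2⟩ := b
  simp only at ha hb h
  subst ha hb
  rcases h with ⟨h1, h2⟩ | ⟨h1, h2⟩
  · exact Or.inr (Or.inr ⟨b1, a1, h2, h1, by simp [mul_comm]⟩)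
  · exact Or.inr (Or.inr ⟨-b1, -a1, by omega, by omega, by simp [mul_comm]⟩)

theorem fst_ne_zero (w : WellStretched Δ d₁ d₂ g p) {f : X.Flag} (hf : (X.flagDir f).2 = 0) :
    (X.flagDir f).1 ≠ 0 := fun h => flagDir_ne_zero w f (Prod.ext h hf)

theorem horizontal_unique (w : WellStretched Δ d₁ d₂ g p) {v : X.V} (hv : ¬ X.Marked v)
    {f f' : X.Flag} (hf : X.flagVert f = v) (hf' : X.flagVert f' = v)
    (h : (X.flagDir f).2 = 0) (h' : (X.flagDir f').2 = 0) : f = f' := by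
  by_contra hne
  have hc : 2 < #(X.flagsAt v) := by rw [card_flagsAt_of_not_marked hv]; norm_num
  classical
  obtain ⟨f'', hf'', hne'⟩ : ∃ f'' ∈ X.flagsAt v, f'' ∉ ({f, f'} : Finset X.Flag) := by
    by_contra! hcon
    have := (Finset.card_le_card hcon).trans (Finset.card_le_two)
    omega
  simp only [mem_insert, mem_singleton, not_or] at hne'
  rw [mem_flagsAt] at hf''
  have hb := dir_add_of_not_marked hv hf hf' hf'' hne (Ne.symm hne'.1) (Ne.symm hne'.2)
  have hb1 := congrArg Prod.fst hb
  have hb2 := congrArg Prod.snd hb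
  simp only [Prod.fst_add, Prod.snd_add, Prod.fst_zero, Prod.snd_zero] at hb1 hb2
  have h'' : (X.flagDir f'').2 = 0 := by omega
  have n1 := fst_ne_zero w h
  have n2 := fst_ne_zero w h'
  have n3 := fst_ne_zero w h''
  have s1 : ¬ _ := fun hs => X.locallyEmbedded v hv f (mem_flagsAt.2 hf) f' (mem_flagsAt.2 hf') hne
    (sameRay_of_horizontal h h' hs)
  have s2 : ¬ _ := fun hs => X.locallyEmbedded v hv f (mem_flagsAt.2 hf) f'' (mem_flagsAt.2 hf'')
    (Ne.symm hne'.1) (sameRay_of_horizontal h h'' hs)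
  have s3 : ¬ _ := fun hs => X.locallyEmbedded v hv f' (mem_flagsAt.2 hf') f'' (mem_flagsAt.2 hf'')
    (Ne.symm hne'.2) (sameRay_of_horizontal h' h'' hs)
  omega

/-- Horizontal flags at a vertex pointing to the same side coincide. -/
theorem horizontal_ext (w : WellStretched Δ d₁ d₂ g p) {f f' : X.Flag}
    (hv : X.flagVert f = X.flagVert f') (h : (X.flagDir f).2 = 0) (h' : (X.flagDir f').2 = 0)
    (hs : 0 < (X.flagDir f).1 ↔ 0 < (X.flagDir f').1) : f = f' := by
  by_contra hne
  by_cases hm : X.Marked (X.flagVert f')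
  · have := congrArg Prod.fst (dir_add_of_marked w hm hv rfl hne)
    have n1 := fst_ne_zero w h
    have n2 := fst_ne_zero w h'
    simp only [Prod.fst_add, Prod.fst_zero] at this
    omega
  · exact hne (horizontal_unique w hm hv rfl h h')

variable (X) in
/-- The vertex `v` is adjacent to an edge which is not horizontal. -/
def Floored (v : X.V) : Prop := ∃ f, X.flagVert f = v ∧ (X.flagDir f).2 ≠ 0

theorem Floored.exists_up {v : X.V} (hv : X.Floored v) :
    ∃ f, X.flagVert f = v ∧ 0 < (X.flagDir f).2 := by
  by_contra! hcon
  obtain ⟨f, hf, hne⟩ := hv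
  have h := congrArg Prod.snd (X.balanced v)
  rw [Prod.snd_sum, Prod.snd_zero] at h
  have h2 := (Finset.sum_eq_zero_iff_of_nonpos fun f hf => hcon f (mem_flagsAt.1 hf)).1 h f
    (mem_flagsAt.2 hf)
  exact hne h2

theorem Floored.exists_down {v : X.V} (hv : X.Floored v) :
    ∃ f, X.flagVert f = v ∧ (X.flagDir f).2 < 0 := by
  by_contra! hcon
  obtain ⟨f, hf, hne⟩ := hv
  have h := congrArg Prod.snd (X.balanced v)
  rw [Prod.snd_sum, Prod.snd_zero] at h
  have h2 := (Finset.sum_eq_zero_iff_of_nonneg fun f hf => hcon f (mem_flagsAt.1 hf)).1 h f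
    (mem_flagsAt.2 hf)
  exact hne h2

theorem floored_of_not_marked (w : WellStretched Δ d₁ d₂ g p) {v : X.V} (hv : ¬ X.Marked v) :
    X.Floored v := by
  by_contra hcon
  have hc : 1 < #(X.flagsAt v) := by rw [card_flagsAt_of_not_marked hv]; norm_num
  obtain ⟨f, hf, f', hf', hne⟩ := Finset.one_lt_card.1 hc
  have hall : ∀ f ∈ X.flagsAt v, (X.flagDir f).2 = 0 := fun f hf => by
    by_contra h
    exact hcon ⟨f, mem_flagsAt.1 hf, h⟩
  exact hne (horizontal_unique w hv (mem_flagsAt.1 hf) (mem_flagsAt.1 hf') (hall f hf)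
    (hall f' hf'))

/-- A marked vertex with a horizontal flag has only horizontal flags. -/
theorem not_floored_of_horizontal (w : WellStretched Δ d₁ d₂ g p) {v : X.V} (hv : X.Marked v)
    {f : X.Flag} (hf : X.flagVert f = v) (h : (X.flagDir f).2 = 0) : ¬ X.Floored v := by
  rintro ⟨f', hf', h'⟩
  by_cases hne : f = f'
  · exact h' (hne ▸ h)
  · have := congrArg Prod.snd (dir_add_of_marked w hv hf hf' hne)
    simp only [Prod.snd_add, Prod.snd_zero] at this
    omega

theorem card_V (w : WellStretched Δ d₁ d₂ g p) : Fintype.card X.V + 2 * d₂ = 3 * n := by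
  have h := X.toCutStableMap.two_mul_genus X.trivalent
  have h1 := X.genus_eq
  have h2 : Fintype.card X.Dn = d₂ := X.bidegree.1
  have h3 : Fintype.card X.Up = d₂ := X.bidegree.2.1
  have h4 := w.card
  have h5 := w.pos
  rw [h1, h2, h3] at h
  omega

end CountedMap


namespace CutStableMap

variable {n : ℕ} (C : CutStableMap n)

/-- The flag `f` points upwards and leaves the set of vertices `S`. -/
def IsExit (S : C.V → Prop) (f : C.Flag) : Prop :=
  S (C.flagVert f) ∧ 0 < (C.flagDir f).2 ∧ ∀ h, f = .inl h → ¬ S (C.vert (C.opp h))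

open Classical in
/-- The flow through a set of vertices which can only be left upwards. -/
theorem card_isExit_le (S : C.V → Prop)
    (hS : ∀ h, S (C.vert h) → ¬ S (C.vert (C.opp h)) → 0 ≤ (C.dir h).2) :
    #(univ.filter fun f => C.IsExit S f) ≤ #(univ.filter fun d => S (C.dnVert d)) := by
  have h := congrArg Prod.snd (C.cut_sum S)
  simp only [Prod.snd_add, Prod.snd_sum, Prod.snd_zero, apply_ite Prod.snd, ite_self,
    Finset.sum_const_zero, add_zero] at h
  have h1 : (#(univ.filter fun f => C.IsExit S f) : ℤ) ≤
      (∑ h, if S (C.vert h) ∧ ¬ S (C.vert (C.opp h)) then (C.dir h).2 else 0) +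
      ∑ u, if S (C.upVert u) then 1 else 0 := by
    rw [Finset.card_filter, Nat.cast_sum, Fintype.sum_sum_type, Fintype.sum_sum_type,
      Fintype.sum_sum_type, Fintype.sum_sum_type]
    have z1 : ∑ d : C.Dn, ((if C.IsExit S (.inr (.inl d)) then 1 else 0 : ℕ) : ℤ) = 0 :=
      Finset.sum_eq_zero fun d _ => by
        rw [if_neg fun hx => by simpa [CutData.flagDir] using hx.2.1]; rfl
    have z2 : ∑ d : C.Rt, ((if C.IsExit S (.inr (.inr (.inr (.inl d)))) then 1 else 0 : ℕ) : ℤ) = 0 :=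
      Finset.sum_eq_zero fun d _ => by
        rw [if_neg fun hx => by simpa [CutData.flagDir] using hx.2.1]; rfl
    have z3 : ∑ d : C.Lf, ((if C.IsExit S (.inr (.inr (.inr (.inr d)))) then 1 else 0 : ℕ) : ℤ) = 0 :=
      Finset.sum_eq_zero fun d _ => by
        rw [if_neg fun hx => by simpa [CutData.flagDir] using hx.2.1]; rfl
    rw [z1, z2, z3, zero_add, add_zero, add_zero]
    refine add_le_add (Finset.sum_le_sum fun h _ => ?_) (Finset.sum_le_sum fun u _ => ?_)
    · by_cases hx : C.IsExit S (.inl h)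
      · have h2 : 0 < (C.dir h).2 := hx.2.1
        rw [if_pos hx, if_pos ⟨hx.1, hx.2.2 h rfl⟩]
        exact_mod_cast h2
      · rw [if_neg hx]
        split_ifs with h2
        · exact_mod_cast hS h h2.1 h2.2
        · simp
    · by_cases hx : C.IsExit S (.inr (.inr (.inl u)))
      · rw [if_pos hx, if_pos (show S (C.upVert u) from hx.1)]; simp
      · rw [if_neg hx]
        split_ifs <;> simp
  have h2 : (∑ d, if S (C.dnVert d) then (-1 : ℤ) else 0) =
      -(#(univ.filter fun d => S (C.dnVert d)) : ℤ) := by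
    rw [← Finset.sum_filter, Finset.sum_const, nsmul_eq_mul, mul_neg, mul_one]
  rw [h2] at h
  have : (#(univ.filter fun f => C.IsExit S f) : ℤ) ≤ #(univ.filter fun d => S (C.dnVert d)) := by
    linarith
  exact_mod_cast this

/-- The directions of the horizontal flags at a given height sum up to zero. -/
theorem sum_horizontal (y : ℝ) : ∑ f, (if (C.pos (C.flagVert f)).2 = y then
    (if (C.flagDir f).2 = 0 then (C.flagDir f).1 else 0) else 0) = 0 := by
  classical
  rw [Fintype.sum_sum_type, Fintype.sum_sum_type, Fintype.sum_sum_type, Fintype.sum_sum_type]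
  have z1 : ∑ h : C.H, (if (C.pos (C.flagVert (.inl h))).2 = y then
      (if (C.flagDir (.inl h)).2 = 0 then (C.flagDir (.inl h)).1 else 0) else 0) = 0 := by
    have key : ∀ h : C.H, (if (C.pos (C.flagVert (.inl h))).2 = y then
        (if (C.flagDir (.inl h)).2 = 0 then (C.flagDir (.inl h)).1 else 0) else 0) =
        if (C.dir h).2 = 0 ∧ (C.pos (C.vert h)).2 = y then (C.dir h).1 else 0 := by
      intro h
      simp only [CutData.flagVert, CutData.flagDir]
      by_cases h1 : (C.pos (C.vert h)).2 = y <;> by_cases h2 : (C.dir h).2 = 0 <;> simp [h1, h2]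
    simp only [key]
    have hopp : ∀ h, (C.dir h).2 = 0 → (C.pos (C.vert (C.opp h))).2 = (C.pos (C.vert h)).2 := by
      intro h hh
      rw [C.affine, hh]
      simp
    refine Finset.sum_involution (fun h _ => C.opp h) (fun h _ => ?_) (fun h _ _ => C.opp_ne h)
      (fun h _ => Finset.mem_univ _) (fun h _ => C.opp_opp h)
    rw [C.dir_opp]
    simp only [Prod.snd_neg, Prod.fst_neg, neg_eq_zero]
    by_cases h1 : (C.dir h).2 = 0
    · rw [hopp h h1]
      split_ifs <;> simp
    · simp [h1]
  have z2 : ∑ d : C.Dn, (if (C.pos (C.flagVert (.inr (.inl d)))).2 = y then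
      (if (C.flagDir (.inr (.inl d))).2 = 0 then (C.flagDir (.inr (.inl d))).1 else 0) else 0) = 0 :=
    Finset.sum_eq_zero fun d _ => by simp [CutData.flagDir]
  have z3 : ∑ d : C.Up, (if (C.pos (C.flagVert (.inr (.inr (.inl d))))).2 = y then
      (if (C.flagDir (.inr (.inr (.inl d)))).2 = 0 then
        (C.flagDir (.inr (.inr (.inl d)))).1 else 0) else 0) = 0 :=
    Finset.sum_eq_zero fun d _ => by simp [CutData.flagDir]
  rw [z1, z2, z3, zero_add, zero_add, zero_add]
  have h1 := Equiv.sum_comp C.glue fun l => if C.leftY l = y then (C.leftWt l : ℤ) else 0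
  simp only [C.glue_y, C.glue_wt] at h1
  rw [Fintype.sum_sum_type, Fintype.sum_sum_type] at h1
  have h2 : (∑ l : C.Lf, (if (C.pos (C.flagVert (.inr (.inr (.inr (.inr l)))))).2 = y then
      (if (C.flagDir (.inr (.inr (.inr (.inr l))))).2 = 0 then
        (C.flagDir (.inr (.inr (.inr (.inr l))))).1 else 0) else 0)) =
      -∑ l : C.Lf, if C.leftY (.inl l) = y then (C.leftWt (.inl l) : ℤ) else 0 := by
    rw [← Finset.sum_neg_distrib]
    refine Finset.sum_congr rfl fun l _ => ?_
    by_cases h1 : (C.pos (C.lfVert l)).2 = y <;>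
      simp [CutData.flagDir, CutData.flagVert, CutData.leftY, CutData.leftWt, h1]
  have h3 : (∑ l : C.Rt, (if (C.pos (C.flagVert (.inr (.inr (.inr (.inl l)))))).2 = y then
      (if (C.flagDir (.inr (.inr (.inr (.inl l))))).2 = 0 then
        (C.flagDir (.inr (.inr (.inr (.inl l))))).1 else 0) else 0)) =
      ∑ l : C.Rt, if C.rightY (.inl l) = y then (C.rightWt (.inl l) : ℤ) else 0 := by
    refine Finset.sum_congr rfl fun l _ => ?_
    by_cases h1 : (C.pos (C.rtVert l)).2 = y <;>
      simp [CutData.flagDir, CutData.flagVert, CutData.rightY, CutData.rightWt, h1]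
  rw [h2, h3]
  have h4 : ∑ z : C.Z, (if C.rightY (.inr z) = y then (C.rightWt (.inr z) : ℤ) else 0) =
      ∑ z : C.Z, if C.leftY (.inr z) = y then (C.leftWt (.inr z) : ℤ) else 0 := rfl
  linarith

end CutStableMap

namespace CountedMap

variable {Δ : Multiset ℤ} {d₁ d₂ g n : ℕ} {p : Fin n → ℝ × ℝ} {X : CountedMap Δ d₁ d₂ g p}

theorem _root_.WellStretched.lt (w : WellStretched Δ d₁ d₂ g p) {i j : Fin n} (hij : i ≠ j)
    (k l : Fin n) :
    8 * (FloorDiagram.degreeBound Δ d₁ : ℝ) * |(p k).2 - (p l).2| < |(p i).1 - (p j).1| := by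
  refine lt_of_le_of_lt ?_ (w.stretched i j hij k l)
  have h1 : (1 : ℝ) ≤ n := by
    have := w.card
    have := w.pos
    exact_mod_cast (by omega : 1 ≤ n)
  refine mul_le_mul_of_nonneg_right ?_ (abs_nonneg _)
  have h2 : (0 : ℝ) ≤ FloorDiagram.degreeBound Δ d₁ := Nat.cast_nonneg _
  nlinarith

theorem _root_.WellStretched.exists_highest (w : WellStretched Δ d₁ d₂ g p) :
    ∃ t, ∀ i, (p i).2 ≤ (p t).2 := by
  have h1 : 0 < n := by
    have := w.card
    have := w.pos
    omega
  have : Nonempty (Fin n) := ⟨⟨0, h1⟩⟩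
  obtain ⟨t, -, ht⟩ := Finset.exists_max_image univ (fun i => (p i).2) univ_nonempty
  exact ⟨t, fun i => ht i (mem_univ _)⟩

/-- The `x`-coordinate varies slowly along an edge which is not horizontal. -/
theorem abs_fst_sub_le {h : X.H} (hh : (X.dir h).2 ≠ 0) :
    |(X.pos (X.vert (X.opp h))).1 - (X.pos (X.vert h)).1| ≤
      FloorDiagram.degreeBound Δ d₁ * |(X.pos (X.vert (X.opp h))).2 - (X.pos (X.vert h)).2| := by
  have h1 : |((X.dir h).1 : ℝ)| ≤ FloorDiagram.degreeBound Δ d₁ := by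
    exact_mod_cast CutStableMap.abs_dir_le X.leakyDegree X.bidegree h
  have h2 : (1 : ℝ) ≤ |((X.dir h).2 : ℝ)| := by
    exact_mod_cast Int.one_le_abs hh
  have h3 := X.len_pos h
  have h4 : (0 : ℝ) ≤ FloorDiagram.degreeBound Δ d₁ := Nat.cast_nonneg _
  rw [X.affine]
  simp only [Prod.fst_add, Prod.snd_add, add_sub_cancel_left, abs_mul, abs_of_pos h3]
  calc X.len h * |((X.dir h).1 : ℝ)| ≤ X.len h * FloorDiagram.degreeBound Δ d₁ := by gcongr
    _ ≤ (X.len h * FloorDiagram.degreeBound Δ d₁) * |((X.dir h).2 : ℝ)| :=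
      le_mul_of_one_le_right (mul_nonneg h3.le h4) h2
    _ = _ := by ring

/-- Going up along the edges which are not horizontal. -/
theorem exists_exit {v : X.V} (hv : X.Floored v) {Y : ℝ} (hY : (X.pos v).2 ≤ Y) :
    ∃ f, X.IsExit (fun u => (X.pos u).2 ≤ Y) f ∧ |(X.pos (X.flagVert f)).1 - (X.pos v).1| ≤
      FloorDiagram.degreeBound Δ d₁ * (Y - (X.pos v).2) := by
  classical
  set K : ℝ := (FloorDiagram.degreeBound Δ d₁ : ℝ) with hK
  have hK0 : 0 ≤ K := Nat.cast_nonneg _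
  obtain ⟨u, hu, hmax⟩ := Finset.exists_max_image (univ.filter fun u => X.Floored u ∧
    (X.pos v).2 ≤ (X.pos u).2 ∧ (X.pos u).2 ≤ Y ∧
    |(X.pos u).1 - (X.pos v).1| ≤ K * ((X.pos u).2 - (X.pos v).2)) (fun u => (X.pos u).2)
    ⟨v, by simp [hv, hY]⟩
  simp only [mem_filter, mem_univ, true_and] at hu hmax
  obtain ⟨hu1, hu2, hu3, hu4⟩ := hu
  obtain ⟨f, rfl, hf⟩ := hu1.exists_up
  refine ⟨f, ⟨hu3, hf, ?_⟩, hu4.trans (by gcongr)⟩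
  rintro h rfl hY'
  have hd : 0 < (X.dir h).2 := hf
  have hlt := X.lt_of_dir_snd_pos hd
  have hx := abs_fst_sub_le hd.ne'
  rw [abs_of_pos (sub_pos.2 hlt)] at hx
  refine absurd (hmax (X.vert (X.opp h)) ⟨⟨.inl (X.opp h), rfl, ?_⟩, hu2.trans hlt.le, hY', ?_⟩)
    (not_le.2 hlt)
  · change (X.dir (X.opp h)).2 ≠ 0
    rw [X.dir_opp]
    simpa using hd.ne'
  · have : X.flagVert (.inl h) = X.vert h := rfl
    rw [this] at hu4
    calc _ ≤ _ := abs_sub_le _ (X.pos (X.vert h)).1 _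
      _ ≤ _ := add_le_add hx hu4
      _ = _ := by ring

variable (X) in
open Classical in
/-- The points on floors. -/
noncomputable def whites : Finset (Fin n) := univ.filter fun i => X.Floored (X.markVert i)

@[simp] theorem mem_whites {i : Fin n} : i ∈ X.whites ↔ X.Floored (X.markVert i) := by
  simp [whites]

theorem exits_card_le (Y : ℝ) :
    Set.ncard {f | X.IsExit (fun u => (X.pos u).2 ≤ Y) f} ≤ d₂ := by
  classical
  rw [Set.ncard_eq_toFinset_card', Set.toFinset_ofPred]
  refine (X.card_isExit_le _ fun h h1 h2 => ?_).trans ((Finset.card_filter_le _ _).trans ?_)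
  · exact (X.dir_snd_pos_of_lt (h1.trans_lt (not_le.1 h2))).le
  · exact X.bidegree.1.le

/-- The exits from different points are different. -/
theorem exit_injective (w : WellStretched Δ d₁ d₂ g p) {t i j : Fin n} (ht : ∀ i, (p i).2 ≤ (p t).2)
    {x : ℝ} (hi : |x - (p i).1| ≤ FloorDiagram.degreeBound Δ d₁ * ((p t).2 - (p i).2))
    (hj : |x - (p j).1| ≤ FloorDiagram.degreeBound Δ d₁ * ((p t).2 - (p j).2)) : i = j := by
  by_contra hij
  have h1 := w.lt hij t i
  have h2 := w.lt hij t j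
  rw [abs_of_nonneg (sub_nonneg.2 (ht _))] at h1 h2
  have h3 : |(p i).1 - (p j).1| ≤ |x - (p i).1| + |x - (p j).1| := by
    rw [abs_sub_comm x (p i).1]
    exact abs_sub_le _ _ _
  have h4 := abs_nonneg (x - (p i).1)
  have h5 := abs_nonneg (x - (p j).1)
  linarith

/-- The floors through different points reach the top through different exits. -/
theorem exists_injective_exit (w : WellStretched Δ d₁ d₂ g p) {t : Fin n}
    (ht : ∀ i, (p i).2 ≤ (p t).2) :
    ∃ f : X.whites → {f | X.IsExit (fun u => (X.pos u).2 ≤ (p t).2) f}, Function.Injective f ∧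
      ∀ i, |(X.pos (X.flagVert (f i).1)).1 - (p i).1| ≤
        FloorDiagram.degreeBound Δ d₁ * ((p t).2 - (p i).2) := by
  have : ∀ i : X.whites, ∃ f, X.IsExit (fun u => (X.pos u).2 ≤ (p t).2) f ∧
      |(X.pos (X.flagVert f)).1 - (p i).1| ≤
        FloorDiagram.degreeBound Δ d₁ * ((p t).2 - (p i).2) := by
    rintro ⟨i, hi⟩
    have := exists_exit (mem_whites.1 hi) (Y := (p t).2) (by rw [X.point]; exact ht i)
    rwa [X.point] at this
  choose f hf hx using this
  have hinj : Function.Injective fun i => (⟨f i, hf i⟩ : {f | X.IsExit (fun u =>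
      (X.pos u).2 ≤ (p t).2) f}) := by
    intro i j hij
    have hij' : f i = f j := congrArg Subtype.val hij
    have h2 := hx j
    rw [← hij'] at h2
    exact Subtype.ext (exit_injective w ht (hx i) h2)
  exact ⟨_, hinj, hx⟩

theorem card_whites_le (w : WellStretched Δ d₁ d₂ g p) : #X.whites ≤ d₂ := by
  classical
  obtain ⟨t, ht⟩ := w.exists_highest
  obtain ⟨f, hinj, hx⟩ := exists_injective_exit (X := X) w ht
  have := Nat.card_le_card_of_injective _ hinj
  rw [Nat.card_eq_fintype_card, Fintype.card_coe, Nat.card_coe_set_eq] at this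
  exact this.trans (exits_card_le _)

/-- At the height of a point which is not on a floor, there are elevator ends at floors on both
sides. -/
theorem exists_end (w : WellStretched Δ d₁ d₂ g p) {i : Fin n} (hi : i ∉ X.whites) {ε : ℤ}
    (hε : ε = 1 ∨ ε = -1) : ∃ f, ¬ X.Marked (X.flagVert f) ∧ (X.pos (X.flagVert f)).2 = (p i).2 ∧
      (X.flagDir f).2 = 0 ∧ 0 < ε * (X.flagDir f).1 := by
  classical
  by_contra! hcon
  rw [mem_whites] at hi
  have hm : ∀ v, X.Marked v → (X.pos v).2 = (p i).2 → v = X.markVert i := by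
    rintro _ ⟨j, rfl⟩ h
    rw [X.point] at h
    rw [w.snd_injective _ _ h]
  have hblack : ∀ f, X.flagVert f = X.markVert i → (X.flagDir f).2 = 0 := fun f hf => by
    by_contra h
    exact hi ⟨f, hf, h⟩
  have hsum := X.sum_flags (fun v => (X.pos v).2 = (p i).2)
    fun f => ε * if (X.flagDir f).2 = 0 then (X.flagDir f).1 else 0
  have h0 : ∑ f, (if (X.pos (X.flagVert f)).2 = (p i).2 then
      ε * (if (X.flagDir f).2 = 0 then (X.flagDir f).1 else 0) else 0) = 0 := by
    refine Eq.trans ?_ ((congrArg (ε * ·) (X.sum_horizontal (p i).2)).trans (mul_zero ε))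
    simp only [Finset.mul_sum]
    refine Finset.sum_congr rfl fun f _ => ?_
    by_cases h1 : (X.pos (X.flagVert f)).2 = (p i).2 <;> simp [h1]
  rw [h0] at hsum
  have hterm : ∀ v, ¬ X.Marked v → (X.pos v).2 = (p i).2 → ∀ f ∈ X.flagsAt v,
      ε * (if (X.flagDir f).2 = 0 then (X.flagDir f).1 else 0) ≤ 0 := by
    intro v hv hy f hf
    obtain rfl := mem_flagsAt.1 hf
    split_ifs with h
    · exact hcon f hv hy h
    · simp
  have hle : ∀ v ∈ (univ : Finset X.V), (if (X.pos v).2 = (p i).2 then ∑ f ∈ X.flagsAt v,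
      ε * (if (X.flagDir f).2 = 0 then (X.flagDir f).1 else 0) else 0) ≤ 0 := by
    intro v _
    split_ifs with hy
    · by_cases hv : X.Marked v
      · obtain rfl := hm v hv hy
        have : ∑ f ∈ X.flagsAt (X.markVert i),
            ε * (if (X.flagDir f).2 = 0 then (X.flagDir f).1 else 0) =
            ε * (∑ f ∈ X.flagsAt (X.markVert i), X.flagDir f).1 := by
          rw [Prod.fst_sum, Finset.mul_sum]
          exact Finset.sum_congr rfl fun f hf => by rw [if_pos (hblack f (mem_flagsAt.1 hf))]
        rw [this, X.balanced]
        simp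
      · exact Finset.sum_nonpos (hterm v hv hy)
    · exact le_rfl
  have hzero := (Finset.sum_eq_zero_iff_of_nonpos hle).1 hsum
  have hnone : ∀ f, (X.pos (X.flagVert f)).2 = (p i).2 → (X.flagDir f).2 = 0 →
      X.flagVert f = X.markVert i := by
    intro f hy hf
    by_contra hne
    have hv : ¬ X.Marked (X.flagVert f) := fun hv => hne (hm _ hv hy)
    have h1 := hzero (X.flagVert f) (mem_univ _)
    rw [if_pos hy] at h1
    have h2 := (Finset.sum_eq_zero_iff_of_nonpos (hterm _ hv hy)).1 h1 f (mem_flagsAt.2 rfl)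
    rw [if_pos hf] at h2
    have h3 := fst_ne_zero w hf
    rcases hε with rfl | rfl <;> omega
  have hmy : (X.pos (X.markVert i)).2 = (p i).2 := by rw [X.point]
  have hR : ∀ r, X.rightBase r ∈ ({.inl (X.markVert i)} ∪ .inr '' {z | X.lineY z = (p i).2} :
      Set (X.V ⊕ X.Z)) ↔ X.rightY r = (p i).2 := by
    rintro (r | z)
    · constructor
      · rintro (h | ⟨z, -, h⟩)
        · have h' : X.rtVert r = X.markVert i := Sum.inl_injective h
          change (X.pos (X.rtVert r)).2 = _
          rw [h', hmy]
        · cases h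
      · intro h
        exact Or.inl (congrArg Sum.inl (hnone (.inr (.inr (.inr (.inl r)))) h rfl))
    · constructor
      · rintro (h | ⟨z', h', h⟩)
        · cases h
        · obtain rfl := Sum.inr_injective h
          exact h'
      · intro h
        exact Or.inr ⟨z, h, rfl⟩
  have hL : ∀ r, X.leftBase r ∈ ({.inl (X.markVert i)} ∪ .inr '' {z | X.lineY z = (p i).2} :
      Set (X.V ⊕ X.Z)) ↔ X.leftY r = (p i).2 := by
    rintro (r | z)
    · constructor
      · rintro (h | ⟨z, -, h⟩)
        · have h' : X.lfVert r = X.markVert i := Sum.inl_injective h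
          change (X.pos (X.lfVert r)).2 = _
          rw [h', hmy]
        · cases h
      · intro h
        exact Or.inl (congrArg Sum.inl (hnone (.inr (.inr (.inr (.inr r)))) h rfl))
    · constructor
      · rintro (h | ⟨z', h', h⟩)
        · cases h
        · obtain rfl := Sum.inr_injective h
          exact h'
      · intro h
        exact Or.inr ⟨z, h, rfl⟩
  refine false_of_closed w (S := {.inl (X.markVert i)} ∪ .inr '' {z | X.lineY z = (p i).2})
    ⟨_, Or.inl rfl⟩ (fun h hh => ?_) (fun r => ?_) fun d hd => ?_
  · rcases hh with hh | ⟨z, -, hh⟩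
    · have h1 : X.vert h = X.markVert i := Sum.inl_injective hh
      have h2 : (X.dir h).2 = 0 := hblack (.inl h) h1
      refine Or.inl (congrArg Sum.inl (hnone (.inl (X.opp h)) ?_ ?_))
      · change (X.pos (X.vert (X.opp h))).2 = _
        rw [X.affine, h1, h2, ← hmy]
        simp
      · change (X.dir (X.opp h)).2 = 0
        rw [X.dir_opp]
        simpa using h2
    · cases hh
  · rw [hR, hL, X.glue_y]
  · rcases hd with hd | ⟨z, -, hd⟩
    · have h1 : X.dnVert d = X.markVert i := Sum.inl_injective hd
      have := hblack (.inr (.inl d)) h1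
      simp [CutData.flagDir] at this
    · cases hd

end CountedMap


namespace CountedMap

variable {Δ : Multiset ℤ} {d₁ d₂ g n : ℕ} {p : Fin n → ℝ × ℝ} {X : CountedMap Δ d₁ d₂ g p}

/-- The horizontal flag at the end of a half elevator at a floor. -/
noncomputable def endFlag (w : WellStretched Δ d₁ d₂ g p) (e : {i // i ∉ X.whites} × Bool) :
    X.Flag :=
  (exists_end w e.1.2 (ε := if e.2 then 1 else -1) (by split_ifs <;> simp)).choose

/-- The end of a half elevator at a floor. -/
noncomputable def endVtx (w : WellStretched Δ d₁ d₂ g p) (e : {i // i ∉ X.whites} × Bool) : X.V :=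
  X.flagVert (endFlag w e)

section

variable (w : WellStretched Δ d₁ d₂ g p) (e : {i // i ∉ X.whites} × Bool)

theorem not_marked_endVtx : ¬ X.Marked (endVtx w e) :=
  (exists_end w e.1.2 (ε := if e.2 then 1 else -1) (by split_ifs <;> simp)).choose_spec.1

theorem endVtx_snd : (X.pos (endVtx w e)).2 = (p e.1.1).2 :=
  (exists_end w e.1.2 (ε := if e.2 then 1 else -1) (by split_ifs <;> simp)).choose_spec.2.1

theorem endFlag_snd : (X.flagDir (endFlag w e)).2 = 0 :=
  (exists_end w e.1.2 (ε := if e.2 then 1 else -1) (by split_ifs <;> simp)).choose_spec.2.2.1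

theorem endFlag_fst : 0 < (if e.2 then 1 else -1) * (X.flagDir (endFlag w e)).1 :=
  (exists_end w e.1.2 (ε := if e.2 then 1 else -1) (by split_ifs <;> simp)).choose_spec.2.2.2

end

theorem endFlag_fst_pos_iff (w : WellStretched Δ d₁ d₂ g p) (e : {i // i ∉ X.whites} × Bool) :
    0 < (X.flagDir (endFlag w e)).1 ↔ e.2 = true := by
  have := endFlag_fst w e
  rcases hs : e.2 with _ | _ <;> simp only [hs] at this <;> simp at this ⊢ <;> omega

theorem endVtx_injective (w : WellStretched Δ d₁ d₂ g p) :
    Function.Injective (endVtx (X := X) w) := by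
  intro e e' h
  have h1 : e.1.1 = e'.1.1 := by
    refine w.snd_injective _ _ ?_
    rw [← endVtx_snd w e, ← endVtx_snd w e', h]
  have h2 : endFlag w e = endFlag w e' :=
    horizontal_unique w (not_marked_endVtx w e') h rfl (endFlag_snd w e) (endFlag_snd w e')
  have h3 : e.2 = true ↔ e'.2 = true := by
    rw [← endFlag_fst_pos_iff w, ← endFlag_fst_pos_iff w, h2]
  exact Prod.ext (Subtype.ext h1) (Bool.eq_iff_iff.2 h3)

theorem card_not_marked (w : WellStretched Δ d₁ d₂ g p) :
    Nat.card {v // ¬ X.Marked v} + 2 * d₂ = 2 * n := by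
  classical
  have h1 := card_V (X := X) w
  have h2 := Fintype.card_subtype_compl X.Marked
  have h3 : Fintype.card {v // X.Marked v} = n := by
    rw [← Nat.card_eq_fintype_card]
    exact (Nat.card_congr (Equiv.ofInjective _ (markVert_injective (X := X) w))).symm.trans
      (Nat.card_fin n)
  have h4 : Fintype.card {v // X.Marked v} ≤ Fintype.card X.V := Fintype.card_subtype_le _
  rw [Nat.card_eq_fintype_card, h2, h3]
  omega

theorem card_elevator_ends : Fintype.card ({i // i ∉ X.whites} × Bool) = 2 * (n - #X.whites) := by
  rw [Fintype.card_prod, Fintype.card_bool, mul_comm]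
  congr 1
  rw [Fintype.card_subtype_compl, Fintype.card_fin, Fintype.card_coe]

theorem card_whites (w : WellStretched Δ d₁ d₂ g p) : #X.whites = d₂ := by
  have h1 := card_not_marked (X := X) w
  have h2 := Nat.card_le_card_of_injective
    (fun e => (⟨endVtx w e, not_marked_endVtx w e⟩ : {v // ¬ X.Marked v}))
    fun e e' h => endVtx_injective w (congrArg Subtype.val h)
  rw [Nat.card_eq_fintype_card, card_elevator_ends] at h2
  have h3 := card_whites_le (X := X) w
  have h4 := Finset.card_le_univ X.whites
  rw [Fintype.card_fin] at h4
  omega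

/-- Every vertex which is not marked is the end of a half elevator. -/
theorem exists_endVtx_eq (w : WellStretched Δ d₁ d₂ g p) {v : X.V} (hv : ¬ X.Marked v) :
    ∃ e, endVtx w e = v := by
  have hbij := (Nat.bijective_iff_injective_and_card
    (fun e => (⟨endVtx w e, not_marked_endVtx w e⟩ : {v // ¬ X.Marked v}))).2
    ⟨fun e e' h => endVtx_injective w (congrArg Subtype.val h), by
      have h1 := card_not_marked (X := X) w
      rw [Nat.card_eq_fintype_card, card_elevator_ends, card_whites w]
      omega⟩
  obtain ⟨e, he⟩ := hbij.2 ⟨v, hv⟩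
  exact ⟨e, congrArg Subtype.val he⟩

theorem exists_height_eq (w : WellStretched Δ d₁ d₂ g p) (v : X.V) :
    ∃ i, (X.pos v).2 = (p i).2 := by
  by_cases hv : X.Marked v
  · obtain ⟨i, rfl⟩ := hv
    exact ⟨i, by rw [X.point]⟩
  · obtain ⟨e, rfl⟩ := exists_endVtx_eq w hv
    exact ⟨_, endVtx_snd w e⟩

/-! ### Floors -/

theorem vertical_ext (w : WellStretched Δ d₁ d₂ g p) {f f' : X.Flag}
    (hv : X.flagVert f = X.flagVert f') (h : (X.flagDir f).2 ≠ 0) (h' : (X.flagDir f').2 ≠ 0)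
    (hs : 0 < (X.flagDir f).2 ↔ 0 < (X.flagDir f').2) : f = f' := by
  by_contra hne
  by_cases hm : X.Marked (X.flagVert f')
  · have := congrArg Prod.snd (dir_add_of_marked w hm hv rfl hne)
    simp only [Prod.snd_add, Prod.snd_zero] at this
    omega
  · obtain ⟨e, he⟩ := exists_endVtx_eq w hm
    have h0 := endFlag_snd w e
    have := congrArg Prod.snd (dir_add_of_not_marked hm hv rfl he hne
      (fun h1 => h (h1 ▸ h0)) (fun h1 => h' (h1 ▸ h0)))
    simp only [Prod.snd_add, Prod.snd_zero] at this
    omega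

theorem snd_add_eq_zero (w : WellStretched Δ d₁ d₂ g p) {f f' : X.Flag}
    (hv : X.flagVert f = X.flagVert f') (h : 0 < (X.flagDir f).2) (h' : (X.flagDir f').2 < 0) :
    (X.flagDir f).2 + (X.flagDir f').2 = 0 := by
  have hne : f ≠ f' := by
    rintro rfl
    omega
  by_cases hm : X.Marked (X.flagVert f')
  · exact congrArg Prod.snd (dir_add_of_marked w hm hv rfl hne)
  · obtain ⟨e, he⟩ := exists_endVtx_eq w hm
    have h0 := endFlag_snd w e
    have := congrArg Prod.snd (dir_add_of_not_marked hm hv rfl he hne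
      (fun h1 => h.ne' (h1 ▸ h0)) (fun h1 => h'.ne (h1 ▸ h0)))
    simp only [Prod.snd_add, Prod.snd_zero] at this
    omega

theorem flag_of_snd_neg {f : X.Flag} (hf : (X.flagDir f).2 < 0) :
    (∃ d, f = .inr (.inl d)) ∨ ∃ h, f = .inl h ∧ (X.dir h).2 < 0 := by
  rcases f with h | d | u | r | l
  · exact Or.inr ⟨h, rfl, hf⟩
  · exact Or.inl ⟨d, rfl⟩
  all_goals simp [CutData.flagDir] at hf

theorem flag_of_snd_pos {f : X.Flag} (hf : 0 < (X.flagDir f).2) :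
    (∃ u, f = .inr (.inr (.inl u))) ∨ ∃ h, f = .inl h ∧ 0 < (X.dir h).2 := by
  rcases f with h | d | u | r | l
  · exact Or.inr ⟨h, rfl, hf⟩
  · simp [CutData.flagDir] at hf
  · exact Or.inl ⟨u, rfl⟩
  all_goals simp [CutData.flagDir] at hf

theorem abs_snd_le (w : WellStretched Δ d₁ d₂ g p) (f : X.Flag) : |(X.flagDir f).2| ≤ 1 := by
  classical
  by_contra hcon
  obtain ⟨f, hf, hmin⟩ := Finset.exists_min_image (univ.filter fun f => 1 < |(X.flagDir f).2|)
    (fun f => (X.pos (X.flagVert f)).2) ⟨f, by simpa using hcon⟩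
  simp only [mem_filter, mem_univ, true_and] at hf hmin
  obtain ⟨f', hf', hf1⟩ : ∃ f', X.flagVert f' = X.flagVert f ∧ (X.flagDir f').2 < -1 := by
    rcases lt_abs.1 hf with h | h
    · obtain ⟨f', hv, hf'⟩ := Floored.exists_down (v := X.flagVert f) ⟨f, rfl, by omega⟩
      have := snd_add_eq_zero w hv.symm (by omega) hf'
      exact ⟨f', hv, by omega⟩
    · exact ⟨f, rfl, by omega⟩
  rcases flag_of_snd_neg (f := f') (by omega) with ⟨d, rfl⟩ | ⟨h, rfl, hh⟩
  · simp [CutData.flagDir] at hf1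
  · have h1 : (X.dir h).2 < -1 := hf1
    have h2 := hmin (.inl (X.opp h)) (by
      change 1 < |(X.dir (X.opp h)).2|
      rw [X.dir_opp, Prod.snd_neg, abs_neg, lt_abs]
      right
      omega)
    rw [← hf'] at h2
    change (X.pos (X.vert h)).2 ≤ (X.pos (X.vert (X.opp h))).2 at h2
    have h3 := X.lt_of_dir_snd_pos (h := X.opp h) (by rw [X.dir_opp]; simpa using hh)
    rw [X.opp_opp] at h3
    exact absurd h2 (not_le.2 h3)

variable (X) in
/-- The vertex `v` lies on the floor through the `i`-th point. -/
def OnFloor (v : X.V) (i : Fin n) : Prop :=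
  i ∈ X.whites ∧ X.Floored v ∧ ∃ k l k' l', |(X.pos v).1 - (p i).1| ≤
    FloorDiagram.degreeBound Δ d₁ * |(p k).2 - (p l).2| +
      FloorDiagram.degreeBound Δ d₁ * |(p k').2 - (p l').2|

theorem OnFloor.unique_of_abs_le (w : WellStretched Δ d₁ d₂ g p) {u v : X.V} {i j k l : Fin n}
    (hi : X.OnFloor u i) (hj : X.OnFloor v j) (huv : |(X.pos u).1 - (X.pos v).1| ≤
      FloorDiagram.degreeBound Δ d₁ * |(p k).2 - (p l).2|) : i = j := by
  obtain ⟨-, -, k1, l1, k2, l2, h1⟩ := hi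
  obtain ⟨-, -, k3, l3, k4, l4, h2⟩ := hj
  by_contra hij
  have a0 := w.lt hij k l
  have a1 := w.lt hij k1 l1
  have a2 := w.lt hij k2 l2
  have a3 := w.lt hij k3 l3
  have a4 := w.lt hij k4 l4
  have a5 : |(p i).1 - (p j).1| ≤ |(X.pos u).1 - (p i).1| +
      (|(X.pos u).1 - (X.pos v).1| + |(X.pos v).1 - (p j).1|) := by
    rw [abs_sub_comm (X.pos u).1 (p i).1]
    exact (abs_sub_le _ (X.pos u).1 _).trans (add_le_add le_rfl (abs_sub_le _ _ _))
  have a6 := abs_nonneg ((p i).1 - (p j).1)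
  linarith

theorem OnFloor.unique (w : WellStretched Δ d₁ d₂ g p) {v : X.V} {i j : Fin n}
    (hi : X.OnFloor v i) (hj : X.OnFloor v j) : i = j :=
  hi.unique_of_abs_le w (k := i) (l := i) hj (by simp)

theorem onFloor_markVert {i : Fin n} (hi : i ∈ X.whites) : X.OnFloor (X.markVert i) i :=
  ⟨hi, mem_whites.1 hi, i, i, i, i, by rw [X.point]; simp⟩

theorem exists_onFloor (w : WellStretched Δ d₁ d₂ g p) {v : X.V} (hv : X.Floored v) :
    ∃ i, X.OnFloor v i := by
  classical
  obtain ⟨t, ht⟩ := w.exists_highest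
  obtain ⟨f, hinj, hx⟩ := exists_injective_exit (X := X) w ht
  have hbij := hinj.bijective_of_nat_card_le (by
    rw [Nat.card_coe_set_eq, Nat.card_eq_fintype_card, Fintype.card_coe, card_whites w]
    exact exits_card_le _)
  obtain ⟨m, hm⟩ := exists_height_eq w v
  obtain ⟨f', hf', hx'⟩ := exists_exit hv (Y := (p t).2) (hm ▸ ht m)
  obtain ⟨i, hi⟩ := hbij.2 ⟨f', hf'⟩
  have h1 := hx i
  rw [hi] at h1
  refine ⟨i, i.2, hv, t, m, t, i, ?_⟩
  rw [abs_of_nonneg (sub_nonneg.2 (ht _)), abs_of_nonneg (sub_nonneg.2 (ht _)), ← hm]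
  rw [abs_sub_comm] at hx'
  exact (abs_sub_le _ _ _).trans (add_le_add hx' h1)

theorem floored_of_snd {h : X.H} (hh : (X.dir h).2 ≠ 0) : X.Floored (X.vert h) :=
  ⟨.inl h, rfl, hh⟩

theorem OnFloor.opp (w : WellStretched Δ d₁ d₂ g p) {h : X.H} {i : Fin n}
    (hi : X.OnFloor (X.vert h) i) (hh : (X.dir h).2 ≠ 0) : X.OnFloor (X.vert (X.opp h)) i := by
  obtain ⟨j, hj⟩ := exists_onFloor w (v := X.vert (X.opp h))
    (floored_of_snd (by rw [X.dir_opp]; simpa using hh))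
  obtain ⟨k, hk⟩ := exists_height_eq w (X.vert (X.opp h))
  obtain ⟨l, hl⟩ := exists_height_eq w (X.vert h)
  have h1 := abs_fst_sub_le hh
  rw [hk, hl] at h1
  rwa [hj.unique_of_abs_le w hi h1] at hj

/-- There is only one end of direction `(0,-1)` on every floor. -/
theorem dn_unique (w : WellStretched Δ d₁ d₂ g p) {d d' : X.Dn} {i : Fin n}
    (hd : X.OnFloor (X.dnVert d) i) (hd' : X.OnFloor (X.dnVert d') i) : d = d' := by
  classical
  have hfl : ∀ d, X.Floored (X.dnVert d) := fun d => ⟨.inr (.inl d), rfl, by simp [CutData.flagDir]⟩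
  choose φ hφ using fun d => exists_onFloor w (hfl d)
  have hsurj : Function.Surjective fun d => (⟨φ d, (hφ d).1⟩ : X.whites) := by
    rintro ⟨i, hi⟩
    obtain ⟨v, hv, hmin⟩ := Finset.exists_min_image (univ.filter fun v => X.OnFloor v i)
      (fun v => (X.pos v).2) ⟨X.markVert i, by simpa using onFloor_markVert hi⟩
    simp only [mem_filter, mem_univ, true_and] at hv hmin
    obtain ⟨f, rfl, hf⟩ := hv.2.1.exists_down
    rcases flag_of_snd_neg hf with ⟨d, rfl⟩ | ⟨h, rfl, hh⟩
    · exact ⟨d, Subtype.ext ((hφ d).unique w hv)⟩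
    · have h1 := hmin _ (hv.opp w (h := h) hh.ne)
      have h3 := X.lt_of_dir_snd_pos (h := X.opp h) (by rw [X.dir_opp]; simpa using hh)
      rw [X.opp_opp] at h3
      exact absurd h1 (not_le.2 h3)
  have hbij := hsurj.bijective_of_nat_card_le (by
    rw [Nat.card_eq_fintype_card, Nat.card_eq_fintype_card, Fintype.card_coe, card_whites w]
    exact X.bidegree.1.le)
  exact hbij.1 (Subtype.ext ((hd.unique w (hφ d)).symm.trans (hd'.unique w (hφ d'))))

theorem OnFloor.exists_exit {v : X.V} {i : Fin n} (hv : X.OnFloor v i) : ∃ f,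
    X.flagVert f = v ∧ X.IsExit (fun u => X.OnFloor u i ∧ (X.pos u).2 ≤ (X.pos v).2) f := by
  obtain ⟨f, rfl, hf⟩ := hv.2.1.exists_up
  refine ⟨f, rfl, ⟨hv, le_rfl⟩, hf, ?_⟩
  rintro h rfl ⟨-, h1⟩
  exact absurd h1 (not_le.2 (X.lt_of_dir_snd_pos hf))

section

variable (w : WellStretched Δ d₁ d₂ g p)
include w

open Classical in
theorem card_floor_exits (i : Fin n) (y : ℝ) :
    #(univ.filter fun f => X.IsExit (fun v => X.OnFloor v i ∧ (X.pos v).2 ≤ y) f) ≤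
      #(univ.filter fun d => X.OnFloor (X.dnVert d) i ∧ (X.pos (X.dnVert d)).2 ≤ y) := by
  have key := X.card_isExit_le (fun v => X.OnFloor v i ∧ (X.pos v).2 ≤ y) fun h h1 h2 => ?_
  · convert key
  by_cases hh : (X.dir h).2 = 0
  · exact hh.ge
  · have h3 : y < (X.pos (X.vert (X.opp h))).2 := by
      by_contra hy
      exact h2 ⟨h1.1.opp w hh, not_lt.1 hy⟩
    exact (X.dir_snd_pos_of_lt (h1.2.trans_lt h3)).le

/-- Every floor crosses every height at most once. -/
theorem exit_unique {i : Fin n} {y : ℝ} {f f' : X.Flag}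
    (hf : X.IsExit (fun v => X.OnFloor v i ∧ (X.pos v).2 ≤ y) f)
    (hf' : X.IsExit (fun v => X.OnFloor v i ∧ (X.pos v).2 ≤ y) f') : f = f' := by
  classical
  have h1 := (card_floor_exits (X := X) w i y).trans (Finset.card_le_one.2 fun d hd d' hd' =>
    dn_unique w (mem_filter.1 hd).2.1 (mem_filter.1 hd').2.1)
  exact Finset.card_le_one.1 h1 f (by simpa using hf) f' (by simpa using hf')

theorem OnFloor.ext {u v : X.V} {i : Fin n} (hu : X.OnFloor u i) (hv : X.OnFloor v i)
    (h : (X.pos u).2 = (X.pos v).2) : u = v := by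
  obtain ⟨f, rfl, hf⟩ := hu.exists_exit
  obtain ⟨f', rfl, hf'⟩ := hv.exists_exit
  rw [h] at hf
  rw [exit_unique w hf hf']

theorem OnFloor.opp_le {u : X.V} {h : X.H} {i : Fin n} (hv : X.OnFloor (X.vert h) i)
    (hh : 0 < (X.dir h).2) (hu : X.OnFloor u i) (hlt : (X.pos (X.vert h)).2 < (X.pos u).2) :
    (X.pos (X.vert (X.opp h))).2 ≤ (X.pos u).2 := by
  by_contra hcon
  obtain ⟨f, hf, hf'⟩ := hu.exists_exit
  have h1 := exit_unique w (f := .inl h) ⟨⟨hv, hlt.le⟩, hh, by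
    rintro h' heq ⟨-, h2⟩
    rw [← Sum.inl_injective heq] at h2
    exact hcon h2⟩ hf'
  rw [← h1] at hf
  exact hlt.ne (congrArg (fun v => (X.pos v).2) hf)

theorem OnFloor.le_up {u : X.Up} {v : X.V} {i : Fin n} (hu : X.OnFloor (X.upVert u) i)
    (hv : X.OnFloor v i) : (X.pos v).2 ≤ (X.pos (X.upVert u)).2 := by
  by_contra hcon
  obtain ⟨f, hf, hf'⟩ := hv.exists_exit
  have h1 := exit_unique w (f := .inr (.inr (.inl u))) ⟨⟨hu, (not_le.1 hcon).le⟩, by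
    simp [CutData.flagDir], by simp⟩ hf'
  rw [← h1] at hf
  exact hcon (congrArg (fun v => (X.pos v).2) hf).ge

theorem OnFloor.dn_le {d : X.Dn} {v : X.V} {i : Fin n} (hd : X.OnFloor (X.dnVert d) i)
    (hv : X.OnFloor v i) : (X.pos (X.dnVert d)).2 ≤ (X.pos v).2 := by
  classical
  obtain ⟨f, hf, hf'⟩ := hv.exists_exit
  have h1 : 0 < #(univ.filter fun f => X.IsExit (fun u => X.OnFloor u i ∧
      (X.pos u).2 ≤ (X.pos v).2) f) := Finset.card_pos.2 ⟨f, by simpa using hf'⟩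
  obtain ⟨d', hd'⟩ := Finset.card_pos.1 (h1.trans_le (card_floor_exits w i (X.pos v).2))
  simp only [mem_filter, mem_univ, true_and] at hd'
  rw [dn_unique w hd hd'.1]
  exact hd'.2

end

end CountedMap


section

variable {R L Z : Type*} {e : R ⊕ Z ≃ L ⊕ Z}

theorem GlueChain.walk_of_le {r : R} {k : ℕ} {l : L} (h : GlueChain e r k l) {j : ℕ} (hj : k ≤ j) :
    glueWalk e r j = .inl l := by
  induction j, hj using Nat.le_induction with
  | base => exact h.1
  | succ j _ ih => rw [glueWalk, ih]; rfl

theorem GlueChain.eq_of_inl {r : R} {k : ℕ} {l l' : L} (h : GlueChain e r k l) {j : ℕ}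
    (hj : glueWalk e r j = .inl l') : l' = l := by
  rcases lt_or_ge j k with hlt | hle
  · have := h.2 j hlt
    rw [hj] at this
    cases this
  · exact Sum.inl_injective (hj.symm.trans (h.walk_of_le hle))

theorem GlueChain.lt_of_inr {r : R} {k : ℕ} {l : L} (h : GlueChain e r k l) {j : ℕ} {z : Z}
    (hj : glueWalk e r j = .inr z) : j < k := by
  by_contra hle
  rw [h.walk_of_le (not_lt.1 hle)] at hj
  cases hj

end

/-- The vertices `u` and `v` are connected by a horizontal edge of weight `ω` of the glued graph
which crosses the cut `k` times. -/
def CutData.Elevator {n : ℕ} (C : CutData n) (u v : C.V) (ω : ℕ) : ℕ → Prop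
  | 0 => ∃ h, C.vert h = u ∧ C.vert (C.opp h) = v ∧ C.dir h = ((ω : ℤ), 0)
  | k + 1 => ∃ r l, C.rtVert r = u ∧ C.lfVert l = v ∧ C.rtWt r = ω ∧ C.lfWt l = ω ∧
      GlueChain C.glue r k l

namespace CutStableMap

variable {n : ℕ} (C : CutStableMap n)

theorem leftWt_glueWalk (r : C.Rt) (j : ℕ) : C.leftWt (glueWalk C.glue r j) = C.rtWt r := by
  induction j with
  | zero => exact C.glue_wt (.inl r)
  | succ j ih =>
    rw [glueWalk]
    rcases hj : glueWalk C.glue r j with l | z <;> rw [hj] at ih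
    · exact ih
    · exact (C.glue_wt (.inr z)).trans ih

theorem leftY_glueWalk (r : C.Rt) (j : ℕ) :
    C.leftY (glueWalk C.glue r j) = (C.pos (C.rtVert r)).2 := by
  induction j with
  | zero => exact C.glue_y (.inl r)
  | succ j ih =>
    rw [glueWalk]
    rcases hj : glueWalk C.glue r j with l | z <;> rw [hj] at ih
    · exact ih
    · exact (C.glue_y (.inr z)).trans ih

variable {C}

theorem Elevator.exists_right {u v : C.V} {ω k : ℕ} (h : C.Elevator u v ω k) :
    ∃ f, C.flagVert f = u ∧ C.flagDir f = ((ω : ℤ), 0) := by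
  cases k with
  | zero =>
    obtain ⟨h, h1, -, h2⟩ := h
    exact ⟨.inl h, h1, h2⟩
  | succ k =>
    obtain ⟨r, l, h1, -, rfl, -⟩ := h
    exact ⟨.inr (.inr (.inr (.inl r))), h1, rfl⟩

theorem Elevator.exists_left {u v : C.V} {ω k : ℕ} (h : C.Elevator u v ω k) :
    ∃ f, C.flagVert f = v ∧ C.flagDir f = (-(ω : ℤ), 0) := by
  cases k with
  | zero =>
    obtain ⟨h, -, h1, h2⟩ := h
    refine ⟨.inl (C.opp h), h1, ?_⟩
    change C.dir (C.opp h) = _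
    rw [C.dir_opp, h2]
    simp
  | succ k =>
    obtain ⟨r, l, -, h1, -, rfl, -⟩ := h
    exact ⟨.inr (.inr (.inr (.inr l))), h1, rfl⟩

theorem Elevator.snd_eq {u v : C.V} {ω k : ℕ} (h : C.Elevator u v ω k) :
    (C.pos v).2 = (C.pos u).2 := by
  cases k with
  | zero =>
    obtain ⟨h, rfl, rfl, h2⟩ := h
    rw [C.affine, h2]
    simp
  | succ k =>
    obtain ⟨r, l, rfl, rfl, -, -, h⟩ := h
    have := C.leftY_glueWalk r k
    rw [h.1] at this
    exact this

theorem Elevator.fst_lt {u v : C.V} {ω : ℕ} (h : C.Elevator u v ω 0) (hω : 0 < ω) :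
    (C.pos u).1 < (C.pos v).1 := by
  obtain ⟨h, rfl, rfl, h2⟩ := h
  exact C.lt_of_dir_fst_pos (by rw [h2]; exact Int.natCast_pos.2 hω)

/-- Every horizontal flag pointing to the right belongs to an elevator. -/
theorem exists_elevator {f : C.Flag} {ω : ℕ} (hω : 0 < ω) (hf : C.flagDir f = ((ω : ℤ), 0)) :
    ∃ v k, C.Elevator (C.flagVert f) v ω k := by
  rcases f with h | d | u | r | l
  · exact ⟨C.vert (C.opp h), 0, h, rfl, rfl, hf⟩
  · exact absurd (congrArg Prod.snd hf) (by simp [CutData.flagDir])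
  · exact absurd (congrArg Prod.snd hf) (by simp [CutData.flagDir])
  · obtain ⟨k, l, h⟩ := exists_glueChain (e := C.glue) r
    have h1 : C.rtWt r = ω := Int.natCast_inj.1 (congrArg Prod.fst hf)
    have h2 := C.leftWt_glueWalk r k
    rw [h.1] at h2
    exact ⟨C.lfVert l, k + 1, r, l, rfl, rfl, h1, h2.trans h1, h⟩
  · have := congrArg Prod.fst hf
    simp only [CutData.flagDir] at this
    omega

end CutStableMap

namespace CountedMap

variable {Δ : Multiset ℤ} {d₁ d₂ g n : ℕ} {p : Fin n → ℝ × ℝ} {X : CountedMap Δ d₁ d₂ g p}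

theorem Elevator.wt_le {u v : X.V} {ω k : ℕ} (h : X.Elevator u v ω k) :
    ω ≤ FloorDiagram.degreeBound Δ d₁ := by
  cases k with
  | zero =>
    obtain ⟨h, -, -, h2⟩ := h
    have := CutStableMap.abs_dir_le X.leakyDegree X.bidegree h
    rw [h2] at this
    simpa using this
  | succ k =>
    obtain ⟨r, l, -, -, rfl, -⟩ := h
    exact_mod_cast CutStableMap.rtWt_le X.leakyDegree X.bidegree r

theorem Elevator.left_unique (w : WellStretched Δ d₁ d₂ g p) {u u' v : X.V} {ω ω' k k' : ℕ}
    (hω : 0 < ω) (hω' : 0 < ω') (h : X.Elevator u v ω k) (h' : X.Elevator u' v ω' k') : u = u' := by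
  have key : ∀ f f', X.flagVert f = v → X.flagVert f' = v → X.flagDir f = (-(ω : ℤ), 0) →
      X.flagDir f' = (-(ω' : ℤ), 0) → f = f' := by
    intro f f' hf hf' hd hd'
    refine horizontal_ext w (hf.trans hf'.symm) (by rw [hd]) (by rw [hd']) ?_
    rw [hd, hd']
    simp only
    omega
  cases k with
  | zero =>
    obtain ⟨h, rfl, h1, h2⟩ := h
    have d1 : X.flagDir (.inl (X.opp h)) = (-(ω : ℤ), 0) := by
      change X.dir (X.opp h) = _
      rw [X.dir_opp, h2]
      simp
    cases k' with
    | zero =>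
      obtain ⟨h', rfl, h1', h2'⟩ := h'
      have d2 : X.flagDir (.inl (X.opp h')) = (-(ω' : ℤ), 0) := by
        change X.dir (X.opp h') = _
        rw [X.dir_opp, h2']
        simp
      have := Sum.inl_injective (key _ _ h1 h1' d1 d2)
      rw [← X.opp_opp h, this, X.opp_opp]
    | succ k' =>
      obtain ⟨r, l, rfl, h1', -, rfl, -⟩ := h'
      cases key (.inl (X.opp h)) (.inr (.inr (.inr (.inr l)))) h1 h1' d1 rfl
  | succ k =>
    obtain ⟨r, l, rfl, h1, -, rfl, hc⟩ := h
    cases k' with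
    | zero =>
      obtain ⟨h', rfl, h1', h2'⟩ := h'
      have d2 : X.flagDir (.inl (X.opp h')) = (-(ω' : ℤ), 0) := by
        change X.dir (X.opp h') = _
        rw [X.dir_opp, h2']
        simp
      cases key (.inr (.inr (.inr (.inr l)))) (.inl (X.opp h')) h1 h1' rfl d2
    | succ k' =>
      obtain ⟨r', l', rfl, h1', -, rfl, hc'⟩ := h'
      have := key (.inr (.inr (.inr (.inr l)))) (.inr (.inr (.inr (.inr l')))) h1 h1' rfl rfl
      cases this
      rw [hc.unique_left hc']

theorem not_elevator_self (w : WellStretched Δ d₁ d₂ g p) {v : X.V} (hv : X.Marked v)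
    {ω k : ℕ} (hω : 0 < ω) : ¬ X.Elevator v v ω k := by
  intro h
  cases k with
  | zero => exact absurd (CutStableMap.Elevator.fst_lt h hω) (lt_irrefl _)
  | succ k =>
    obtain ⟨r, l, h1, h2, h3, h4, hc⟩ := h
    have hfl : ∀ f, X.flagVert f = v →
        f = .inr (.inr (.inr (.inl r))) ∨ f = .inr (.inr (.inr (.inr l))) := by
      intro f hf
      have hf0 : (X.flagDir f).2 = 0 := by
        by_contra hne
        exact not_floored_of_horizontal w hv (f := .inr (.inr (.inr (.inl r)))) h1 rfl ⟨f, hf, hne⟩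
      have n1 := fst_ne_zero w hf0
      rcases lt_or_ge 0 (X.flagDir f).1 with hpos | hneg
      · left
        refine horizontal_ext w (hf.trans h1.symm) hf0 rfl ?_
        simp only [hpos, true_iff]
        change (0 : ℤ) < X.rtWt r
        omega
      · right
        refine horizontal_ext w (hf.trans h2.symm) hf0 rfl ?_
        have h5 : (X.flagDir (.inr (.inr (.inr (.inr l))))).1 = -(X.lfWt l : ℤ) := rfl
        rw [h5]
        omega
    let S : Set (X.V ⊕ X.Z) := {.inl v} ∪ .inr '' {z | ∃ j, glueWalk X.glue r j = .inr z}
    have hA : ∀ j, X.leftBase (glueWalk X.glue r j) ∈ S := by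
      intro j
      rcases hj : glueWalk X.glue r j with l' | z
      · rw [hc.eq_of_inl hj]
        exact Or.inl (congrArg Sum.inl h2)
      · exact Or.inr ⟨z, ⟨j, hj⟩, rfl⟩
    have hB : ∀ r' j, j ≤ k → X.glue r' = glueWalk X.glue r j → X.rightBase r' ∈ S := by
      intro r' j hj hr
      cases j with
      | zero =>
        rw [X.glue.injective hr]
        exact Or.inl (congrArg Sum.inl h1)
      | succ j =>
        obtain ⟨z, hz, hz'⟩ := hc.exists_right (j := j) (by omega)
        rw [hz'] at hr
        rw [X.glue.injective hr]
        exact Or.inr ⟨z, ⟨j, hz⟩, rfl⟩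
    refine false_of_closed w (S := S) ⟨.inl v, Or.inl rfl⟩ (fun h hh => ?_) (fun r' => ⟨fun hr => ?_,
      fun hr => ?_⟩) fun d hd => ?_
    · rcases hh with hh | ⟨z, -, hh⟩
      · rcases hfl (.inl h) (Sum.inl_injective hh) with h' | h' <;> cases h'
      · cases hh
    · rcases hr with hr | ⟨z, ⟨j, hj⟩, hr⟩
      · rcases r' with r' | z
        · rcases hfl (.inr (.inr (.inr (.inl r')))) (Sum.inl_injective hr) with h' | h' <;> cases h'
          exact hA 0
        · cases hr
      · rcases r' with r' | z'
        · cases hr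
        · obtain rfl : z = z' := Sum.inr_injective hr
          have := hA (j + 1)
          rw [glueWalk, hj] at this
          exact this
    · rcases hl : X.glue r' with l' | z <;> rw [hl] at hr
      · rcases hr with hr | ⟨z, -, hr⟩
        · rcases hfl (.inr (.inr (.inr (.inr l')))) (Sum.inl_injective hr) with h' | h' <;> cases h'
          exact hB r' k le_rfl (hl.trans hc.1.symm)
        · cases hr
      · rcases hr with hr | ⟨z', ⟨j, hj⟩, hr⟩
        · cases hr
        · obtain rfl : z' = z := Sum.inr_injective hr
          exact hB r' j (hc.lt_of_inr hj).le (hl.trans hj.symm)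
    · rcases hd with hd | ⟨z, -, hd⟩
      · rcases hfl (.inr (.inl d)) (Sum.inl_injective hd) with h' | h' <;> cases h'
      · cases hd

/-- No set of vertexless lines is closed under the glueing. -/
theorem not_glue_invariant (w : WellStretched Δ d₁ d₂ g p) {S : Set X.Z} (hS : S.Nonempty) :
    ¬ ∀ z, z ∈ S ↔ ∃ z' ∈ S, X.glue (.inr z) = .inr z' := by
  intro hinv
  have hinj : ∀ z : S, ∃ z' : S, X.glue (.inr z.1) = .inr z'.1 := fun z => by
    obtain ⟨z', hz', h⟩ := (hinv z.1).1 z.2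
    exact ⟨⟨z', hz'⟩, h⟩
  choose φ hφ using hinj
  have hφi : Function.Injective φ := by
    intro a b hab
    have := hφ a
    rw [hab, ← hφ b] at this
    exact Subtype.ext (Sum.inr_injective (X.glue.injective this))
  have hφs := Finite.surjective_of_injective hφi
  obtain ⟨z0, hz0⟩ := hS
  refine false_of_closed w (S := .inr '' S) ⟨_, z0, hz0, rfl⟩ (fun h hh => ?_)
    (fun r => ⟨?_, ?_⟩) fun d hd => ?_
  · obtain ⟨z, -, hh⟩ := hh
    cases hh
  · rintro ⟨z, hz, hr⟩
    rcases r with r | z'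
    · cases hr
    · obtain rfl : z = z' := Sum.inr_injective hr
      rw [hφ ⟨z, hz⟩]
      exact ⟨_, (φ ⟨z, hz⟩).2, rfl⟩
  · rintro ⟨z, hz, hr⟩
    obtain ⟨y, hy⟩ := hφs ⟨z, hz⟩
    have h1 := hφ y
    rw [hy] at h1
    rcases hl : X.glue r with l | z' <;> rw [hl] at hr
    · cases hr
    · obtain rfl : z = z' := Sum.inr_injective hr
      rw [X.glue.injective (hl.trans h1.symm)]
      exact ⟨y.1, y.2, rfl⟩
  · obtain ⟨z, -, hh⟩ := hd
    cases hh

theorem exists_mark_flags (w : WellStretched Δ d₁ d₂ g p) {i : Fin n} (hi : i ∉ X.whites) :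
    ∃ ω : ℕ, 0 < ω ∧ ∃ f f', X.flagVert f = X.markVert i ∧ X.flagVert f' = X.markVert i ∧
      X.flagDir f = ((ω : ℤ), 0) ∧ X.flagDir f' = (-(ω : ℤ), 0) := by
  rw [mem_whites] at hi
  have hc : 1 < #(X.flagsAt (X.markVert i)) := by
    rw [card_flagsAt_of_marked w ⟨i, rfl⟩]; norm_num
  obtain ⟨f, hf, f', hf', hne⟩ := Finset.one_lt_card.1 hc
  rw [mem_flagsAt] at hf hf'
  have h0 : ∀ f, X.flagVert f = X.markVert i → (X.flagDir f).2 = 0 := fun f hf => by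
    by_contra h
    exact hi ⟨f, hf, h⟩
  have hsum := congrArg Prod.fst (dir_add_of_marked w ⟨i, rfl⟩ hf hf' hne)
  simp only [Prod.fst_add, Prod.fst_zero] at hsum
  have n1 := fst_ne_zero w (h0 f hf)
  rcases lt_or_ge 0 (X.flagDir f).1 with hpos | hneg
  · refine ⟨(X.flagDir f).1.natAbs, by omega, f, f', hf, hf', Prod.ext ?_ (h0 f hf),
      Prod.ext ?_ (h0 f' hf')⟩ <;> simp only <;> omega
  · refine ⟨(X.flagDir f).1.natAbs, by omega, f', f, hf', hf, Prod.ext ?_ (h0 f' hf'),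
      Prod.ext ?_ (h0 f hf)⟩ <;> simp only <;> omega

/-- The two half elevators at a point which is not on a floor. -/
theorem exists_elevators (w : WellStretched Δ d₁ d₂ g p) {i : Fin n} (hi : i ∉ X.whites) :
    ∃ ω, 0 < ω ∧ (∃ k, X.Elevator (endVtx w (⟨i, hi⟩, true)) (X.markVert i) ω k) ∧
      ∃ k, X.Elevator (X.markVert i) (endVtx w (⟨i, hi⟩, false)) ω k := by
  obtain ⟨ω, hω, f, f', hf, hf', hd, hd'⟩ := exists_mark_flags w hi
  have hleft : ∀ v, (X.pos v).2 = (p i).2 → ∀ f : X.Flag, X.flagVert f = v →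
      (X.flagDir f).2 = 0 → (X.flagDir f).1 < 0 →
      v = X.markVert i ∨ v = endVtx w (⟨i, hi⟩, false) := by
    clear hf hd f
    intro v hv f hf h0 hneg
    by_cases hm : X.Marked v
    · obtain ⟨j, rfl⟩ := hm
      rw [X.point] at hv
      rw [w.snd_injective _ _ hv]
      exact Or.inl rfl
    · obtain ⟨⟨⟨j, hj⟩, s⟩, rfl⟩ := exists_endVtx_eq w hm
      rw [endVtx_snd] at hv
      obtain rfl : j = i := w.snd_injective _ _ hv
      have h1 := horizontal_unique w hm hf rfl h0 (endFlag_snd w _)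
      have h2 := endFlag_fst_pos_iff w (⟨j, hj⟩, s)
      rw [← h1] at h2
      right
      have hs : s = false := by
        by_contra hs
        have := h2.2 (by simpa using hs)
        omega
      rw [hs]
  obtain ⟨ω₁, hω₁⟩ : ∃ ω₁ : ℕ, X.flagDir (endFlag w (⟨i, hi⟩, true)) = ((ω₁ : ℤ), 0) := by
    have h1 := (endFlag_fst_pos_iff w (⟨i, hi⟩, true)).2 rfl
    exact ⟨_, Prod.ext (Int.toNat_of_nonneg h1.le).symm (endFlag_snd w _)⟩
  have hpos₁ : 0 < ω₁ := by
    have h1 := (endFlag_fst_pos_iff w (⟨i, hi⟩, true)).2 rfl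
    rw [hω₁] at h1
    exact Int.natCast_pos.1 h1
  obtain ⟨v₁, k₁, h₁⟩ := CutStableMap.exists_elevator hpos₁ hω₁
  obtain ⟨v₂, k₂, h₂⟩ := CutStableMap.exists_elevator hω hd
  rw [hf] at h₂
  have m₁ : v₁ = X.markVert i ∨ v₁ = endVtx w (⟨i, hi⟩, false) := by
    obtain ⟨f₁, hf₁, hd₁⟩ := CutStableMap.Elevator.exists_left h₁
    refine hleft v₁ ?_ f₁ hf₁ (by rw [hd₁]) (by rw [hd₁]; simp only; omega)
    rw [CutStableMap.Elevator.snd_eq h₁]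
    exact endVtx_snd w _
  have m₂ : v₂ = X.markVert i ∨ v₂ = endVtx w (⟨i, hi⟩, false) := by
    obtain ⟨f₁, hf₁, hd₁⟩ := CutStableMap.Elevator.exists_left h₂
    refine hleft v₂ ?_ f₁ hf₁ (by rw [hd₁]) (by rw [hd₁]; simp only; omega)
    rw [CutStableMap.Elevator.snd_eq h₂, X.point]
  have hne₂ : v₂ ≠ X.markVert i := by
    rintro rfl
    exact not_elevator_self w ⟨i, rfl⟩ hω h₂
  obtain rfl := m₂.resolve_left hne₂
  have hne₁ : v₁ ≠ endVtx w (⟨i, hi⟩, false) := by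
    rintro rfl
    exact not_marked_endVtx w (⟨i, hi⟩, true) ⟨i, (Elevator.left_unique w hpos₁ hω h₁ h₂).symm⟩
  obtain rfl := m₁.resolve_right hne₁
  have hw : ω₁ = ω := by
    obtain ⟨f₁, hf₁, hd₁⟩ := CutStableMap.Elevator.exists_left h₁
    have h1 : f₁ = f' := by
      refine horizontal_ext w (hf₁.trans hf'.symm) (by rw [hd₁]) (by rw [hd']) ?_
      rw [hd₁, hd']
      simp only
      omega
    have h2 := congrArg Prod.fst (hd₁.symm.trans (h1 ▸ hd'))
    simp only at h2
    omega
  subst hw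
  exact ⟨ω₁, hω, ⟨k₁, h₁⟩, ⟨k₂, h₂⟩⟩

end CountedMap


namespace FloorDiagram

variable {n : ℕ} {δ : FloorDiagram n} {p : Fin n → ℝ × ℝ}

theorem abs_floorX_sub_le {K : ℕ} (hK : ∀ b, δ.wt b ≤ K) (i : Fin n) (y : ℝ) :
    |δ.floorX p i y - (p i).1| ≤ 2 * n * K * |y - (p i).2| := by
  unfold floorX
  rw [add_sub_cancel_left]
  refine (Finset.abs_sum_le_sum_abs _ _).trans ?_
  have h1 : ∀ b ∈ (univ : Finset (Fin n)), |(δ.coef i b : ℝ) *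
      (max (y - (p b).2) 0 - max ((p i).2 - (p b).2) 0)| ≤ 2 * K * |y - (p i).2| := by
    intro b _
    rw [abs_mul]
    have h2 : |(δ.coef i b : ℝ)| ≤ 2 * K := by
      have h3 := (abs_coef_le (δ := δ) i b).trans
        (mul_le_mul_of_nonneg_left (Nat.cast_le.2 (hK b)) (by norm_num))
      exact_mod_cast h3
    have h4 : |max (y - (p b).2) 0 - max ((p i).2 - (p b).2) 0| ≤ |y - (p i).2| := by
      refine (abs_max_sub_max_le_abs _ _ _).trans (le_of_eq ?_)
      congr 1
      ring
    exact mul_le_mul h2 h4 (abs_nonneg _) (by positivity)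
  refine (Finset.sum_le_sum h1).trans (le_of_eq ?_)
  rw [Finset.sum_const, Finset.card_univ, Fintype.card_fin, nsmul_eq_mul]
  ring

theorem floorX_lt_of_wt_le {Δ : Multiset ℤ} {d₁ d₂ g : ℕ} (w : WellStretched Δ d₁ d₂ g p)
    (hK : ∀ b, δ.wt b ≤ degreeBound Δ d₁) {i j : Fin n} (b c : Fin n) (hij : (p i).1 < (p j).1) :
    δ.floorX p i (p b).2 < δ.floorX p j (p c).2 := by
  have hne : i ≠ j := by
    rintro rfl
    exact lt_irrefl _ hij
  have h1 := abs_le.1 (abs_floorX_sub_le (p := p) hK i (p b).2)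
  have h2 := abs_le.1 (abs_floorX_sub_le (p := p) hK j (p c).2)
  have h3 := w.stretched i j hne b i
  have h4 := w.stretched i j hne c j
  rw [abs_sub_comm (p i).1, abs_of_pos (sub_pos.2 hij)] at h3 h4
  linarith [h1.2, h2.1]

end FloorDiagram

theorem WellStretched.fst_injective {Δ : Multiset ℤ} {d₁ d₂ g n : ℕ} {p : Fin n → ℝ × ℝ}
    (w : WellStretched Δ d₁ d₂ g p) (i j : Fin n) (h : (p i).1 = (p j).1) : i = j := by
  by_contra hij
  have := w.lt hij i i
  rw [h] at this
  simp at this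

namespace CountedMap

variable {Δ : Multiset ℤ} {d₁ d₂ g n : ℕ} {p : Fin n → ℝ × ℝ} {X : CountedMap Δ d₁ d₂ g p}

variable (X) in
open Classical in
/-- The floor diagram of a tropical stable map. -/
noncomputable def diagram (w : WellStretched Δ d₁ d₂ g p) : FloorDiagram n where
  floor i s := if h : i ∈ X.whites then i else
    (exists_onFloor w (floored_of_not_marked w (not_marked_endVtx w (⟨i, h⟩, s)))).choose
  wind i s := if h : i ∈ X.whites then 0 else
    if s then (exists_elevators w h).choose_spec.2.1.choose
    else (exists_elevators w h).choose_spec.2.2.choose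
  wt i := if h : i ∈ X.whites then 0 else (exists_elevators w h).choose

variable {w : WellStretched Δ d₁ d₂ g p}

theorem diagram_wt_eq_zero {i : Fin n} : (X.diagram w).wt i = 0 ↔ i ∈ X.whites := by
  unfold diagram
  by_cases h : i ∈ X.whites
  · simp [h]
  · have := (exists_elevators w h).choose_spec.1
    simp only [h, dite_false, iff_false]
    omega

theorem notMem_whites {i : Fin n} (h : 0 < (X.diagram w).wt i) : i ∉ X.whites := fun hi =>
  h.ne' (diagram_wt_eq_zero.2 hi)

theorem diagram_floor_white {i : Fin n} (h : i ∈ X.whites) (s : Bool) :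
    (X.diagram w).floor i s = i := dif_pos h

theorem onFloor_diagram_floor {i : Fin n} (h : i ∉ X.whites) (s : Bool) :
    X.OnFloor (endVtx w (⟨i, h⟩, s)) ((X.diagram w).floor i s) := by
  have := (exists_onFloor w (floored_of_not_marked w (not_marked_endVtx w (⟨i, h⟩, s)))).choose_spec
  have h2 : (X.diagram w).floor i s = _ := dif_neg h
  rwa [h2]

theorem diagram_floor_mem (i : Fin n) (s : Bool) : (X.diagram w).floor i s ∈ X.whites := by
  by_cases h : i ∈ X.whites
  · rwa [diagram_floor_white h]
  · exact (onFloor_diagram_floor h s).1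

variable (X w) in
/-- The vertices of a tropical stable map in terms of its floor diagram. -/
noncomputable def vtxMap : (X.diagram w).Vtx → X.V :=
  Sum.elim X.markVert fun e => endVtx w (⟨e.1.1, notMem_whites e.2⟩, e.1.2)

open FloorDiagram

theorem vtxMap_bijective : Function.Bijective (X.vtxMap w) := by
  constructor
  · rintro (i | ⟨⟨b, s⟩, hb⟩) (j | ⟨⟨c, t⟩, hc⟩) h
    · exact congrArg _ (markVert_injective w h)
    · exact absurd ⟨i, h⟩ (not_marked_endVtx w _)
    · exact absurd ⟨j, h.symm⟩ (not_marked_endVtx w _)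
    · have := endVtx_injective w h
      simp only [Prod.mk.injEq, Subtype.mk.injEq] at this
      obtain ⟨rfl, rfl⟩ := this
      rfl
  · intro v
    by_cases hv : X.Marked v
    · obtain ⟨i, rfl⟩ := hv
      exact ⟨.inl i, rfl⟩
    · obtain ⟨⟨⟨i, hi⟩, s⟩, rfl⟩ := exists_endVtx_eq w hv
      exact ⟨.inr ⟨(i, s), Nat.pos_of_ne_zero fun h => hi (diagram_wt_eq_zero.1 h)⟩, rfl⟩

theorem vtxMap_snd (v : (X.diagram w).Vtx) : (X.pos (X.vtxMap w v)).2 = height p v := by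
  rcases v with i | e
  · exact congrArg Prod.snd (X.point i)
  · exact endVtx_snd w _

theorem onFloor_vtxMap {v : (X.diagram w).Vtx} (hv : (X.diagram w).wt (onFloor v) = 0) :
    X.OnFloor (X.vtxMap w v) (onFloor v) := by
  rcases v with i | e
  · exact onFloor_markVert (diagram_wt_eq_zero.1 hv)
  · exact onFloor_diagram_floor (notMem_whites e.2) e.1.2

theorem wt_of_floored {v : (X.diagram w).Vtx} (hv : X.Floored (X.vtxMap w v)) :
    (X.diagram w).wt (onFloor v) = 0 := by
  rcases v with i | e
  · exact diagram_wt_eq_zero.2 (mem_whites.2 hv)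
  · exact diagram_wt_eq_zero.2 (diagram_floor_mem _ _)

theorem onFloor_vtxMap_iff {v : (X.diagram w).Vtx} {i : Fin n} (hi : i ∈ X.whites) :
    X.OnFloor (X.vtxMap w v) i ↔ onFloor v = i := by
  constructor
  · intro h
    exact (onFloor_vtxMap (wt_of_floored h.2.1)).unique w h
  · rintro rfl
    exact onFloor_vtxMap (diagram_wt_eq_zero.2 hi)

theorem diagram_elevator (e : (X.diagram w).Half) :
    X.Elevator (X.vtxMap w (leftVtx e)) (X.vtxMap w (rightVtx e)) ((X.diagram w).wt e.1.1)
      ((X.diagram w).wind e.1.1 e.1.2) := by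
  obtain ⟨⟨b, s⟩, hb⟩ := e
  have hb' : b ∉ X.whites := notMem_whites hb
  have hw : (X.diagram w).wt b = (exists_elevators w hb').choose := dif_neg hb'
  have hk : (X.diagram w).wind b s = _ := dif_neg hb'
  simp only [hw, hk]
  cases s
  · exact (exists_elevators w hb').choose_spec.2.2.choose_spec
  · exact (exists_elevators w hb').choose_spec.2.1.choose_spec

theorem diagram_wt_le (b : Fin n) : (X.diagram w).wt b ≤ degreeBound Δ d₁ := by
  rcases Nat.eq_zero_or_pos ((X.diagram w).wt b) with h | h
  · rw [h]; exact Nat.zero_le _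
  · exact Elevator.wt_le (diagram_elevator ⟨(b, true), h⟩)

/-- Vertices on floors are close to the marked points of the floors. -/
theorem abs_fst_sub_le_of_onFloor (v : (X.diagram w).Vtx) : ∃ k l k' l',
    |(X.pos (X.vtxMap w v)).1 - (p (onFloor v)).1| ≤
      degreeBound Δ d₁ * |(p k).2 - (p l).2| + degreeBound Δ d₁ * |(p k').2 - (p l').2| := by
  rcases v with i | e
  · refine ⟨i, i, i, i, ?_⟩
    change |(X.pos (X.markVert i)).1 - (p i).1| ≤ _
    rw [X.point]
    simp
  · exact (onFloor_vtxMap (v := .inr e) (diagram_wt_eq_zero.2 (diagram_floor_mem _ _))).2.2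

theorem fst_lt_of_vtxMap {u v : (X.diagram w).Vtx} (hne : onFloor u ≠ onFloor v)
    (h : (X.pos (X.vtxMap w u)).1 < (X.pos (X.vtxMap w v)).1) :
    (p (onFloor u)).1 < (p (onFloor v)).1 := by
  obtain ⟨k1, l1, k2, l2, h1⟩ := abs_fst_sub_le_of_onFloor u
  obtain ⟨k3, l3, k4, l4, h2⟩ := abs_fst_sub_le_of_onFloor v
  by_contra hcon
  have a1 := w.lt hne k1 l1
  have a2 := w.lt hne k2 l2
  have a3 := w.lt hne k3 l3
  have a4 := w.lt hne k4 l4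
  rw [abs_of_nonneg (sub_nonneg.2 (not_lt.1 hcon))] at a1 a2 a3 a4
  have b1 := (abs_le.1 h1).1
  have b2 := (abs_le.1 h2).2
  linarith

theorem admissible_diagram : (X.diagram w).Admissible p where
  floor_white i h s := diagram_floor_white (diagram_wt_eq_zero.1 h) s
  wt_floor i s := diagram_wt_eq_zero.2 (diagram_floor_mem i s)
  floor_ne i hi heq := by
    have h1 := onFloor_diagram_floor (w := w) (notMem_whites hi) true
    have h2 := onFloor_diagram_floor (w := w) (notMem_whites hi) false
    rw [← heq] at h2
    have h3 := endVtx_injective w (h1.ext w h2 (by rw [endVtx_snd, endVtx_snd]))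
    simp at h3
  lt_or_wind i hi s := by
    refine or_iff_not_imp_right.2 fun h0 => ?_
    have h1 := diagram_elevator (w := w) ⟨(i, s), hi⟩
    rw [show (X.diagram w).wind i s = 0 by omega] at h1
    have h2 := CutStableMap.Elevator.fst_lt h1 hi
    rw [← onFloor_leftVtx ⟨(i, s), hi⟩, ← onFloor_rightVtx ⟨(i, s), hi⟩]
    refine fst_lt_of_vtxMap (fun heq => ?_) h2
    rw [onFloor_leftVtx, onFloor_rightVtx] at heq
    have h3 : (X.diagram w).floor i s = i := by
      cases s
      · exact heq.symm
      · exact heq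
    exact notMem_whites hi (h3 ▸ diagram_floor_mem i s)
  fst_injective := w.fst_injective
  snd_injective := w.snd_injective
  floorX_lt i j b c := floorX_lt_of_wt_le w diagram_wt_le b c

theorem below_of_edge {u v : (X.diagram w).Vtx} {h : X.H} (hu : X.vert h = X.vtxMap w u)
    (hv : X.vert (X.opp h) = X.vtxMap w v) (hh : 0 < (X.dir h).2) : Below p u v := by
  have h1 : X.Floored (X.vtxMap w u) := hu ▸ floored_of_snd hh.ne'
  have h2 := onFloor_vtxMap (wt_of_floored h1)
  have h3 : X.OnFloor (X.vtxMap w v) (onFloor u) := by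
    rw [← hv]
    rw [← hu] at h2
    exact h2.opp w hh.ne'
  have h4 := X.lt_of_dir_snd_pos hh
  rw [hu, hv, vtxMap_snd, vtxMap_snd] at h4
  refine ⟨((onFloor_vtxMap_iff h2.1).1 h3).symm, h4, fun x hx hlt => ?_⟩
  have h5 := (onFloor_vtxMap_iff h2.1).2 hx
  have h6 := (hu ▸ h2 : X.OnFloor (X.vert h) _).opp_le w hh h5
    (by rwa [hu, vtxMap_snd, vtxMap_snd])
  rwa [hv, vtxMap_snd, vtxMap_snd] at h6

theorem exists_slopes_of_below {v : (X.diagram w).Vtx} (hv : (X.diagram w).wt (onFloor v) = 0)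
    {f : X.Flag} (hf : X.flagVert f = X.vtxMap w v) (hd : X.flagDir f = (-slopeBelow p v, -1)) :
    ∃ f, X.flagVert f = X.vtxMap w v ∧ X.flagDir f = (slopeAbove p v, 1) := by
  have hfl := (onFloor_vtxMap hv).2.1
  have hs := (admissible_diagram (X := X) (w := w)).slopeAbove_sub v
  obtain ⟨f', hf', hd'⟩ := hfl.exists_up
  have hne : f' ≠ f := by
    rintro rfl
    rw [hd] at hd'
    simp at hd'
  have h1 : (X.flagDir f').2 = 1 := by
    have := abs_le.1 (abs_snd_le w f')
    omega
  refine ⟨f', hf', Prod.ext ?_ h1⟩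
  simp only
  rcases v with i | e
  · have h2 := congrArg Prod.fst (dir_add_of_marked w ⟨i, rfl⟩ hf' hf hne)
    rw [hd] at h2
    have h3 := coef_white_self (admissible_diagram (X := X) (w := w)) i
    change _ = (X.diagram w).coef i i at hs
    simp only [Prod.fst_add, Prod.fst_zero] at h2
    omega
  · have h3 := hs.trans (coef_floor (admissible_diagram (X := X) (w := w)) e)
    have he := diagram_elevator (w := w) e
    obtain ⟨f'', hf'', hd''⟩ : ∃ f'', X.flagVert f'' = X.vtxMap w (.inr e) ∧
        X.flagDir f'' = (if e.1.2 then ((X.diagram w).wt e.1.1 : ℤ) else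
          -((X.diagram w).wt e.1.1 : ℤ), 0) := by
      obtain ⟨⟨b, s⟩, hb⟩ := e
      cases s
      · exact CutStableMap.Elevator.exists_left he
      · exact CutStableMap.Elevator.exists_right he
    have h2 := congrArg Prod.fst (dir_add_of_not_marked (not_marked_endVtx w _) hf' hf hf'' hne
      (fun h => by rw [h, hd''] at h1; simp at h1) (fun h => by rw [h, hd''] at hd; simp at hd))
    rw [hd, hd''] at h2
    simp only [Prod.fst_add, Prod.fst_zero] at h2
    split_ifs at h2 h3 <;> omega

theorem exists_slopes (v : (X.diagram w).Vtx) (hv : (X.diagram w).wt (onFloor v) = 0) :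
    (∃ f, X.flagVert f = X.vtxMap w v ∧ X.flagDir f = (-slopeBelow p v, -1)) ∧
      ∃ f, X.flagVert f = X.vtxMap w v ∧ X.flagDir f = (slopeAbove p v, 1) := by
  induction v using (Finite.wellFounded_of_trans_of_irrefl
    (fun u v : (X.diagram w).Vtx => height p u < height p v)).induction with
  | _ v ih =>
    suffices h : ∃ f, X.flagVert f = X.vtxMap w v ∧ X.flagDir f = (-slopeBelow p v, -1) by
      obtain ⟨f, hf, hd⟩ := h
      exact ⟨⟨f, hf, hd⟩, exists_slopes_of_below hv hf hd⟩
    have hfl := onFloor_vtxMap hv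
    obtain ⟨f, hf, hd⟩ := hfl.2.1.exists_down
    refine ⟨f, hf, ?_⟩
    rcases flag_of_snd_neg hd with ⟨d, rfl⟩ | ⟨h, rfl, hh⟩
    · have h1 : X.dnVert d = X.vtxMap w v := hf
      rw [admissible_diagram.slopeBelow_of_bottom fun u hu => ?_]
      · rfl
      · have h2 := (onFloor_vtxMap_iff hfl.1).2 hu.1
        have h3 := (h1 ▸ hfl : X.OnFloor (X.dnVert d) _).dn_le w h2
        rw [h1, vtxMap_snd, vtxMap_snd] at h3
        exact absurd hu.2.1 (not_lt.2 h3)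
    · have h1 : X.vert h = X.vtxMap w v := hf
      obtain ⟨u, hu⟩ := (vtxMap_bijective (w := w)).2 (X.vert (X.opp h))
      have h2 : 0 < (X.dir (X.opp h)).2 := by
        rw [X.dir_opp]
        simpa using hh
      have h3 : Below p u v := below_of_edge hu.symm (by rw [X.opp_opp, h1]) h2
      obtain ⟨f', hf', hd'⟩ := (ih u h3.2.1 (h3.1 ▸ hv)).2
      have h4 : .inl (X.opp h) = f' := by
        refine vertical_ext w (hu.symm.trans hf'.symm) h2.ne' (by rw [hd']; simp) ?_
        rw [hd']
        simp only [zero_lt_one, iff_true]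
        exact h2
      rw [← h4] at hd'
      change X.dir (X.opp h) = _ at hd'
      rw [X.dir_opp, admissible_diagram.slope_eq h3] at hd'
      change X.dir h = _
      rw [← neg_neg (X.dir h), hd']
      rfl

theorem exists_edge {u v : (X.diagram w).Vtx} (huv : Below p u v) : ∃ h,
    X.vert h = X.vtxMap w u ∧ X.vert (X.opp h) = X.vtxMap w v ∧ X.dir h = (slopeAbove p u, 1) := by
  have hu := wt_onFloor_of_below admissible_diagram huv
  obtain ⟨-, f, hf, hd⟩ := exists_slopes u hu
  rcases flag_of_snd_pos (f := f) (by rw [hd]; simp) with ⟨e, rfl⟩ | ⟨h, rfl, hh⟩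
  · have h1 : X.upVert e = X.vtxMap w u := hf
    have h2 := onFloor_vtxMap hu
    have h3 := (onFloor_vtxMap_iff h2.1).2 huv.1.symm
    have h4 := (h1 ▸ h2 : X.OnFloor (X.upVert e) _).le_up w h3
    rw [h1, vtxMap_snd, vtxMap_snd] at h4
    exact absurd huv.2.1 (not_lt.2 h4)
  · obtain ⟨x, hx⟩ := (vtxMap_bijective (w := w)).2 (X.vert (X.opp h))
    have h1 := below_of_edge hf hx.symm hh
    rw [admissible_diagram.above_unique huv h1]
    exact ⟨h, hf, hx.symm, hd⟩

theorem vtxMap_pos (v : (X.diagram w).Vtx) : X.pos (X.vtxMap w v) = position p v := by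
  have key : (X.pos (X.vtxMap w v)).1 - (X.diagram w).floorX p (onFloor v) (height p v) =
      (X.pos (X.vtxMap w (.inl (onFloor v)))).1 -
        (X.diagram w).floorX p (onFloor v) (height p (.inl (onFloor v) : (X.diagram w).Vtx)) :=
    admissible_diagram.floor_induction
      (R := fun u v => (X.pos (X.vtxMap w u)).1 - (X.diagram w).floorX p (onFloor u) (height p u) =
        (X.pos (X.vtxMap w v)).1 - (X.diagram w).floorX p (onFloor v) (height p v))
      ⟨fun _ => rfl, fun h => h.symm, fun h h' => h.trans h'⟩ (fun u v huv => by
        obtain ⟨h, hu, hv, hd⟩ := exists_edge huv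
        have h1 := congrArg Prod.fst (X.affine h)
        have h2 := congrArg Prod.snd (X.affine h)
        rw [hu, hv, hd] at h1 h2
        simp only [Prod.fst_add, Prod.snd_add, Int.cast_one, mul_one, vtxMap_snd] at h1 h2
        rw [h1, admissible_diagram.floorX_sub huv, h2]
        ring) (v := (.inl (onFloor v) : (X.diagram w).Vtx)) rfl
  have h1 : X.pos (X.vtxMap w (.inl (onFloor v))) = p (onFloor v) := X.point _
  have h2 := congrArg Prod.fst (position_inl (δ := X.diagram w) (p := p) (onFloor v))
  change (X.diagram w).floorX p (onFloor v) _ = _ at h2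
  rw [h1, h2, sub_self, sub_eq_zero] at key
  exact Prod.ext key (vtxMap_snd v)

theorem exists_down_end {v : (X.diagram w).Vtx} (hv : (X.diagram w).wt (onFloor v) = 0)
    (hb : ∀ u, ¬ Below p u v) : ∃ d, X.dnVert d = X.vtxMap w v := by
  obtain ⟨⟨f, hf, hd⟩, -⟩ := exists_slopes v hv
  rcases flag_of_snd_neg (f := f) (by rw [hd]; simp) with ⟨d, rfl⟩ | ⟨h, rfl, hh⟩
  · exact ⟨d, hf⟩
  · obtain ⟨u, hu⟩ := (vtxMap_bijective (w := w)).2 (X.vert (X.opp h))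
    exact absurd (below_of_edge hu.symm (by rw [X.opp_opp]; exact hf)
      (by rw [X.dir_opp]; simpa using hh)) (hb u)

theorem exists_up_end {v : (X.diagram w).Vtx} (hv : (X.diagram w).wt (onFloor v) = 0)
    (ht : ∀ u, ¬ Below p v u) :
    ∃ d, X.upVert d = X.vtxMap w v ∧ X.leak d = (X.diagram w).leak (onFloor v) := by
  obtain ⟨-, f, hf, hd⟩ := exists_slopes v hv
  rcases flag_of_snd_pos (f := f) (by rw [hd]; simp) with ⟨d, rfl⟩ | ⟨h, rfl, hh⟩
  · refine ⟨d, hf, ?_⟩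
    rw [← admissible_diagram.slopeAbove_of_top ht]
    exact congrArg Prod.fst hd
  · obtain ⟨u, hu⟩ := (vtxMap_bijective (w := w)).2 (X.vert (X.opp h))
    exact absurd (below_of_edge hf hu.symm hh) (ht u)

end CountedMap


namespace FloorDiagram

variable {n : ℕ} {δ : FloorDiagram n} {p : Fin n → ℝ × ℝ}

/-- The tropical stable map `X` has the shape prescribed by the floor diagram `δ`. -/
structure Realizes (δ : FloorDiagram n) (p : Fin n → ℝ × ℝ) (X : CutStableMap n)
    (φ : δ.Vtx → X.V) : Prop where
  bijective : Function.Bijective φ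
  mark : ∀ i, X.markVert i = φ (.inl i)
  pos : ∀ v, X.pos (φ v) = position p v
  elevator : ∀ e : δ.Half,
    X.Elevator (φ (leftVtx e)) (φ (rightVtx e)) (δ.wt e.1.1) (δ.wind e.1.1 e.1.2)
  edge : ∀ u v, Below p u v → ∃ h, X.vert h = φ u ∧ X.vert (X.opp h) = φ v ∧
    X.dir h = (slopeAbove p u, 1)
  down : ∀ v, δ.wt (onFloor v) = 0 → (∀ u, ¬ Below p u v) → ∃ d, X.dnVert d = φ v
  up : ∀ v, δ.wt (onFloor v) = 0 → (∀ u, ¬ Below p v u) →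
    ∃ d, X.upVert d = φ v ∧ X.leak d = δ.leak (onFloor v)
  trivalent : X.Trivalent
  not_invariant : ∀ S : Set X.Z, S.Nonempty → ¬ ∀ z, z ∈ S ↔ ∃ z' ∈ S, X.glue (.inr z) = .inr z'

theorem flagIndex_ext (h : δ.Admissible p) {k k' : δ.FlagIndex} (hv : k.vert = k'.vert)
    (hd : k.dir p = k'.dir p) : k = k' := by
  have h1 : k ∈ univ.filter fun x : δ.FlagIndex => x.vert = k'.vert := by simpa using hv
  have h2 : k' ∈ univ.filter fun x : δ.FlagIndex => x.vert = k'.vert := by simp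
  generalize k'.vert = v at h1 h2
  rcases v with i | e
  · rcases Nat.eq_zero_or_pos (δ.wt i) with hi | hi
    · rw [filter_vert_white hi] at h1 h2
      simp only [mem_insert, mem_singleton] at h1 h2
      rcases h1 with rfl | rfl <;> rcases h2 with rfl | rfl <;>
        first | rfl | simp [FlagIndex.dir] at hd
    · rw [filter_vert_black hi] at h1 h2
      simp only [mem_insert, mem_singleton] at h1 h2
      rcases h1 with rfl | rfl <;> rcases h2 with rfl | rfl <;>
        first | rfl | (simp [FlagIndex.dir] at hd; omega)
  · rw [filter_vert_inr h] at h1 h2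
    obtain ⟨a, b, c, e1, e2, e3, -⟩ := exists_dir_index h e
    simp only [mem_insert, mem_singleton] at h1 h2
    rcases h1 with rfl | rfl | rfl <;> rcases h2 with rfl | rfl | rfl <;>
      first | rfl | (simp only [e1, e2, e3] at hd; simp at hd)

theorem card_flag (h : δ.Admissible p) {X : CutStableMap n} {φ : δ.Vtx → X.V}
    (hr : Realizes δ p X φ) : Nat.card X.Flag = Nat.card (δ.curveData p).Flag := by
  have h1 := X.sum_valence
  have h2 := (curveMap h).sum_valence
  simp only [hr.trivalent _, Finset.sum_const, Finset.card_univ, smul_eq_mul] at h1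
  have h3 : ∀ v, (curveMap h).valence v = 3 := curveData_trivalent h
  simp only [h3, Finset.sum_const, Finset.card_univ, smul_eq_mul] at h2
  have h4 : Fintype.card (curveMap h).V = Fintype.card X.V := Fintype.card_of_bijective hr.bijective
  rw [Nat.card_eq_fintype_card]
  refine Eq.trans ?_ (Nat.card_eq_fintype_card (α := (curveMap h).Flag)).symm
  omega

theorem len_eq_of_affine (h : δ.Admissible p) {X : CutStableMap n} {φ : δ.Vtx → X.V}
    (hr : Realizes δ p X φ) {e : CurveEdge δ p} {x : X.H} (h1 : X.vert x = φ e.tail)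
    (h2 : X.vert (X.opp x) = φ e.head) (h3 : X.dir x = e.dir) : X.len x = e.len := by
  have h4 := X.affine x
  rw [h1, h2, h3, hr.pos, hr.pos, curveEdge_affine h, add_right_inj] at h4
  rcases e with q | e
  · simpa [CurveEdge.dir] using (congrArg Prod.snd h4).symm
  · have := (wt_cast_pos e.1).ne'
    simpa [CurveEdge.dir, this] using (congrArg Prod.fst h4).symm

/-- A tropical stable map of the shape of a floor diagram is the one of the floor diagram. -/
theorem Realizes.nonempty_iso (h : δ.Admissible p) {X : CutStableMap n} {φ : δ.Vtx → X.V}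
    (hr : Realizes δ p X φ) : Nonempty (CutData.Iso (δ.curveData p) X.toCutData) := by
  have hE : ∀ e : CurveEdge δ p, ∃ x, X.vert x = φ e.tail ∧ X.vert (X.opp x) = φ e.head ∧
      X.dir x = e.dir := by
    rintro (q | e)
    · exact hr.edge _ _ q.2
    · have := hr.elevator e.1
      rw [e.2] at this
      exact this
  choose gE hE1 hE2 hE3 using hE
  choose gDn hDn using fun v : (δ.curveData p).Dn => hr.down v.1 v.2.1 v.2.2
  choose gUp hUp1 hUp2 using fun v : (δ.curveData p).Up => hr.up v.1 v.2.1 v.2.2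
  have hW : ∀ e : δ.Winding, ∃ r l, X.rtVert r = φ (leftVtx e.1) ∧ X.lfVert l = φ (rightVtx e.1) ∧
      X.rtWt r = δ.wt e.1.1.1 ∧ X.lfWt l = δ.wt e.1.1.1 ∧
      GlueChain X.glue r (δ.wind e.1.1.1 e.1.1.2 - 1) l := by
    intro e
    have := hr.elevator e.1
    obtain ⟨k, hk⟩ := Nat.exists_eq_add_of_lt e.2
    rw [zero_add] at hk
    rw [hk] at this ⊢
    exact this
  choose gRt gLf hRt hLf hRt' hLf' hC using hW
  have hZ : ∀ q : δ.Line, ∃ z, glueWalk X.glue (gRt ⟨q.1.1, (Nat.zero_lt_succ _).trans q.2⟩) q.1.2 =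
      .inr z := fun q => by
    have hq := q.2
    obtain ⟨z, hz, -⟩ := (hC ⟨q.1.1, (Nat.zero_lt_succ _).trans q.2⟩).exists_right (j := q.1.2)
      (by simp only; omega)
    exact ⟨z, hz⟩
  choose gZ hZ using hZ
  let gH : (δ.curveData p).H → X.H := fun x => if x.2 then gE x.1 else X.opp (gE x.1)
  let G : (δ.curveData p).Flag → X.Flag :=
    Sum.map gH (Sum.map gDn (Sum.map gUp (Sum.map gRt gLf)))
  have hGv : ∀ f, X.flagVert (G f) = φ ((δ.curveData p).flagVert f) := by
    rintro (⟨e, s⟩ | v | v | e | e)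
    · cases s
      · exact hE2 e
      · exact hE1 e
    · exact hDn v
    · exact hUp1 v
    · exact hRt e
    · exact hLf e
  have hGd : ∀ f, X.flagDir (G f) = (δ.curveData p).flagDir f := by
    rintro (⟨e, s⟩ | v | v | e | e)
    · cases s
      · change X.dir (X.opp (gE e)) = -e.dir
        rw [X.dir_opp, hE3]
      · exact hE3 e
    · rfl
    · exact Prod.ext (hUp2 v) rfl
    · exact Prod.ext (congrArg Nat.cast (hRt' e)) rfl
    · exact Prod.ext (congrArg (fun x : ℕ => -(x : ℤ)) (hLf' e)) rfl
  have hGi : Function.Injective G := by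
    intro f f' hff
    refine (flagIndex_bijective h).1 (flagIndex_ext h ?_ ?_)
    · rw [vert_flagIndex, vert_flagIndex]
      apply hr.bijective.1
      rw [← hGv, ← hGv, hff]
    · rw [dir_flagIndex, dir_flagIndex, ← hGd, ← hGd, hff]
  have hGb : Function.Bijective G := hGi.bijective_of_nat_card_le (card_flag h hr).le
  obtain ⟨bH, hGb⟩ := Sum.map_bijective.1 hGb
  obtain ⟨bDn, hGb⟩ := Sum.map_bijective.1 hGb
  obtain ⟨bUp, hGb⟩ := Sum.map_bijective.1 hGb
  obtain ⟨bRt, bLf⟩ := Sum.map_bijective.1 hGb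
  have bZ : Function.Bijective gZ := by
    constructor
    · intro q q' hqq
      have hlt := q.2
      have hlt' := q'.2
      have h1 := hZ q
      rw [hqq, ← hZ q'] at h1
      obtain ⟨h2, h3⟩ := glueWalk_injective h1
        (fun i hi => (hC _).2 i (hi.trans (by simp only; omega)))
        (fun i hi => (hC _).2 i (hi.trans (by simp only; omega)))
      have h4 := congrArg (fun x : δ.Winding => x.1) (bRt.1 h2)
      exact Subtype.ext (Prod.ext h4 h3)
    · intro z
      obtain ⟨r, j, hj⟩ := exists_glueWalk_eq (e := X.glue) (fun S hS => hr.not_invariant S hS) z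
      obtain ⟨e, rfl⟩ := bRt.2 r
      have hlt := (hC e).lt_of_inr hj
      refine ⟨⟨(e.1, j), by simp only; omega⟩, ?_⟩
      have h1 := hZ ⟨(e.1, j), by simp only; omega⟩
      exact Sum.inr_injective (h1.symm.trans hj)
  have hrt : ∀ r : δ.Winding ⊕ δ.Line, X.glue (Sum.map gRt gZ r) =
      glueWalk X.glue (gRt ⟨(rightSlot r).1.1, (Nat.zero_le _).trans_lt (rightSlot r).2⟩)
        (rightSlot r).1.2 := by
    rintro (e | q)
    · rfl
    · change X.glue (.inr (gZ q)) = glueWalk X.glue _ (q.1.2 + 1)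
      rw [glueWalk, show glueWalk X.glue (gRt ⟨(rightSlot (.inr q)).1.1, _⟩) q.1.2 = _ from hZ q]
      rfl
  have hlf : ∀ l : δ.Winding ⊕ δ.Line, Sum.map gLf gZ l =
      glueWalk X.glue (gRt ⟨(leftSlot l).1.1, (Nat.zero_le _).trans_lt (leftSlot l).2⟩)
        (leftSlot l).1.2 := by
    rintro (e | q)
    · exact (hC e).1.symm
    · exact (hZ q).symm
  exact ⟨{
    eV := .ofBijective _ hr.bijective
    eH := .ofBijective _ bH
    eDn := .ofBijective _ bDn
    eUp := .ofBijective _ bUp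
    eRt := .ofBijective _ bRt
    eLf := .ofBijective _ bLf
    eZ := .ofBijective _ bZ
    vert := fun x => hGv (.inl x)
    opp := fun ⟨e, s⟩ => by
      cases s
      · exact X.opp_opp _
      · rfl
    len := fun ⟨e, s⟩ => by
      have h1 := len_eq_of_affine h hr (hE1 e) (hE2 e) (hE3 e)
      cases s
      · exact (X.len_opp _).trans h1
      · exact h1
    dir := fun x => hGd (.inl x)
    dnVert := hDn
    upVert := hUp1
    leak := hUp2
    rtVert := hRt
    rtWt := hRt'
    lfVert := hLf
    lfWt := hLf'
    lineWt := fun q => by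
      have h1 := X.leftWt_glueWalk (gRt ⟨q.1.1, (Nat.zero_lt_succ _).trans q.2⟩) q.1.2
      rw [hZ q] at h1
      exact h1.trans (hRt' _)
    lineY := fun q => by
      have h1 := X.leftY_glueWalk (gRt ⟨q.1.1, (Nat.zero_lt_succ _).trans q.2⟩) q.1.2
      rw [hZ q, hRt, hr.pos] at h1
      refine h1.trans ?_
      change (p (level (leftVtx q.1.1))).2 = _
      rw [level_leftVtx]
    markVert := hr.mark
    pos := hr.pos
    glue := fun r => by
      refine (hrt r).trans (Eq.trans ?_ (hlf (δ.glueEquiv r)).symm)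
      have := δ.leftSlot_glueEquiv r
      simp only [this] }⟩

end FloorDiagram


theorem CutData.Iso.elevator {n : ℕ} {C D : CutData n} (e : CutData.Iso C D) {u v : C.V} {ω k : ℕ}
    (h : C.Elevator u v ω k) : D.Elevator (e.eV u) (e.eV v) ω k := by
  cases k with
  | zero =>
    obtain ⟨h, rfl, rfl, h2⟩ := h
    exact ⟨e.eH h, e.vert h, by rw [e.opp, e.vert], by rw [e.dir, h2]⟩
  | succ k =>
    obtain ⟨r, l, rfl, rfl, rfl, h4, h5⟩ := h
    exact ⟨e.eRt r, e.eLf l, e.rtVert r, e.lfVert l, e.rtWt r, (e.lfWt l).trans h4,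
      e.glueChain_iff.2 h5⟩

theorem CutData.Elevator.eq_of_unique {n : ℕ} {C : CutData n} {u v v' : C.V} {ω k k' : ℕ}
    (hu : ∀ f f', C.flagVert f = u → C.flagVert f' = u → C.flagDir f = ((ω : ℤ), 0) →
      C.flagDir f' = ((ω : ℤ), 0) → f = f')
    (h : C.Elevator u v ω k) (h' : C.Elevator u v' ω k') : k = k' := by
  cases k with
  | zero =>
    cases k' with
    | zero => rfl
    | succ k' =>
      obtain ⟨h, h1, -, h2⟩ := h
      obtain ⟨r, l, h1', -, rfl, -⟩ := h'
      cases hu (.inl h) (.inr (.inr (.inr (.inl r)))) h1 h1' h2 rfl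
  | succ k =>
    obtain ⟨r, l, h1, -, rfl, -, hc⟩ := h
    cases k' with
    | zero =>
      obtain ⟨h', h1', -, h2'⟩ := h'
      cases hu (.inr (.inr (.inr (.inl r)))) (.inl h') h1 h1' rfl h2'
    | succ k' =>
      obtain ⟨r', l', h1', -, h2', -, hc'⟩ := h'
      cases hu (.inr (.inr (.inr (.inl r)))) (.inr (.inr (.inr (.inl r')))) h1 h1' rfl
        (Prod.ext (congrArg Nat.cast h2') rfl)
      rw [(hc.unique hc').1]

namespace FloorDiagram

variable {n : ℕ} {δ δ' : FloorDiagram n} {p : Fin n → ℝ × ℝ}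

theorem curveData_elevator (p : Fin n → ℝ × ℝ) (e : δ.Half) : (δ.curveData p).Elevator (leftVtx e)
    (rightVtx e) (δ.wt e.1.1) (δ.wind e.1.1 e.1.2) := by
  rcases he : δ.wind e.1.1 e.1.2 with _ | k
  · exact ⟨(.inr ⟨e, he⟩, true), rfl, rfl, rfl⟩
  · have he' : 0 < δ.wind e.1.1 e.1.2 := by omega
    have h : ∀ m, m = δ.wind e.1.1 e.1.2 - 1 → GlueChain δ.glueEquiv ⟨e, he'⟩ m ⟨e, he'⟩ :=
      fun m hm => hm ▸ glueChain_winding ⟨e, he'⟩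
    exact ⟨⟨e, he'⟩, ⟨e, he'⟩, rfl, rfl, rfl, rfl, h k (by omega)⟩

theorem flag_ext (h : δ.Admissible p) {f f' : (δ.curveData p).Flag}
    (hv : (δ.curveData p).flagVert f = (δ.curveData p).flagVert f')
    (hd : (δ.curveData p).flagDir f = (δ.curveData p).flagDir f') : f = f' := by
  refine (flagIndex_bijective h).1 (flagIndex_ext h ?_ ?_)
  · rw [vert_flagIndex, vert_flagIndex, hv]
  · rw [dir_flagIndex, dir_flagIndex, hd]

theorem exists_index_iso (h : δ.Admissible p) (h' : δ'.Admissible p)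
    (e : CutData.Iso (δ.curveData p) (δ'.curveData p)) (k : δ.FlagIndex) :
    ∃ k' : δ'.FlagIndex, k'.vert = e.eV k.vert ∧ k'.dir p = k.dir p := by
  obtain ⟨f, rfl⟩ := (flagIndex_bijective h).2 k
  refine ⟨flagIndex h' (e.eFlag f), ?_, ?_⟩
  · rw [vert_flagIndex, vert_flagIndex, e.flagVert_eFlag]
  · rw [dir_flagIndex, dir_flagIndex, e.flagDir_eFlag]

theorem wt_eq_of_pos (h : δ.Admissible p) (h' : δ'.Admissible p)
    (e : CutData.Iso (δ.curveData p) (δ'.curveData p)) {i : Fin n} (hi : 0 < δ.wt i) :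
    δ'.wt i = δ.wt i := by
  obtain ⟨k, hk, hd⟩ := exists_index_iso h h' e (.inr (⟨(i, false), hi⟩, true))
  have hv : e.eV (.inl i : δ.Vtx) = (.inl i : δ'.Vtx) := (e.markVert i).symm
  have hk' : k ∈ univ.filter fun x : δ'.FlagIndex => x.vert = .inl i := by
    rw [mem_filter]
    exact ⟨mem_univ _, hk.trans hv⟩
  have hd0 : k.dir p = ((δ.wt i : ℤ), 0) := hd
  rcases Nat.eq_zero_or_pos (δ'.wt i) with hi' | hi'
  · rw [filter_vert_white hi'] at hk'
    simp only [mem_insert, mem_singleton] at hk'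
    rcases hk' with rfl | rfl <;> simp [FlagIndex.dir] at hd0
  · rw [filter_vert_black hi'] at hk'
    simp only [mem_insert, mem_singleton] at hk'
    rcases hk' with rfl | rfl <;> simp [FlagIndex.dir] at hd0 <;> omega

theorem wt_eq_of_iso (h : δ.Admissible p) (h' : δ'.Admissible p)
    (e : CutData.Iso (δ.curveData p) (δ'.curveData p)) (i : Fin n) : δ'.wt i = δ.wt i := by
  rcases Nat.eq_zero_or_pos (δ.wt i) with hi | hi
  · rcases Nat.eq_zero_or_pos (δ'.wt i) with hi' | hi'
    · rw [hi, hi']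
    · exact (wt_eq_of_pos h' h e.symm hi').symm
  · exact wt_eq_of_pos h h' e hi

theorem eV_inr (h : δ.Admissible p) (h' : δ'.Admissible p)
    (e : CutData.Iso (δ.curveData p) (δ'.curveData p)) {b : Fin n} {s : Bool} (hb : 0 < δ.wt b)
    (hb' : 0 < δ'.wt b) : e.eV (.inr ⟨(b, s), hb⟩ : δ.Vtx) = (.inr ⟨(b, s), hb'⟩ : δ'.Vtx) := by
  obtain ⟨k, hk, hd⟩ := exists_index_iso h h' e (.inr (⟨(b, s), hb⟩, s))
  have hv : FlagIndex.vert (.inr (⟨(b, s), hb⟩, s) : δ.FlagIndex) = .inr ⟨(b, s), hb⟩ := by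
    cases s <;> rfl
  rw [hv] at hk
  have hpos := congrArg Prod.snd (e.pos (.inr ⟨(b, s), hb⟩ : δ.Vtx))
  have hmark : ∀ i, e.eV (.inl i : δ.Vtx) = (.inl i : δ'.Vtx) := fun i => (e.markVert i).symm
  rcases hx : e.eV (.inr ⟨(b, s), hb⟩ : δ.Vtx) with i | ⟨⟨c, t⟩, hc⟩
  · have := e.eV.injective (hx.trans (hmark i).symm)
    cases this
  · rw [hx] at hpos hk
    obtain rfl : c = b := h.snd_injective _ _ hpos
    have hk' : k ∈ univ.filter fun x : δ'.FlagIndex => x.vert = .inr ⟨(c, t), hc⟩ := by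
      rw [mem_filter]
      exact ⟨mem_univ _, hk⟩
    rw [filter_vert_inr h'] at hk'
    simp only [mem_insert, mem_singleton] at hk'
    rcases hk' with rfl | rfl | rfl
    · cases s <;> simp [FlagIndex.dir] at hd
    · cases s <;> simp [FlagIndex.dir] at hd
    · cases s <;> cases t <;> first | rfl | (simp [FlagIndex.dir] at hd; omega)

theorem onFloor_eV (h : δ.Admissible p) (e : CutData.Iso (δ.curveData p) (δ'.curveData p))
    (v : δ.Vtx) : onFloor (δ := δ') (e.eV v) = onFloor v := by
  have key : onFloor (δ := δ') (e.eV v) = onFloor (δ := δ') (e.eV (.inl (onFloor v) : δ.Vtx)) :=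
    h.floor_induction (R := fun u v : δ.Vtx => onFloor (δ := δ') (e.eV u) =
        onFloor (δ := δ') (e.eV v)) ⟨fun _ => rfl, fun h => h.symm, fun h h' => h.trans h'⟩
      (fun u v huv => by
        have h1 := e.vert (.inl ⟨(u, v), huv⟩, true)
        have h2 := e.vert (.inl ⟨(u, v), huv⟩, false)
        have h3 := e.opp (.inl ⟨(u, v), huv⟩, true)
        have h4 := e.dir (.inl ⟨(u, v), huv⟩, true)
        change _ = e.eH (.inl ⟨(u, v), huv⟩, false) at h3
        rw [← h3] at h2
        rcases hx : e.eH (.inl ⟨(u, v), huv⟩, true) with ⟨q | x, s⟩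
        · rw [hx] at h1 h2
          change _ = e.eV u at h1
          change _ = e.eV v at h2
          rw [← h1, ← h2]
          cases s
          · exact q.2.1.symm
          · exact q.2.1
        · rw [hx] at h4
          have h5 := congrArg Prod.snd h4
          cases s <;> simp [CurveEdge.dir] at h5)
      (v := (.inl (onFloor v) : δ.Vtx)) rfl
  rw [key]
  exact congrArg (onFloor (δ := δ')) (e.markVert (onFloor v)).symm

/-- A floor diagram is determined by its tropical stable map. -/
theorem eq_of_iso (h : δ.Admissible p) (h' : δ'.Admissible p)
    (hw : ∀ i, δ.wt i = 0 → ∀ s, δ.wind i s = 0) (hw' : ∀ i, δ'.wt i = 0 → ∀ s, δ'.wind i s = 0)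
    (e : CutData.Iso (δ.curveData p) (δ'.curveData p)) : δ = δ' := by
  have hwt : ∀ i, δ'.wt i = δ.wt i := wt_eq_of_iso h h' e
  have key : ∀ b s, δ.floor b s = δ'.floor b s ∧ δ.wind b s = δ'.wind b s := by
    intro b s
    rcases Nat.eq_zero_or_pos (δ.wt b) with hb | hb
    · have hb' := (hwt b).trans hb
      exact ⟨(h.floor_white b hb s).trans (h'.floor_white b hb' s).symm,
        (hw b hb s).trans (hw' b hb' s).symm⟩
    · have hb' : 0 < δ'.wt b := by rw [hwt]; exact hb
      have hv := eV_inr h h' e (s := s) hb hb'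
      have hm : e.eV (.inl b : δ.Vtx) = (.inl b : δ'.Vtx) := (e.markVert b).symm
      constructor
      · have h1 := onFloor_eV h e (.inr ⟨(b, s), hb⟩)
        rw [hv] at h1
        exact h1.symm
      · have h1 := e.elevator (curveData_elevator p (⟨(b, s), hb⟩ : δ.Half))
        have h2 := curveData_elevator p (⟨(b, s), hb'⟩ : δ'.Half)
        have hl : e.eV (leftVtx (⟨(b, s), hb⟩ : δ.Half)) = leftVtx (⟨(b, s), hb'⟩ : δ'.Half) := by
          cases s
          · exact hm
          · exact hv
        rw [hl] at h1
        simp only [hwt] at h2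
        exact CutData.Elevator.eq_of_unique (fun f f' hf hf' hd hd' =>
          flag_ext h' (hf.trans hf'.symm) (hd.trans hd'.symm)) h1 h2
  refine FloorDiagram.ext ?_ ?_ ?_
  · funext b s
    exact (key b s).1
  · funext b s
    exact (key b s).2
  · funext i
    exact (hwt i).symm

end FloorDiagram


namespace CountedMap

variable {Δ : Multiset ℤ} {d₁ d₂ g n : ℕ} {p : Fin n → ℝ × ℝ}

open FloorDiagram

theorem realizes_diagram (X : CountedMap Δ d₁ d₂ g p) (w : WellStretched Δ d₁ d₂ g p) :
    Realizes (X.diagram w) p X.toCutStableMap (X.vtxMap w) where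
  bijective := vtxMap_bijective
  mark _ := rfl
  pos := vtxMap_pos
  elevator := diagram_elevator
  edge _ _ := exists_edge
  down _ := exists_down_end
  up _ := exists_up_end
  trivalent := X.trivalent
  not_invariant _ hS := not_glue_invariant w hS

theorem valid_diagram (X : CountedMap Δ d₁ d₂ g p) (w : WellStretched Δ d₁ d₂ g p) :
    (X.diagram w).Valid (fun i => (p i).1) Δ d₁ d₂ := by
  have h : (X.diagram w).Admissible p := admissible_diagram
  obtain ⟨e⟩ := (realizes_diagram X w).nonempty_iso h
  have hb := (curveData_hasBidegree_iff h).1 (e.hasBidegree X.bidegree)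
  exact
    { floor_white := h.floor_white
      wind_white := fun i hi s => dif_pos (diagram_wt_eq_zero.1 hi)
      wt_floor := h.wt_floor
      floor_ne := h.floor_ne
      lt_or_wind := h.lt_or_wind
      card_whites := hb.1
      leaky := (curveData_leaks h).symm.trans (e.hasLeakyDegree X.leakyDegree)
      connected := graph_connected_of_curveData (e.connected X.connected)
      degree := hb.2 }

end CountedMap

namespace FloorDiagram

variable {Δ : Multiset ℤ} {d₁ d₂ g n : ℕ} {p : Fin n → ℝ × ℝ} {δ : FloorDiagram n}

theorem Valid.admissible (w : WellStretched Δ d₁ d₂ g p)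
    (hv : δ.Valid (fun i => (p i).1) Δ d₁ d₂) : δ.Admissible p where
  floor_white := hv.floor_white
  wt_floor := hv.wt_floor
  floor_ne := hv.floor_ne
  lt_or_wind := hv.lt_or_wind
  fst_injective := w.fst_injective
  snd_injective := w.snd_injective
  floorX_lt _ _ b c := floorX_lt_of_wt_le w hv.wt_le b c

/-- The class of tropical stable maps of a floor diagram. -/
noncomputable def toClass (w : WellStretched Δ d₁ d₂ g p)
    (δ : {δ : FloorDiagram n // δ.Valid (fun i => (p i).1) Δ d₁ d₂}) :
    CountedMap.Class Δ d₁ d₂ g p :=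
  Quotient.mk _ (countedMap (δ.2.admissible w) δ.2 w.card)

theorem toClass_bijective (w : WellStretched Δ d₁ d₂ g p) : Function.Bijective (toClass w) := by
  constructor
  · intro δ δ' hδ
    obtain ⟨e⟩ := Quotient.exact hδ
    exact Subtype.ext (eq_of_iso (δ.2.admissible w) (δ'.2.admissible w) δ.2.wind_white
      δ'.2.wind_white e)
  · intro q
    induction q using Quotient.inductionOn with
    | _ X =>
      refine ⟨⟨X.diagram w, CountedMap.valid_diagram X w⟩, Quotient.sound ?_⟩
      exact (CountedMap.realizes_diagram X w).nonempty_iso CountedMap.admissible_diagram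

theorem finite_class_and_tropCount_eq (w : WellStretched Δ d₁ d₂ g p) :
    Finite (CountedMap.Class Δ d₁ d₂ g p) ∧
      tropCount Δ d₁ d₂ g p = count (fun i => (p i).1) Δ d₁ d₂ := by
  have := finite_valid (fun i => (p i).1) Δ d₁ d₂
  exact ⟨Finite.of_surjective _ (toClass_bijective w).2,
    (finsum_eq_of_bijective _ (toClass_bijective w)
      fun δ => (curveData_mult (δ.2.admissible w)).symm).symm⟩

end FloorDiagram

theorem mainTheorem3 (Δ : Multiset ℤ) (d₁ d₂ g n : ℕ) (hd₁ : 0 < d₁) (hd₂ : 0 < d₂) (hg : 0 < g)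
    (hn : n + 1 = 2 * d₂ + g) (hΔ : Multiset.card Δ = d₂) (hsum : Δ.sum = 0) :
    ∃ (C : ℝ) (walls : Finset ((Fin n → ℝ × ℝ) →ₗ[ℝ] ℝ)), (∀ φ ∈ walls, φ ≠ 0) ∧
      ∀ p : Fin n → ℝ × ℝ, HorizontallyStretched C p → (∀ φ ∈ walls, φ p ≠ 0) →
        ∀ T : ℝ, 0 < T → ∀ P : Fin n → AddCircle T, Function.Injective P →
          Finite (CurledPearlChain.Class T Δ d₁ d₂ g P) ∧
          Finite (CountedMap.Class Δ d₁ d₂ g p) ∧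
          pearlCount T Δ d₁ d₂ g P = tropCount Δ d₁ d₂ g p := by
  classical
  let y : Fin n → ((Fin n → ℝ × ℝ) →ₗ[ℝ] ℝ) := fun i =>
    (LinearMap.snd ℝ ℝ ℝ).comp (LinearMap.proj i)
  refine ⟨8 * n * FloorDiagram.degreeBound Δ d₁,
    (univ.filter fun q : Fin n × Fin n => q.1 ≠ q.2).image fun q => y q.1 - y q.2, ?_, ?_⟩
  · intro φ hφ h0
    simp only [mem_image, mem_filter, mem_univ, true_and, Prod.exists] at hφ
    obtain ⟨i, j, hij, rfl⟩ := hφ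
    have := LinearMap.congr_fun h0 (Pi.single i (0, 1))
    simp [y, hij.symm] at this
  · intro p hs hw T hT P hP
    have w : WellStretched Δ d₁ d₂ g p :=
      { pos := hd₂
        card := hn
        snd_injective := fun i j hij => by
          by_contra hne
          refine hw (y i - y j) (mem_image.2 ⟨(i, j), by simpa using hne, rfl⟩) ?_
          simp [y, hij]
        stretched := hs }
    have : Fact (0 < T) := ⟨hT⟩
    let r : Fin n → ℝ := fun i => (AddCircle.equivIco T 0 (P i)).1
    have hr : ∀ i, r i ∈ Set.Ico 0 T := fun i => by
      simpa using (AddCircle.equivIco T 0 (P i)).2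
    have hrP : (fun i => (r i : AddCircle T)) = P := funext fun i => AddCircle.coe_equivIco
    have hri : Function.Injective r := fun i j hij => hP (by
      rw [← hrP]
      simp only [hij])
    obtain ⟨h1, h2⟩ := finite_class_and_pearlCount_eq (Δ := Δ) hT hr (by rw [hrP]; exact hP) hd₁ hn
    obtain ⟨h3, h4⟩ := FloorDiagram.finite_class_and_tropCount_eq w
    rw [hrP] at h1 h2
    exact ⟨h1, h3, by
      rw [h2, h4, FloorDiagram.count_eq hri fun i j hij => w.fst_injective i j hij]⟩
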